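/- **Conventions.** Let $(\mathcal C,\otimes,\mathbf 1,P)$ be a symmetric monoidal category; associativity and unit constraints are suppressed in formulas. For an algebra object $(A,\mu,\eta)$ put $\mu_0=\eta$, $\mu_1=\mathrm{Id}$, $\mu_k=\mu\circ(\mu_{k-1}\otimes \mathrm{Id})$ and $\mu_{k_1,\dots,k_r}=\mu_{k_1}\otimes\cdots\otimes\mu_{k_r}$ $(k_i\ge 0)$; for $a,b:\mathbf 1\to A^{\otimes n}$ let $a\cdot b$ be their product with respect to the factorwise multiplication $A^{\otimes n}\otimes A^{\otimes n}\to A^{\otimes n}$. For $\sigma\in\mathfrak S_n$ let $P_\sigma:A^{\otimes n}\to A^{\otimes n}$ be the symmetry that moves the factor $i$ to the place $\sigma(i)$, so $P_{\sigma\tau}=P_\sigma P_\tau$. **XC-algebras.** An XC-algebra object is an algebra object $A$ with multiplicatively invertible arrows $R:\mathbf 1\to A\otimes A$ and $\kappa:\mathbf 1\to A$ such that, where $R_{ij}$ denotes $R$ with its first leg at place $i$, its second leg at place $j$ and units elsewhere (and similarly $\kappa_i$), $R^{\pm1}=(\kappa\otimes\kappa)\cdot R^{\pm1}\cdot(\kappa^{-1}\otimes\kappa^{-1})$;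 $\mu_3(R_{31}\cdot\kappa_2)=\mu_3(R_{13}\cdot\kappa_2^{-1})$; $\eta\otimes\kappa^{-1}=(\mu\otimes\mu_3)(R_{15}\cdot R_{23}^{-1}\cdot\kappa_4^{-1})$; $\kappa\otimes \eta=(\mu_3\otimes\mu)(R_{15}^{-1}\cdot R_{34}\cdot\kappa_2)$; $R_{12}R_{13}R_{23}=R_{23}R_{13}R_{12}$. Let $\mathsf{XC}$ be the PROP for XC-algebras, i.e. the symmetric monoidal category presented by generators $\mu:2\to1$, $\eta:0\to1$, $R^{\pm1}:0\to2$, $\kappa^{\pm1}:0\to1$ and the relations above together with those of an algebra object. An XC-algebra object $A$ in $\mathcal C$ is the same as a symmetric monoidal functor $A:\mathsf{XC}\to\mathcal C$, and $A(\mathrm{Hom}_{\mathsf{XC}}(0,n))\subseteq \mathrm{Hom}_{\mathcal C}(\mathbf 1,A^{\otimes n})$ denotes the image. **XC-tangles.** An XC-tangle diagram with $n$ strands is a finite directed graph with vertices of valence $1,2,4$, where tetravalent vertices (crossings) carry a sign and a cyclic order of the half-edges in which the two incoming ones are adjacent, bivalent vertices have one incoming and one outgoing half-edge, every edge carries a rotation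 number in $\{-1,0,1\}$, the maximal directed paths going straight at crossings (strands) join univalent vertices (so that there are no closed components), and the sets $V_{out}$ (starts of strands) and $V_{in}$ (ends of strands) are totally ordered. At each crossing one passage is over and the other one is under, as when the crossing is drawn according to its sign. An XC-tangle is an equivalence class of diagrams (up to isomorphism) under the following local moves. Here a strand segment is written as the sequence of its passages $o_x,u_x$ (over, under at the crossing $x$) in the order of the orientation, with the nonzero rotation numbers $[\pm1]$ of edges between them; all other edges have rotation number $0$, and segments of a move are separated by $|$. - ($\widehat\Omega0r$) consecutive edges $[i],[j]$ joined by a bivalent vertex $\leftrightarrow$ one edge $[i+j]$, for $i,j,i+j\in\{-1,0,1\}$; - ($\widehat\Omega0a,b$) $o_x\,|\,u_x\leftrightarrow [1]o_x[-1]\,|\,[1]u_x[-1]$, for $x$ of either sign; - ($\widehat\Omega1f$) $o_x[-1]u_x\leftrightarrow u_x[1]o_x$, $x$ positive; - ($\widehat\Omega2a,b$) $o_xo_y\,|\,u_xu_y\leftrightarrow\ \cdot\,|\,\cdot$, with $x,y$ of opposite signs; - ($\widehat\Omega2c$) $o_yo_x\,|\,u_x[1]u_y\leftrightarrow\ \cdot\,|\,[1]$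 and ($\widehat\Omega2d$) $o_x[-1]o_y\,|\,u_yu_x\leftrightarrow[-1]\,|\,\cdot$, with $x$ positive and $y$ negative; - ($\widehat\Omega3$) $o_{2}o_{1}\,|\,o_{3}u_{1}\,|\,u_{3}u_{2}\leftrightarrow o_{1}o_{2}\,|\,u_{1}o_{3}\,|\,u_{2}u_{3}$, with three positive crossings. XC-tangles form a strict symmetric monoidal category $\mathcal T^{\mathrm{XC}}$: the objects are the integers $n\ge0$, there are only endomorphisms, $\mathrm{End}(n)$ is the set of XC-tangles with $n$ strands, $T_2\circ T_1$ is given by glueing the $i$-th incoming vertex of $T_1$ to the $i$-th outgoing vertex of $T_2$, $\otimes$ is ordered disjoint union, the symmetry $P_{n,m}$ consists of $n+m$ edges of rotation number $0$, from the $i$-th start to the end number $i+m$ (mod $n+m$). Let $X,X^-\in\mathrm{End}(2)$ be the single positive, respectively negative, crossing with permutation $(12)$, where the first strand is the overpassing one in $X$ and the underpassing one in $X^-$, and let $C,C^-\in \mathrm{End}(1)$ be a single edge with rotation number $1$, respectively $-1$. **The virtual category of elements.** $v\mathcal E(A)$ is the strict symmetric monoidal category with objects $n\ge0$, only endomorphisms,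 $\mathrm{End}(n)=A(\mathrm{Hom}_{\mathsf{XC}}(0,n))\times\mathfrak S_n$, $(u,\sigma)\circ(v,\tau)=(P_{\tau^{-1}}(u)\cdot v,\sigma\tau)$, identity $(\eta^{\otimes n},\mathrm{Id})$, $(u,\sigma)\otimes(v,\xi)=(u\otimes v,\sigma\otimes\xi)$ with the block product of permutations, and symmetry $(\eta^{\otimes(n+m)},i\mapsto i+m \bmod (n+m))$. **External algebra actions.** Both categories carry the following operations. - Permutations: for $\rho,\tau\in\mathfrak S_n$, renumber the ends of the strands by $\rho$ and their starts by $\tau$; on $v\mathcal E(A)$ this is $(u,\sigma)\mapsto(P_\tau(u),\rho\sigma\tau^{-1})$. - $\mu_{k_1,\dots,k_r}$, from $\mathrm{End}(k_1+\cdots+k_r)$ to $\mathrm{End}(r)$: merge the first $k_1$ strands, then the next $k_2$ strands, etc. In each block, the last strand is traversed first and the end of each strand is glued to the start of the preceding one; where $k_i=0$, an edge of rotation number $0$ is inserted as the $i$-th strand. On $v\mathcal E(A)$ this is $(u,\sigma)\mapsto(\mu_{k_1,\dots,k_r}\circ u,\tilde\sigma)$. On both sides the new permutation $\tilde\sigma$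 is as follows: it fixes each $i$ with $k_i=0$; it permutes the remaining indices among themselves, in such a way that their images are in the same relative order as the images under $\sigma$ of the first elements of the blocks. A functor that is the identity on objects is *compatible with the external algebra action* if it commutes with all these operations. **Theorem.** Let $A$ be an XC-algebra object in a symmetric monoidal category $\mathcal C$. There exists a unique (strict) symmetric monoidal functor $$Z_A:\mathcal T^{\mathrm{XC}}\to v\mathcal E(A)$$ which is the identity on objects, is compatible with the external algebra action and satisfies $$Z_A(X)=(R,(12)),\quad Z_A(X^-)=(R_{21}^{-1},(12)),\quad Z_A(C)=(\kappa^{-1},\mathrm{Id}),\quad Z_A(C^-)=(\kappa,\mathrm{Id}).$$ Moreover, this functor is full. -/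

import Mathlib

open CategoryTheory MonoidalCategory

universe v u

namespace XCT

/-! ### Tensor powers and iterated multiplications -/

section Generic

variable {C : Type u} [Category.{v} C] [MonoidalCategory C]

/-- The tensor power `X^{⊗ n}`, bracketed to the left. -/
@[reducible]
def tpow (X : C) : ℕ → C
  | 0 => 𝟙_ C
  | n + 1 => tpow X n ⊗ X

/-- The canonical coherence isomorphism `X^{⊗ n} ⊗ X^{⊗ m} ≅ X^{⊗ (n + m)}`. -/
def tpowAdd (X : C) (n : ℕ) : ∀ m : ℕ, tpow X n ⊗ tpow X m ≅ tpow X (n + m)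
  | 0 => ρ_ _
  | m + 1 => (α_ _ _ _).symm ≪≫ whiskerRightIso (tpowAdd X n m) X

/-- The coherence arrow `X ⟶ X^{⊗ 1}`. -/
def toPow1 (X : C) : X ⟶ tpow X 1 := (λ_ X).inv

/-- The coherence arrow `X ⊗ X ⟶ X^{⊗ 2}`. -/
def toPow2 (X : C) : X ⊗ X ⟶ tpow X 2 := (λ_ X).inv ▷ X

/-- The tensor product of two points `𝟙 ⟶ Y`, `𝟙 ⟶ Z`. -/
def ptensor {Y Z : C} (y : 𝟙_ C ⟶ Y) (z : 𝟙_ C ⟶ Z) : 𝟙_ C ⟶ Y ⊗ Z :=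
  (λ_ (𝟙_ C)).inv ≫ (y ⊗ₘ z)

/-- The tensor product `u ⊗ v : 𝟙 ⟶ X^{⊗ (n + m)}` of points of tensor powers. -/
def powTensor {X : C} {n m : ℕ} (a : 𝟙_ C ⟶ tpow X n) (b : 𝟙_ C ⟶ tpow X m) :
    𝟙_ C ⟶ tpow X (n + m) :=
  ptensor a b ≫ (tpowAdd X n m).hom

/-- `η^{⊗ n} : 𝟙 ⟶ X^{⊗ n}`. -/
def unitPow {X : C} (e : 𝟙_ C ⟶ X) : ∀ n : ℕ, 𝟙_ C ⟶ tpow X n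
  | 0 => 𝟙 _
  | n + 1 => ptensor (unitPow e n) e

/-- `η^{⊗ a} ⊗ Id ⊗ η^{⊗ b} : X ⟶ X^{⊗ (a + 1 + b)}`. -/
def placeAt {X : C} (e : 𝟙_ C ⟶ X) (a : ℕ) : ∀ b : ℕ, X ⟶ tpow X (a + 1 + b)
  | 0 => (λ_ X).inv ≫ (unitPow e a ▷ X)
  | b + 1 => (ρ_ X).inv ≫ (placeAt e a b ⊗ₘ e)

/-- The iterated multiplication `μ_k : X^{⊗ k} ⟶ X`; `μ_0 = η`, and `μ_k = μ ∘ (μ_{k-1} ⊗ Id)`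
(so that `μ_1` is the identity, up to the unit law and the unitor `𝟙 ⊗ X ≅ X`). -/
def iterMul {X : C} (m : X ⊗ X ⟶ X) (e : 𝟙_ C ⟶ X) : ∀ k : ℕ, tpow X k ⟶ X
  | 0 => e
  | k + 1 => (iterMul m e k ▷ X) ≫ m

/-- The sum `k_1 + ... + k_r`. -/
def total : ∀ {r : ℕ}, (Fin r → ℕ) → ℕ
  | 0, _ => 0
  | r + 1, k => total (fun i : Fin r => k i.castSucc) + k (Fin.last r)

/-- `μ_{k_1, …, k_r} = μ_{k_1} ⊗ ⋯ ⊗ μ_{k_r} : X^{⊗ (k_1 + ⋯ + k_r)} ⟶ X^{⊗ r}`. -/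
def blockMul {X : C} (m : X ⊗ X ⟶ X) (e : 𝟙_ C ⟶ X) :
    ∀ {r : ℕ} (k : Fin r → ℕ), tpow X (total k) ⟶ tpow X r
  | 0, _ => 𝟙 _
  | r + 1, k =>
    (tpowAdd X (total fun i : Fin r => k i.castSucc) (k (Fin.last r))).inv ≫
      (blockMul m e (fun i : Fin r => k i.castSucc) ⊗ₘ iterMul m e (k (Fin.last r)))

section Braided

variable [BraidedCategory C]

/-- The multiplication `μ^{[n]} : X^{⊗ n} ⊗ X^{⊗ n} ⟶ X^{⊗ n}`, i.e.
`μ^{[n]} = (μ^{[n-1]} ⊗ μ) ∘ (Id ⊗ P_{X, X^{⊗ (n-1)}} ⊗ Id)`; the arrow `tensorμ` is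
`Id ⊗ P ⊗ Id` together with the associativity constraints. -/
def mulPow {X : C} (m : X ⊗ X ⟶ X) : ∀ n : ℕ, tpow X n ⊗ tpow X n ⟶ tpow X n
  | 0 => (λ_ (𝟙_ C)).hom
  | n + 1 => tensorμ (tpow X n) X (tpow X n) X ≫ (mulPow m n ⊗ₘ m)

/-- The product `a · b = μ^{[n]} ∘ (a ⊗ b)` of points of `X^{⊗ n}`. -/
def dot {X : C} (m : X ⊗ X ⟶ X) {n : ℕ} (a b : 𝟙_ C ⟶ tpow X n) : 𝟙_ C ⟶ tpow X n :=
  ptensor a b ≫ mulPow m n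

end Braided

end Generic

/-! ### Symmetric groups acting on tensor powers -/

section Perm

variable {C : Type u} [Category.{v} C] [MonoidalCategory C]

section Swap

variable [BraidedCategory C]

/-- The symmetry of the last two factors: `Id ⊗ P_{X,X} : Y ⊗ X ⊗ X ⟶ Y ⊗ X ⊗ X`. -/
def swapLast (Y X : C) : (Y ⊗ X) ⊗ X ⟶ (Y ⊗ X) ⊗ X :=
  (α_ Y X X).hom ≫ Y ◁ (β_ X X).hom ≫ (α_ Y X X).inv

/-- The symmetry `Id_X^{⊗ i} ⊗ P_{X,X} ⊗ Id_X^{⊗ (n - i - 2)}` of two adjacent factors, for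
`i + 2 ≤ n`. -/
def adj (X : C) : ∀ (n _i : ℕ), tpow X n ⟶ tpow X n
  | 0, _ => 𝟙 _
  | 1, _ => 𝟙 _
  | n + 2, i => if i = n then swapLast (tpow X n) X else adj X (n + 1) i ▷ X

/-- The symmetry that moves the last factor to the place `j` (counted from `0`) and keeps the
order of the other factors. -/
def moveLast (X : C) : ∀ (n _j : ℕ), tpow X (n + 1) ⟶ tpow X (n + 1)
  | 0, _ => 𝟙 _
  | n + 1, j => if j = n + 1 then 𝟙 _ else swapLast (tpow X n) X ≫ moveLast X n j ▷ X

/-- The permutation of the first `n` elements induced by a permutation of `n + 1` elements: delete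
the last element and its image and renumber the images. -/
def dropLast {n : ℕ} (σ : Equiv.Perm (Fin (n + 1))) : Equiv.Perm (Fin n) :=
  Equiv.removeNone (finSuccEquivLast.symm.trans (σ.trans (finSuccEquiv' (σ (Fin.last n)))))

/-- The symmetry `P_{σ, X} : X^{⊗ n} ⟶ X^{⊗ n}` that moves the `i`-th factor to the place `σ i`.
By `permMap_swap` and `permMap_mul` below, it is determined by
`P_{(i, i + 1)} = Id ⊗ P_{X,X} ⊗ Id` and `P_{σ τ} = P_σ ∘ P_τ`. -/
def permMap (X : C) : ∀ {n : ℕ}, Equiv.Perm (Fin n) → (tpow X n ⟶ tpow X n)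
  | 0, _ => 𝟙 _
  | n + 1, σ => permMap X (dropLast σ) ▷ X ≫ moveLast X n (σ (Fin.last n))

theorem succAbove_dropLast {n : ℕ} (σ : Equiv.Perm (Fin (n + 1))) (i : Fin n) :
    (σ (Fin.last n)).succAbove (dropLast σ i) = σ i.castSucc := by
  have h : some (dropLast σ i) =
      (finSuccEquivLast.symm.trans (σ.trans (finSuccEquiv' (σ (Fin.last n))))) (some i) := by
    refine Equiv.removeNone_some _ ?_
    have hne : σ i.castSucc ≠ σ (Fin.last n) := fun h => (Fin.castSucc_lt_last i).ne (σ.injective h)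
    obtain ⟨k, hk⟩ := Fin.exists_succAbove_eq hne
    exact ⟨k, by simp [← hk]⟩
  simp only [Equiv.trans_apply, finSuccEquivLast_symm_some] at h
  apply (finSuccEquiv' (σ (Fin.last n))).injective
  rw [← h, finSuccEquiv'_succAbove]

end Swap

variable [SymmetricCategory C] (X : C)

theorem swapLast_swapLast (Y : C) : swapLast Y X ≫ swapLast Y X = 𝟙 _ := by
  simp only [swapLast, Category.assoc, Iso.inv_hom_id_assoc]
  rw [← MonoidalCategory.whiskerLeft_comp_assoc]
  simp

theorem swapLast_natural {Y Z : C} (f : Y ⟶ Z) :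
    f ▷ X ▷ X ≫ swapLast Z X = swapLast Y X ≫ f ▷ X ▷ X := by
  simp only [swapLast, Category.assoc]
  rw [associator_naturality_left_assoc, ← whisker_exchange_assoc, associator_inv_naturality_left]

theorem swapLast_yang_baxter (Y : C) :
    swapLast (Y ⊗ X) X ≫ swapLast Y X ▷ X ≫ swapLast (Y ⊗ X) X =
      swapLast Y X ▷ X ≫ swapLast (Y ⊗ X) X ≫ swapLast Y X ▷ X := by
  have h := congrArg (fun f => 𝟙 (((Y ⊗ X) ⊗ X) ⊗ X) ⊗≫ Y ◁ f ⊗≫ 𝟙 (((Y ⊗ X) ⊗ X) ⊗ X))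
    (BraidedCategory.yang_baxter X X X)
  simp only [swapLast]
  calc _ = _ := by monoidal
    _ = _ := h.symm
    _ = _ := by monoidal

theorem adj_adj : ∀ (n i : ℕ), adj X n i ≫ adj X n i = 𝟙 _
  | 0, _ => Category.comp_id _
  | 1, _ => Category.comp_id _
  | n + 2, i => by
    by_cases h : i = n
    · simpa [adj, h] using swapLast_swapLast X (tpow X n)
    · have := congrArg (· ▷ X) (adj_adj (n + 1) i)
      simp only [comp_whiskerRight, id_whiskerRight] at this
      simpa [adj, h] using this

theorem adj_self (n : ℕ) : adj X (n + 2) n = swapLast (tpow X n) X := if_pos rfl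

theorem adj_succ (n i : ℕ) (h : i < n) : adj X (n + 2) i = adj X (n + 1) i ▷ X :=
  if_neg h.ne

theorem moveLast_self (n : ℕ) : moveLast X n n = 𝟙 _ := by
  cases n <;> simp [moveLast]

theorem moveLast_succ (n j : ℕ) (h : j ≤ n) :
    moveLast X (n + 1) j = swapLast (tpow X n) X ≫ moveLast X n j ▷ X :=
  if_neg (by omega)

theorem moveLast_adj : ∀ (n j : ℕ), j < n →
    moveLast X n j ≫ adj X (n + 1) j = moveLast X n (j + 1)
  | 0, j, h => by omega
  | n + 1, j, h => by
    by_cases hj : j = n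
    · subst hj
      simp [moveLast_succ, moveLast_self, adj_self, swapLast_swapLast]
    · have := moveLast_adj n j (by omega)
      rw [moveLast_succ X n j (by omega), moveLast_succ X n (j + 1) (by omega),
        adj_succ X n j (by omega), Category.assoc, ← comp_whiskerRight, this]

theorem moveLast_succ_adj (n j : ℕ) (h : j < n) :
    moveLast X n (j + 1) ≫ adj X (n + 1) j = moveLast X n j := by
  rw [← moveLast_adj X n j h, Category.assoc, adj_adj, Category.comp_id]

theorem moveLast_adj_of_lt : ∀ (n j i : ℕ), i + 1 < j → j ≤ n →
    moveLast X n j ≫ adj X (n + 1) i = adj X n i ▷ X ≫ moveLast X n j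
  | 0, _, _, _, _ => by omega
  | 1, _, _, _, _ => by omega
  | n + 2, j, i, h, h' => by
    by_cases hj : j = n + 2
    · subst hj
      simp [moveLast_self, adj_succ X (n + 1) i (by omega)]
    · have := moveLast_adj_of_lt (n + 1) j i h (by omega)
      rw [moveLast_succ X (n + 1) j (by omega), adj_succ X (n + 1) i (by omega), Category.assoc,
        ← comp_whiskerRight, this, comp_whiskerRight, adj_succ X n i (by omega),
        ← Category.assoc, ← swapLast_natural, Category.assoc]

theorem moveLast_adj_of_gt : ∀ (n j i : ℕ), j ≤ i → i + 1 < n →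
    moveLast X n j ≫ adj X (n + 1) (i + 1) = adj X n i ▷ X ≫ moveLast X n j
  | 0, _, _, _, _ => by omega
  | 1, _, _, _, _ => by omega
  | n + 2, j, i, h, h' => by
    by_cases hi : i = n
    · subst hi
      rw [moveLast_succ X (i + 1) j (by omega), moveLast_succ X i j (by omega), adj_self, adj_self]
      simp only [comp_whiskerRight, Category.assoc, swapLast_natural]
      have := congrArg (· ≫ moveLast X i j ▷ X ▷ X) (swapLast_yang_baxter X (tpow X i))
      simpa using this
    · have := moveLast_adj_of_gt (n + 1) j i h (by omega)
      rw [moveLast_succ X (n + 1) j (by omega), adj_succ X (n + 1) (i + 1) (by omega),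
        Category.assoc, ← comp_whiskerRight, this, comp_whiskerRight, adj_succ X n i (by omega),
        ← Category.assoc, ← swapLast_natural, Category.assoc]

/-- The transposition of `i` and `i + 1`. -/
def adjSwap {n : ℕ} (i : ℕ) (h : i + 1 < n) : Equiv.Perm (Fin n) :=
  Equiv.swap ⟨i, by omega⟩ ⟨i + 1, h⟩

theorem adjSwap_val {n : ℕ} (i : ℕ) (h : i + 1 < n) (k : Fin n) : (adjSwap i h k : ℕ) =
    if (k : ℕ) = i then i + 1 else if (k : ℕ) = i + 1 then i else k := by
  simp only [adjSwap, Equiv.swap_apply_def, Fin.ext_iff]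
  split_ifs <;> simp

theorem dropLast_val {n : ℕ} (σ : Equiv.Perm (Fin (n + 1))) (i : Fin n) :
    (σ i.castSucc : ℕ) =
      if (dropLast σ i : ℕ) < σ (Fin.last n) then (dropLast σ i : ℕ) else dropLast σ i + 1 := by
  rw [← succAbove_dropLast σ i, Fin.succAbove]
  simp only [Fin.lt_def, Fin.val_castSucc]
  split_ifs <;> simp

theorem permMap_adjSwap_mul : ∀ {n : ℕ} (i : ℕ) (h : i + 1 < n) (σ : Equiv.Perm (Fin n)),
    permMap X (adjSwap i h * σ) = permMap X σ ≫ adj X n i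
  | 0, _, h, _ => by omega
  | n + 1, i, h, σ => by
    have hl : ∀ τ : Equiv.Perm (Fin (n + 1)), (τ (Fin.last n) : ℕ) ≤ n := fun τ => by omega
    have hlast := adjSwap_val i h (σ (Fin.last n))
    have hd := fun k => dropLast_val (adjSwap i h * σ) k
    have hd' := fun k => dropLast_val σ k
    simp only [Equiv.Perm.coe_mul, Function.comp_apply, hlast] at hd
    simp only [adjSwap_val, hd'] at hd
    simp only [permMap, Category.assoc, Equiv.Perm.coe_mul, Function.comp_apply, hlast]
    have hσ := hl σ
    generalize (σ (Fin.last n) : ℕ) = j at hd hd' hlast hσ ⊢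
    have ext : ∀ τ τ' : Equiv.Perm (Fin n), (∀ k, (τ k : ℕ) = τ' k) → τ = τ' :=
      fun τ τ' hh => Equiv.ext fun k => Fin.ext (hh k)
    rcases lt_trichotomy j i with h1 | h1 | h1
    · obtain ⟨i, rfl⟩ : ∃ i', i = i' + 1 := ⟨i - 1, by omega⟩
      have hi : i + 1 < n := by omega
      have : dropLast (adjSwap (i + 1) h * σ) = adjSwap i hi * dropLast σ := by
        apply ext
        intro k
        have := hd k
        simp only [Equiv.Perm.coe_mul, Function.comp_apply, adjSwap_val]
        split_ifs at this ⊢ <;> omega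
      rw [if_neg (by omega), if_neg (by omega), moveLast_adj_of_gt X n j i (by omega) hi, this,
        permMap_adjSwap_mul i hi, comp_whiskerRight, Category.assoc]
    · subst h1
      have : dropLast (adjSwap j h * σ) = dropLast σ := by
        apply ext
        intro k
        have := hd k
        split_ifs at this <;> omega
      rw [if_pos rfl, moveLast_adj X n j (by omega), this]
    · by_cases h2 : j = i + 1
      · subst h2
        have : dropLast (adjSwap i h * σ) = dropLast σ := by
          apply ext
          intro k
          have := hd k
          split_ifs at this <;> omega
        rw [if_neg (by omega), if_pos rfl, moveLast_succ_adj X n i (by omega), this]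
      · have hi : i + 1 < n := by omega
        have : dropLast (adjSwap i h * σ) = adjSwap i hi * dropLast σ := by
          apply ext
          intro k
          have := hd k
          simp only [Equiv.Perm.coe_mul, Function.comp_apply, adjSwap_val]
          split_ifs at this ⊢ <;> omega
        rw [if_neg (by omega), if_neg (by omega), moveLast_adj_of_lt X n j i (by omega) (by omega),
          this, permMap_adjSwap_mul i hi, comp_whiskerRight, Category.assoc]

theorem permMap_one : ∀ {n : ℕ}, permMap X (1 : Equiv.Perm (Fin n)) = 𝟙 _
  | 0 => rfl
  | n + 1 => by
    have : dropLast (1 : Equiv.Perm (Fin (n + 1))) = 1 := by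
      refine Equiv.ext fun k => Fin.ext ?_
      have := dropLast_val 1 k
      rw [if_pos (by simp)] at this
      simpa using this.symm
    simp [permMap, this, permMap_one, moveLast_self]

/-- `P_{(i, i + 1)} = Id ⊗ P_{X,X} ⊗ Id`. -/
theorem permMap_swap {n : ℕ} (i : ℕ) (h : i + 1 < n) :
    permMap X (Equiv.swap ⟨i, by omega⟩ ⟨i + 1, h⟩) = adj X n i := by
  have := permMap_adjSwap_mul X i h 1
  rwa [mul_one, permMap_one, Category.id_comp] at this

/-- Every permutation is a product of transpositions of adjacent elements. -/
theorem perm_induction {n : ℕ} {p : Equiv.Perm (Fin n) → Prop} (h1 : p 1)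
    (hs : ∀ (i : ℕ) (h : i + 1 < n) σ, p σ → p (adjSwap i h * σ)) (σ : Equiv.Perm (Fin n)) :
    p σ := by
  cases n with
  | zero => rwa [Subsingleton.elim σ 1]
  | succ n =>
    have hσ : σ ∈ Submonoid.closure (Set.range fun i : Fin n ↦ Equiv.swap i.castSucc i.succ) := by
      rw [Equiv.Perm.mclosure_swap_castSucc_succ]; trivial
    induction hσ using Submonoid.closure_induction_left with
    | one => exact h1
    | mul_left x hx y _ ih =>
      obtain ⟨i, rfl⟩ := hx
      exact hs i (by omega) y ih

/-- `P_{σ τ} = P_σ ∘ P_τ`. -/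
theorem permMap_mul {n : ℕ} (σ τ : Equiv.Perm (Fin n)) :
    permMap X (σ * τ) = permMap X τ ≫ permMap X σ := by
  induction σ using perm_induction with
  | h1 => rw [one_mul, permMap_one, Category.comp_id]
  | hs i h σ ih => rw [mul_assoc, permMap_adjSwap_mul, ih, permMap_adjSwap_mul, Category.assoc]

end Perm

/-! ### The tensor powers of an algebra object -/

section Mon

open scoped MonObj

variable {C : Type u} [Category.{v} C] [MonoidalCategory C] [SymmetricCategory C]
  (A : C) [MonObj A]

/-- The tensor powers of an algebra object are algebra objects. -/
instance tpowMonObj : ∀ n : ℕ, MonObj (tpow A n)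
  | 0 => inferInstanceAs (MonObj (𝟙_ C))
  | n + 1 =>
    letI := tpowMonObj n
    inferInstanceAs (MonObj (tpow A n ⊗ A))

theorem tpow_one_eq : ∀ n : ℕ, η[tpow A n] = unitPow η[A] n
  | 0 => rfl
  | n + 1 => by
    change (λ_ (𝟙_ C)).inv ≫ (η[tpow A n] ⊗ₘ η[A]) = _
    rw [tpow_one_eq n]; rfl

theorem tpow_mul_eq : ∀ n : ℕ, μ[tpow A n] = mulPow μ[A] n
  | 0 => rfl
  | n + 1 => by
    change tensorμ (tpow A n) A (tpow A n) A ≫ (μ[tpow A n] ⊗ₘ μ[A]) = _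
    rw [tpow_mul_eq n]; rfl

instance swapLast_isMonHom (Y : C) [MonObj Y] : IsMonHom (swapLast Y A) := by
  have : IsMonHom (β_ A A).hom := ⟨MonObj.one_braiding A A, MonObj.mul_braiding A A⟩
  unfold swapLast
  infer_instance

theorem adj_isMonHom : ∀ n i : ℕ, IsMonHom (adj A n i)
  | 0, _ => inferInstanceAs (IsMonHom (𝟙 (tpow A 0)))
  | 1, _ => inferInstanceAs (IsMonHom (𝟙 (tpow A 1)))
  | n + 2, i => by
    unfold adj
    have := adj_isMonHom (n + 1) i
    split_ifs
    · exact swapLast_isMonHom A (tpow A n)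
    · exact inferInstanceAs (IsMonHom (adj A (n + 1) i ▷ A))

theorem permMap_isMonHom {n : ℕ} (σ : Equiv.Perm (Fin n)) : IsMonHom (permMap A σ) := by
  induction σ using perm_induction with
  | h1 => rw [permMap_one]; infer_instance
  | hs i h σ ih =>
    rw [permMap_adjSwap_mul]
    have := adj_isMonHom A n i
    infer_instance

variable {A}

theorem unitPow_permMap {n : ℕ} (σ : Equiv.Perm (Fin n)) :
    unitPow η[A] n ≫ permMap A σ = unitPow η[A] n := by
  have := permMap_isMonHom A σ
  rw [← tpow_one_eq, IsMonHom.one_hom]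

theorem dot_permMap {n : ℕ} (σ : Equiv.Perm (Fin n)) (a b : 𝟙_ C ⟶ tpow A n) :
    dot μ[A] a b ≫ permMap A σ = dot μ[A] (a ≫ permMap A σ) (b ≫ permMap A σ) := by
  have := permMap_isMonHom A σ
  simp only [dot, ptensor, ← tpow_mul_eq, Category.assoc, IsMonHom.mul_hom,
    ← tensorHom_comp_tensorHom_assoc]

theorem unitPow_dot {n : ℕ} (a : 𝟙_ C ⟶ tpow A n) : dot μ[A] (unitPow η[A] n) a = a := by
  simp only [dot, ptensor, ← tpow_mul_eq, ← tpow_one_eq, tensorHom_def', Category.assoc,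
    MonObj.one_mul]
  simp

theorem dot_unitPow {n : ℕ} (a : 𝟙_ C ⟶ tpow A n) : dot μ[A] a (unitPow η[A] n) = a := by
  simp only [dot, ptensor, ← tpow_mul_eq, ← tpow_one_eq, MonoidalCategory.tensorHom_def, Category.assoc,
    MonObj.mul_one]
  simp [unitors_inv_equal]

theorem dot_assoc {n : ℕ} (a b c : 𝟙_ C ⟶ tpow A n) :
    dot μ[A] (dot μ[A] a b) c = dot μ[A] a (dot μ[A] b c) := by
  simp only [dot, ptensor, ← tpow_mul_eq]
  have h1 : (((λ_ (𝟙_ C)).inv ≫ (a ⊗ₘ b)) ≫ μ[tpow A n]) ⊗ₘ c =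
      ((λ_ (𝟙_ C)).inv ▷ 𝟙_ C ≫ ((a ⊗ₘ b) ⊗ₘ c)) ≫ μ[tpow A n] ▷ tpow A n := by
    simp only [← tensorHom_id, Category.assoc, tensorHom_comp_tensorHom, Category.comp_id,
      Category.id_comp]
  have h2 : a ⊗ₘ (((λ_ (𝟙_ C)).inv ≫ (b ⊗ₘ c)) ≫ μ[tpow A n]) =
      (𝟙_ C ◁ (λ_ (𝟙_ C)).inv ≫ (a ⊗ₘ (b ⊗ₘ c))) ≫ tpow A n ◁ μ[tpow A n] := by
    simp only [← id_tensorHom, Category.assoc, tensorHom_comp_tensorHom, Category.comp_id,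
      Category.id_comp]
  rw [h1, h2]
  simp only [Category.assoc, MonObj.mul_assoc]
  rw [associator_naturality_assoc]
  simp [unitors_inv_equal]

end Mon

/-! ### Images of the operations under a symmetric monoidal functor -/

section Transport

open Functor.LaxMonoidal Functor.Monoidal

variable {C : Type u} [Category.{v} C] [MonoidalCategory C]
  {D : Type*} [Category* D] [MonoidalCategory D] (F : D ⥤ C)

/-- The comparison arrow `(F X)^{⊗ n} ⟶ F (X^{⊗ n})`. -/
def powComp [F.LaxMonoidal] (X : D) : ∀ n : ℕ, tpow (F.obj X) n ⟶ F.obj (tpow X n)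
  | 0 => ε F
  | n + 1 => powComp X n ▷ F.obj X ≫ μ F (tpow X n) X

theorem powComp_isIso [F.Monoidal] (X : D) : ∀ n : ℕ, IsIso (powComp F X n)
  | 0 => inferInstanceAs (IsIso (ε F))
  | n + 1 =>
    have : IsIso (powComp F X n) := powComp_isIso X n
    inferInstanceAs (IsIso (powComp F X n ▷ F.obj X ≫ μ F (tpow X n) X))

attribute [instance] powComp_isIso

theorem comp_tensorHom {U V W Y Z : C} (f : U ⟶ V) (g : V ⟶ W) (h : Y ⟶ Z) :
    (f ≫ g) ⊗ₘ h = (f ⊗ₘ h) ≫ g ▷ Z := by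
  rw [← tensorHom_id, tensorHom_comp_tensorHom, Category.comp_id]

section Lax
variable [F.LaxMonoidal] {X : D}

theorem map_ptensor {Y Z : D} (y : 𝟙_ D ⟶ Y) (z : 𝟙_ D ⟶ Z) :
    ε F ≫ F.map (ptensor y z) = ptensor (ε F ≫ F.map y) (ε F ≫ F.map z) ≫ μ F Y Z := by
  simp only [ptensor, Category.assoc, ← tensorHom_comp_tensorHom, μ_natural, F.map_comp]
  simp only [tensorHom_def', Category.assoc, ← left_unitality_inv]
  simp

theorem powComp_tpowAdd (n : ℕ) : ∀ m : ℕ,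
    (powComp F X n ⊗ₘ powComp F X m) ≫ μ F _ _ ≫ F.map (tpowAdd X n m).hom =
      (tpowAdd (F.obj X) n m).hom ≫ powComp F X (n + m)
  | 0 => by
    have := whiskerRight_tensorUnit_comp_rightUnitor_hom F (powComp F X n)
    simp only [powComp, tpowAdd]
    rw [← this]
    simp
  | m + 1 => by
    have := powComp_tpowAdd n m
    change _ = _ ≫ powComp F X (n.add m) at this
    simp only [powComp, tpowAdd, Iso.trans_hom, Iso.symm_hom, whiskerRightIso_hom, F.map_comp,
      Category.assoc]
    rw [← comp_whiskerRight_assoc, ← this]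
    have h1 : (powComp F X n ⊗ₘ powComp F X m ▷ F.obj X ≫ μ F (tpow X m) X) =
        (powComp F X n ⊗ₘ powComp F X m ▷ F.obj X) ≫ F.obj (tpow X n) ◁ μ F (tpow X m) X := by
      simp only [← id_tensorHom, tensorHom_comp_tensorHom, Category.comp_id]
    rw [h1, Category.assoc, associativity_inv_assoc]
    have h2 : (powComp F X n ⊗ₘ powComp F X m ▷ F.obj X) ≫
        (α_ (F.obj (tpow X n)) (F.obj (tpow X m)) (F.obj X)).inv =
        (α_ _ _ _).inv ≫ (powComp F X n ⊗ₘ powComp F X m) ▷ F.obj X := by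
      simp only [← tensorHom_id, associator_inv_naturality]
    have h3 : μ F (tpow X n ⊗ tpow X m) X ≫ F.map ((tpowAdd X n m).hom ▷ X) =
        F.map (tpowAdd X n m).hom ▷ F.obj X ≫ μ F (tpow X (n.add m)) X :=
      (μ_natural_left F _ _).symm
    rw [reassoc_of% h2, h3]
    simp only [comp_whiskerRight, Category.assoc]

theorem map_powTensor {n m : ℕ} {a : 𝟙_ D ⟶ tpow X n} {b : 𝟙_ D ⟶ tpow X m}
    {a' : 𝟙_ C ⟶ tpow (F.obj X) n} {b' : 𝟙_ C ⟶ tpow (F.obj X) m}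
    (ha : ε F ≫ F.map a = a' ≫ powComp F X n) (hb : ε F ≫ F.map b = b' ≫ powComp F X m) :
    ε F ≫ F.map (powTensor a b) = powTensor a' b' ≫ powComp F X (n + m) := by
  simp only [powTensor, F.map_comp, reassoc_of% map_ptensor F a b, ha, hb, Category.assoc,
    ← powComp_tpowAdd]
  simp only [ptensor, Category.assoc, tensorHom_comp_tensorHom_assoc]

theorem map_unitPow (e : 𝟙_ D ⟶ X) : ∀ n : ℕ,
    ε F ≫ F.map (unitPow e n) = unitPow (ε F ≫ F.map e) n ≫ powComp F X n
  | 0 => by simp [unitPow, powComp]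
  | n + 1 => by
    simp only [unitPow, map_ptensor, map_unitPow e n, powComp]
    simp only [ptensor, Category.assoc, ← tensorHom_id, tensorHom_comp_tensorHom_assoc,
      Category.comp_id]

theorem map_placeAt (e : 𝟙_ D ⟶ X) (a : ℕ) : ∀ b : ℕ,
    F.map (placeAt e a b) = placeAt (ε F ≫ F.map e) a b ≫ powComp F X (a + 1 + b)
  | 0 => by
    simp only [placeAt, F.map_comp, Category.assoc, ← left_unitality_inv, ← μ_natural_left,
      ← comp_whiskerRight_assoc, map_unitPow]
    simp only [comp_whiskerRight, Category.assoc]; rfl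
  | b + 1 => by
    have := map_placeAt e a b
    simp only [placeAt, F.map_comp, Category.assoc, ← right_unitality_inv, ← μ_natural]
    rw [← id_tensorHom, tensorHom_comp_tensorHom_assoc, this]
    simp only [Category.id_comp]
    rw [comp_tensorHom, Category.assoc]
    rfl

theorem map_split {n m : ℕ} {Y Z : D} (f : tpow X n ⟶ Y) (g : tpow X m ⟶ Z) :
    powComp F X (n + m) ≫ F.map (tpowAdd X n m).inv ≫ F.map (f ⊗ₘ g) =
      (tpowAdd (F.obj X) n m).inv ≫ (powComp F X n ≫ F.map f ⊗ₘ powComp F X m ≫ F.map g) ≫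
        μ F Y Z := by
  rw [Iso.eq_inv_comp, ← reassoc_of% (powComp_tpowAdd F (X := X) n m), ← F.map_comp_assoc]
  simp only [Iso.hom_inv_id, F.map_id, Category.id_comp, ← μ_natural,
    tensorHom_comp_tensorHom_assoc]

theorem map_iterMul (m : X ⊗ X ⟶ X) (e : 𝟙_ D ⟶ X) : ∀ k : ℕ,
    powComp F X k ≫ F.map (iterMul m e k) = iterMul (μ F X X ≫ F.map m) (ε F ≫ F.map e) k
  | 0 => by simp [iterMul, powComp]
  | k + 1 => by
    rw [iterMul, iterMul, ← map_iterMul m e k]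
    simp [powComp]

theorem map_blockMul (m : X ⊗ X ⟶ X) (e : 𝟙_ D ⟶ X) : ∀ {r : ℕ} (k : Fin r → ℕ),
    powComp F X (total k) ≫ F.map (blockMul m e k) =
      blockMul (μ F X X ≫ F.map m) (ε F ≫ F.map e) k ≫ powComp F X r
  | 0, _ => by simp [blockMul, powComp, total]
  | r + 1, k => by
    have := map_blockMul m e fun i : Fin r => k i.castSucc
    simp only [blockMul, total]
    rw [F.map_comp, map_split, this, map_iterMul, comp_tensorHom]
    simp only [powComp, Category.assoc]

theorem map_toPow1 : F.map (toPow1 X) = toPow1 (F.obj X) ≫ powComp F X 1 := by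
  simp [toPow1, powComp]

theorem map_toPow2 : μ F X X ≫ F.map (toPow2 X) = toPow2 (F.obj X) ≫ powComp F X 2 := by
  simp only [toPow2, powComp, ← μ_natural_left, ← left_unitality_inv]
  simp only [comp_whiskerRight, Category.assoc]

end Lax

section Braided

variable [SymmetricCategory C] [SymmetricCategory D] {X : D}

theorem map_mulPow [F.LaxBraided] (m : X ⊗ X ⟶ X) : ∀ n : ℕ,
    (powComp F X n ⊗ₘ powComp F X n) ≫ μ F _ _ ≫ F.map (mulPow m n) =
      mulPow (μ F X X ≫ F.map m) n ≫ powComp F X n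
  | 0 => by
    have := tensorUnit_whiskerLeft_comp_leftUnitor_hom F (ε F)
    simp only [powComp, mulPow]
    rw [← this]
    simp
  | n + 1 => by
    have := map_mulPow m n
    simp only [powComp, mulPow, F.map_comp]
    rw [← tensorHom_comp_tensorHom_assoc, Category.assoc,
      ← tensorμ_comp_μ_tensorHom_μ_comp_μ_assoc, ← tensorHom_id,
      tensorμ_natural_assoc]
    simp only [← μ_natural, tensorHom_comp_tensorHom_assoc, this]
    simp only [id_tensorHom_id, Category.id_comp, Category.comp_id]

theorem map_dot [F.LaxBraided] (m : X ⊗ X ⟶ X) {n : ℕ} {a b : 𝟙_ D ⟶ tpow X n}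
    {a' b' : 𝟙_ C ⟶ tpow (F.obj X) n} (ha : ε F ≫ F.map a = a' ≫ powComp F X n)
    (hb : ε F ≫ F.map b = b' ≫ powComp F X n) :
    ε F ≫ F.map (dot m a b) = dot (μ F X X ≫ F.map m) a' b' ≫ powComp F X n := by
  simp only [dot, F.map_comp, reassoc_of% map_ptensor F a b, Category.assoc, ← map_mulPow, ha, hb]
  simp only [ptensor, Category.assoc, tensorHom_comp_tensorHom_assoc]

theorem map_swapLast [F.LaxBraided] (Y X : D) :
    μ F Y X ▷ F.obj X ≫ μ F (Y ⊗ X) X ≫ F.map (swapLast Y X) =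
      swapLast (F.obj Y) (F.obj X) ≫ μ F Y X ▷ F.obj X ≫ μ F (Y ⊗ X) X := by
  simp only [swapLast, F.map_comp, associativity_assoc, Category.assoc]
  rw [← μ_natural_right_assoc, ← MonoidalCategory.whiskerLeft_comp_assoc,
    Functor.LaxBraided.braided, MonoidalCategory.whiskerLeft_comp_assoc, associativity_inv]

theorem map_adj [F.LaxBraided] : ∀ n i : ℕ,
    powComp F X n ≫ F.map (adj X n i) = adj (F.obj X) n i ≫ powComp F X n
  | 0, _ => by simp [adj]
  | 1, _ => by simp [adj]
  | n + 2, i => by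
    have := map_adj (n + 1) i
    simp only [adj]
    split_ifs
    · have := map_swapLast F (tpow X n) X
      simp only [powComp, comp_whiskerRight, Category.assoc, this]
      rw [reassoc_of% (swapLast_natural (F.obj X) (powComp F X n))]
    · rw [powComp, Category.assoc, ← μ_natural_left, ← comp_whiskerRight_assoc, this]
      simp

theorem map_permMap [F.LaxBraided] {n : ℕ} (σ : Equiv.Perm (Fin n)) :
    powComp F X n ≫ F.map (permMap X σ) = permMap (F.obj X) σ ≫ powComp F X n := by
  induction σ using perm_induction with
  | h1 => simp [permMap_one]
  | hs i h σ ih =>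
    rw [permMap_adjSwap_mul, permMap_adjSwap_mul, F.map_comp, reassoc_of% ih, map_adj,
      Category.assoc]

end Braided

end Transport

/-! ### XC-structures -/

/-- The operations of an XC-algebra object, without any axiom. -/
structure XCData (C : Type u) [Category.{v} C] [MonoidalCategory C] where
  obj : C
  mul : obj ⊗ obj ⟶ obj
  one : 𝟙_ C ⟶ obj
  R : 𝟙_ C ⟶ obj ⊗ obj
  Rinv : 𝟙_ C ⟶ obj ⊗ obj
  κ : 𝟙_ C ⟶ obj
  κinv : 𝟙_ C ⟶ obj

namespace XCData

variable {C : Type u} [Category.{v} C] [MonoidalCategory C] [BraidedCategory C] (d : XCData C)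

/-- `r_{ij} : 𝟙 ⟶ A^{⊗ n}`, with the first leg of `r` placed by `p` and the second one by `q`
(where `p`, `q` are of the form `η^{⊗ i-1} ⊗ Id ⊗ η^{⊗ n-i}`), and units elsewhere. -/
def legs (r : 𝟙_ C ⟶ d.obj ⊗ d.obj) {n : ℕ} (p q : d.obj ⟶ tpow d.obj n) :
    𝟙_ C ⟶ tpow d.obj n :=
  r ≫ (p ⊗ₘ q) ≫ mulPow d.mul n

/-- The inclusion of `A` at the place `1` of `A^{⊗ 3}`, with units elsewhere. -/
def i31 : d.obj ⟶ tpow d.obj 3 := placeAt d.one 0 2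

/-- The inclusion of `A` at the place `2` of `A^{⊗ 3}`, with units elsewhere. -/
def i32 : d.obj ⟶ tpow d.obj 3 := placeAt d.one 1 1

/-- The inclusion of `A` at the place `3` of `A^{⊗ 3}`, with units elsewhere. -/
def i33 : d.obj ⟶ tpow d.obj 3 := placeAt d.one 2 0

/-- The inclusion of `A` at the place `1` of `A^{⊗ 5}`, with units elsewhere. -/
def i51 : d.obj ⟶ tpow d.obj 5 := placeAt d.one 0 4

/-- The inclusion of `A` at the place `2` of `A^{⊗ 5}`, with units elsewhere. -/
def i52 : d.obj ⟶ tpow d.obj 5 := placeAt d.one 1 3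

/-- The inclusion of `A` at the place `3` of `A^{⊗ 5}`, with units elsewhere. -/
def i53 : d.obj ⟶ tpow d.obj 5 := placeAt d.one 2 2

/-- The inclusion of `A` at the place `4` of `A^{⊗ 5}`, with units elsewhere. -/
def i54 : d.obj ⟶ tpow d.obj 5 := placeAt d.one 3 1

/-- The inclusion of `A` at the place `5` of `A^{⊗ 5}`, with units elsewhere. -/
def i55 : d.obj ⟶ tpow d.obj 5 := placeAt d.one 4 0

/-- The equations of an algebra object. -/
inductive AlgEqn : ∀ {Y Z : C}, (Y ⟶ Z) → (Y ⟶ Z) → Prop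
  | one_mul : AlgEqn (d.one ▷ d.obj ≫ d.mul) (λ_ d.obj).hom
  | mul_one : AlgEqn (d.obj ◁ d.one ≫ d.mul) (ρ_ d.obj).hom
  | mul_assoc : AlgEqn (d.mul ▷ d.obj ≫ d.mul) ((α_ d.obj d.obj d.obj).hom ≫ d.obj ◁ d.mul ≫ d.mul)

/-- The equations of an XC-structure: the arrows `R`, `Rinv` (of `A ⊗ A`) and `κ`, `κinv` (of `A`)
are multiplicative inverses of each other, and
* (XC0) `R^{±1} = (κ ⊗ κ) · R^{±1} · (κ⁻¹ ⊗ κ⁻¹)`,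
* (XC1f) `μ_3 (R_{31} · κ_2) = μ_3 (R_{13} · κ⁻¹_2)`,
* (XC2c) `1 ⊗ κ⁻¹ = (μ ⊗ μ_3) (R_{15} · R⁻¹_{23} · κ⁻¹_4)`,
* (XC2d) `κ ⊗ 1 = (μ_3 ⊗ μ) (R⁻¹_{15} · R_{34} · κ_2)`,
* (XC3) `R_{12} R_{13} R_{23} = R_{23} R_{13} R_{12}`. -/
inductive XCEqn : ∀ {Y Z : C}, (Y ⟶ Z) → (Y ⟶ Z) → Prop
  | R_mul_inv : XCEqn (dot d.mul (d.R ≫ toPow2 _) (d.Rinv ≫ toPow2 _)) (unitPow d.one 2)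
  | R_inv_mul : XCEqn (dot d.mul (d.Rinv ≫ toPow2 _) (d.R ≫ toPow2 _)) (unitPow d.one 2)
  | κ_mul_inv : XCEqn (dot d.mul (d.κ ≫ toPow1 _) (d.κinv ≫ toPow1 _)) (unitPow d.one 1)
  | κ_inv_mul : XCEqn (dot d.mul (d.κinv ≫ toPow1 _) (d.κ ≫ toPow1 _)) (unitPow d.one 1)
  | xc0 : XCEqn (d.R ≫ toPow2 _)
      (dot d.mul (dot d.mul (ptensor d.κ d.κ ≫ toPow2 _) (d.R ≫ toPow2 _))
        (ptensor d.κinv d.κinv ≫ toPow2 _))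
  | xc0inv : XCEqn (d.Rinv ≫ toPow2 _)
      (dot d.mul (dot d.mul (ptensor d.κ d.κ ≫ toPow2 _) (d.Rinv ≫ toPow2 _))
        (ptensor d.κinv d.κinv ≫ toPow2 _))
  | xc1f : XCEqn
      (dot d.mul (d.legs d.R d.i33 d.i31) (d.κ ≫ d.i32) ≫ iterMul d.mul d.one 3)
      (dot d.mul (d.legs d.R d.i31 d.i33) (d.κinv ≫ d.i32) ≫ iterMul d.mul d.one 3)
  | xc2c : XCEqn (ptensor d.one d.κinv)
      (dot d.mul (dot d.mul (d.legs d.R d.i51 d.i55) (d.legs d.Rinv d.i52 d.i53)) (d.κinv ≫ d.i54) ≫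
        (tpowAdd d.obj 2 3).inv ≫ (iterMul d.mul d.one 2 ⊗ₘ iterMul d.mul d.one 3))
  | xc2d : XCEqn (ptensor d.κ d.one)
      (dot d.mul (dot d.mul (d.legs d.Rinv d.i51 d.i55) (d.legs d.R d.i53 d.i54)) (d.κ ≫ d.i52) ≫
        (tpowAdd d.obj 3 2).inv ≫ (iterMul d.mul d.one 3 ⊗ₘ iterMul d.mul d.one 2))
  | xc3 : XCEqn
      (dot d.mul (dot d.mul (d.legs d.R d.i31 d.i32) (d.legs d.R d.i31 d.i33))
        (d.legs d.R d.i32 d.i33))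
      (dot d.mul (dot d.mul (d.legs d.R d.i32 d.i33) (d.legs d.R d.i31 d.i33))
        (d.legs d.R d.i31 d.i32))

end XCData

open scoped MonObj in
/-- An XC-structure on an algebra object `A` of a symmetric monoidal category: multiplicatively
invertible arrows `R : 𝟙 ⟶ A ⊗ A` and `κ : 𝟙 ⟶ A` subject to the XC-axioms. -/
structure XCStructure {C : Type u} [Category.{v} C] [MonoidalCategory C] [SymmetricCategory C]
    (A : C) [MonObj A] where
  R : 𝟙_ C ⟶ A ⊗ A
  Rinv : 𝟙_ C ⟶ A ⊗ A
  κ : 𝟙_ C ⟶ A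
  κinv : 𝟙_ C ⟶ A
  eqn : ∀ {Y Z : C} {f g : Y ⟶ Z},
    XCData.XCEqn (C := C) ⟨A, μ[A], η[A], R, Rinv, κ, κinv⟩ f g → f = g

open scoped MonObj in
/-- The operations of an algebra object with an XC-structure. -/
def XCStructure.data {C : Type u} [Category.{v} C] [MonoidalCategory C] [SymmetricCategory C]
    {A : C} [MonObj A] (S : XCStructure A) : XCData C :=
  ⟨A, μ[A], η[A], S.R, S.Rinv, S.κ, S.κinv⟩

theorem XCStructure.eqn' {C : Type u} [Category.{v} C] [MonoidalCategory C] [SymmetricCategory C]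
    {A : C} [MonObj A] (S : XCStructure A) {Y Z : C} {f g : Y ⟶ Z} (h : S.data.XCEqn f g) : f = g :=
  S.eqn h

/-! ### Images of XC-structures under symmetric monoidal functors -/

namespace XCData

open Functor.LaxMonoidal Functor.OplaxMonoidal Functor.Monoidal

variable {C : Type u} [Category.{v} C] [MonoidalCategory C] [SymmetricCategory C]
  {D : Type*} [Category* D] [MonoidalCategory D] [SymmetricCategory D]
  (d : XCData D) (F : D ⥤ C) [F.Braided]

/-- The image of the operations under a strong monoidal functor. -/
def map : XCData C where
  obj := F.obj d.obj
  mul := μ F _ _ ≫ F.map d.mul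
  one := ε F ≫ F.map d.one
  R := ε F ≫ F.map d.R ≫ δ F _ _
  Rinv := ε F ≫ F.map d.Rinv ≫ δ F _ _
  κ := ε F ≫ F.map d.κ
  κinv := ε F ≫ F.map d.κinv

theorem img_toPow1 (x : 𝟙_ D ⟶ d.obj) : ε F ≫ F.map (x ≫ toPow1 d.obj) =
    ((ε F ≫ F.map x) ≫ toPow1 (F.obj d.obj)) ≫ powComp F d.obj 1 := by
  simp only [F.map_comp, map_toPow1, Category.assoc]

theorem img_toPow2 (r : 𝟙_ D ⟶ d.obj ⊗ d.obj) : ε F ≫ F.map (r ≫ toPow2 d.obj) =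
    ((ε F ≫ F.map r ≫ δ F _ _) ≫ toPow2 (F.obj d.obj)) ≫ powComp F d.obj 2 := by
  simp only [F.map_comp, Category.assoc, ← map_toPow2, δ_μ_assoc]

theorem img_toPow2' (x y : 𝟙_ D ⟶ d.obj) : ε F ≫ F.map (ptensor x y ≫ toPow2 d.obj) =
    (ptensor (ε F ≫ F.map x) (ε F ≫ F.map y) ≫ toPow2 (F.obj d.obj)) ≫ powComp F d.obj 2 := by
  simp only [F.map_comp, reassoc_of% map_ptensor F x y, Category.assoc, ← map_toPow2]

theorem img_comp {n : ℕ} (x : 𝟙_ D ⟶ d.obj) {p : d.obj ⟶ tpow d.obj n}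
    {p' : F.obj d.obj ⟶ tpow (F.obj d.obj) n} (hp : F.map p = p' ≫ powComp F d.obj n) :
    ε F ≫ F.map (x ≫ p) = ((ε F ≫ F.map x) ≫ p') ≫ powComp F d.obj n := by
  simp only [F.map_comp, hp, Category.assoc]

theorem img_legs {n : ℕ} (r : 𝟙_ D ⟶ d.obj ⊗ d.obj) (p q : d.obj ⟶ tpow d.obj n)
    (p' q' : F.obj d.obj ⟶ tpow (F.obj d.obj) n) (hp : F.map p = p' ≫ powComp F d.obj n)
    (hq : F.map q = q' ≫ powComp F d.obj n) : ε F ≫ F.map (d.legs r p q) =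
    (d.map F).legs (ε F ≫ F.map r ≫ δ F _ _) p' q' ≫ powComp F d.obj n := by
  simp only [legs, F.map_comp, Category.assoc, map, map_tensor, hp, hq]
  rw [← tensorHom_comp_tensorHom]
  simp only [Category.assoc, ← map_mulPow]

theorem map_eqn (h : ∀ {Y Z : C} {f g : Y ⟶ Z}, (d.map F).XCEqn f g → f = g) {Y Z : D}
    {f g : Y ⟶ Z} (hfg : d.XCEqn f g) : F.map f = F.map g := by
  have dot2 := fun {n : ℕ} {a b : 𝟙_ D ⟶ tpow d.obj n} {a' b'} (ha : _ = a' ≫ powComp F d.obj n)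
    (hb : _ = b' ≫ powComp F d.obj n) => map_dot F d.mul (a := a) (b := b) ha hb
  have leg := fun {n : ℕ} (r : 𝟙_ D ⟶ d.obj ⊗ d.obj) {p q : d.obj ⟶ tpow d.obj n} {p' q'}
    (hp : _ = p' ≫ powComp F d.obj n) (hq : _ = q' ≫ powComp F d.obj n) =>
    img_legs d F r p q p' q' hp hq
  have h31 : F.map d.i31 = (d.map F).i31 ≫ powComp F d.obj 3 := map_placeAt F d.one 0 2
  have h32 : F.map d.i32 = (d.map F).i32 ≫ powComp F d.obj 3 := map_placeAt F d.one 1 1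
  have h33 : F.map d.i33 = (d.map F).i33 ≫ powComp F d.obj 3 := map_placeAt F d.one 2 0
  have h51 : F.map d.i51 = (d.map F).i51 ≫ powComp F d.obj 5 := map_placeAt F d.one 0 4
  have h52 : F.map d.i52 = (d.map F).i52 ≫ powComp F d.obj 5 := map_placeAt F d.one 1 3
  have h53 : F.map d.i53 = (d.map F).i53 ≫ powComp F d.obj 5 := map_placeAt F d.one 2 2
  have h54 : F.map d.i54 = (d.map F).i54 ≫ powComp F d.obj 5 := map_placeAt F d.one 3 1
  have h55 : F.map d.i55 = (d.map F).i55 ≫ powComp F d.obj 5 := map_placeAt F d.one 4 0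
  cases hfg with
  | R_mul_inv =>
    rw [← cancel_epi (ε F), dot2 (img_toPow2 d F _) (img_toPow2 d F _), map_unitPow]
    exact congrArg (· ≫ _) (h .R_mul_inv)
  | R_inv_mul =>
    rw [← cancel_epi (ε F), dot2 (img_toPow2 d F _) (img_toPow2 d F _), map_unitPow]
    exact congrArg (· ≫ _) (h .R_inv_mul)
  | κ_mul_inv =>
    rw [← cancel_epi (ε F), dot2 (img_toPow1 d F _) (img_toPow1 d F _), map_unitPow]
    exact congrArg (· ≫ _) (h .κ_mul_inv)
  | κ_inv_mul =>
    rw [← cancel_epi (ε F), dot2 (img_toPow1 d F _) (img_toPow1 d F _), map_unitPow]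
    exact congrArg (· ≫ _) (h .κ_inv_mul)
  | xc0 =>
    rw [← cancel_epi (ε F), img_toPow2,
      dot2 (dot2 (img_toPow2' d F _ _) (img_toPow2 d F _)) (img_toPow2' d F _ _)]
    exact congrArg (· ≫ _) (h .xc0)
  | xc0inv =>
    rw [← cancel_epi (ε F), img_toPow2,
      dot2 (dot2 (img_toPow2' d F _ _) (img_toPow2 d F _)) (img_toPow2' d F _ _)]
    exact congrArg (· ≫ _) (h .xc0inv)
  | xc1f =>
    rw [← cancel_epi (ε F), F.map_comp, F.map_comp,
      reassoc_of% dot2 (leg d.R h33 h31) (img_comp d F d.κ h32),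
      reassoc_of% dot2 (leg d.R h31 h33) (img_comp d F d.κinv h32), map_iterMul]
    exact h .xc1f
  | xc2c =>
    rw [← cancel_epi (ε F), F.map_comp, F.map_comp, map_ptensor,
      reassoc_of% dot2 (dot2 (leg d.R h51 h55) (leg d.Rinv h52 h53)) (img_comp d F d.κinv h54),
      map_split F (n := 2) (m := 3), map_iterMul, map_iterMul]
    exact (congrArg (· ≫ μ F _ _) (h .xc2c)).trans
      ((Category.assoc _ _ _).trans (congrArg (_ ≫ ·) (Category.assoc _ _ _)))
  | xc2d =>
    rw [← cancel_epi (ε F), F.map_comp, F.map_comp, map_ptensor,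
      reassoc_of% dot2 (dot2 (leg d.Rinv h51 h55) (leg d.R h53 h54)) (img_comp d F d.κ h52),
      map_split F (n := 3) (m := 2), map_iterMul, map_iterMul]
    exact (congrArg (· ≫ μ F _ _) (h .xc2d)).trans
      ((Category.assoc _ _ _).trans (congrArg (_ ≫ ·) (Category.assoc _ _ _)))
  | xc3 =>
    rw [← cancel_epi (ε F),
      dot2 (dot2 (leg _ h31 h32) (leg _ h31 h33)) (leg _ h32 h33),
      dot2 (dot2 (leg _ h32 h33) (leg _ h31 h33)) (leg _ h31 h32)]
    exact congrArg (· ≫ _) (h .xc3)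

end XCData

/-! ### The PROP `XC` -/

/-- The objects of the PROP: bracketed tensor powers of one generating object. -/
inductive Word : Type
  | unit : Word
  | gen : Word
  | tensor : Word → Word → Word

/-- Formal composites and tensor products of the structure arrows of a symmetric monoidal category
and of the generators `μ : 2 → 1`, `η : 0 → 1`, `R^{±1} : 0 → 2`, `κ^{±1} : 0 → 1`. -/
inductive Term : Word → Word → Type
  | id (X : Word) : Term X X
  | comp {X Y Z : Word} (f : Term X Y) (g : Term Y Z) : Term X Z
  | whiskerLeft (X : Word) {Y Z : Word} (f : Term Y Z) : Term (X.tensor Y) (X.tensor Z)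
  | whiskerRight {X Y : Word} (f : Term X Y) (Z : Word) : Term (X.tensor Z) (Y.tensor Z)
  | α_hom (X Y Z : Word) : Term ((X.tensor Y).tensor Z) (X.tensor (Y.tensor Z))
  | α_inv (X Y Z : Word) : Term (X.tensor (Y.tensor Z)) ((X.tensor Y).tensor Z)
  | l_hom (X : Word) : Term (Word.unit.tensor X) X
  | l_inv (X : Word) : Term X (Word.unit.tensor X)
  | ρ_hom (X : Word) : Term (X.tensor Word.unit) X
  | ρ_inv (X : Word) : Term X (X.tensor Word.unit)
  | β (X Y : Word) : Term (X.tensor Y) (Y.tensor X)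
  | mul : Term (Word.gen.tensor Word.gen) Word.gen
  | one : Term Word.unit Word.gen
  | R : Term Word.unit (Word.gen.tensor Word.gen)
  | Rinv : Term Word.unit (Word.gen.tensor Word.gen)
  | κ : Term Word.unit Word.gen
  | κinv : Term Word.unit Word.gen

/-- A family of equations between formal arrows. -/
abbrev Eqns := ∀ X Y : Word, Term X Y → Term X Y → Prop

/-- The congruence generated by the laws of a symmetric monoidal category and by `E`. -/
inductive TermRel (E : Eqns) : ∀ {X Y : Word}, Term X Y → Term X Y → Prop
  | ax {X Y} {f g : Term X Y} : E X Y f g → TermRel E f g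
  | refl {X Y} (f : Term X Y) : TermRel E f f
  | symm {X Y} {f g : Term X Y} : TermRel E f g → TermRel E g f
  | trans {X Y} {f g h : Term X Y} : TermRel E f g → TermRel E g h → TermRel E f h
  | comp {X Y Z} {f f' : Term X Y} {g g' : Term Y Z} :
      TermRel E f f' → TermRel E g g' → TermRel E (f.comp g) (f'.comp g')
  | whiskerLeft (X) {Y Z} {f f' : Term Y Z} :
      TermRel E f f' → TermRel E (f.whiskerLeft X) (f'.whiskerLeft X)
  | whiskerRight {Y Z} {f f' : Term Y Z} (X) :
      TermRel E f f' → TermRel E (f.whiskerRight X) (f'.whiskerRight X)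
  | comp_id {X Y} (f : Term X Y) : TermRel E (f.comp (Term.id _)) f
  | id_comp {X Y} (f : Term X Y) : TermRel E ((Term.id _).comp f) f
  | assoc {X Y Z W} (f : Term X Y) (g : Term Y Z) (h : Term Z W) :
      TermRel E ((f.comp g).comp h) (f.comp (g.comp h))
  | whiskerLeft_id (X Y) : TermRel E ((Term.id Y).whiskerLeft X) (Term.id (X.tensor Y))
  | id_whiskerRight (X Y) : TermRel E ((Term.id X).whiskerRight Y) (Term.id (X.tensor Y))
  | whiskerLeft_comp (W) {X Y Z} (f : Term X Y) (g : Term Y Z) :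
      TermRel E ((f.comp g).whiskerLeft W) ((f.whiskerLeft W).comp (g.whiskerLeft W))
  | comp_whiskerRight {X Y Z} (f : Term X Y) (g : Term Y Z) (W) :
      TermRel E ((f.comp g).whiskerRight W) ((f.whiskerRight W).comp (g.whiskerRight W))
  | whisker_exchange {W X Y Z} (f : Term W X) (g : Term Y Z) :
      TermRel E ((g.whiskerLeft W).comp (f.whiskerRight Z)) ((f.whiskerRight Y).comp (g.whiskerLeft X))
  | α_hom_inv (X Y Z) : TermRel E ((Term.α_hom X Y Z).comp (Term.α_inv X Y Z)) (Term.id _)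
  | α_inv_hom (X Y Z) : TermRel E ((Term.α_inv X Y Z).comp (Term.α_hom X Y Z)) (Term.id _)
  | α_left {X X'} (f : Term X X') (Y Z) :
      TermRel E (((f.whiskerRight Y).whiskerRight Z).comp (Term.α_hom X' Y Z))
        ((Term.α_hom X Y Z).comp (f.whiskerRight (Y.tensor Z)))
  | α_middle (X) {Y Y'} (f : Term Y Y') (Z) :
      TermRel E (((f.whiskerLeft X).whiskerRight Z).comp (Term.α_hom X Y' Z))
        ((Term.α_hom X Y Z).comp ((f.whiskerRight Z).whiskerLeft X))
  | α_right (X Y) {Z Z'} (f : Term Z Z') :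
      TermRel E ((f.whiskerLeft (X.tensor Y)).comp (Term.α_hom X Y Z'))
        ((Term.α_hom X Y Z).comp ((f.whiskerLeft Y).whiskerLeft X))
  | ρ_hom_inv (X) : TermRel E ((Term.ρ_hom X).comp (Term.ρ_inv X)) (Term.id _)
  | ρ_inv_hom (X) : TermRel E ((Term.ρ_inv X).comp (Term.ρ_hom X)) (Term.id _)
  | ρ_naturality {X Y} (f : Term X Y) :
      TermRel E ((f.whiskerRight Word.unit).comp (Term.ρ_hom Y)) ((Term.ρ_hom X).comp f)
  | l_hom_inv (X) : TermRel E ((Term.l_hom X).comp (Term.l_inv X)) (Term.id _)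
  | l_inv_hom (X) : TermRel E ((Term.l_inv X).comp (Term.l_hom X)) (Term.id _)
  | l_naturality {X Y} (f : Term X Y) :
      TermRel E ((f.whiskerLeft Word.unit).comp (Term.l_hom Y)) ((Term.l_hom X).comp f)
  | pentagon (W X Y Z) :
      TermRel E (((Term.α_hom W X Y).whiskerRight Z).comp
          ((Term.α_hom W (X.tensor Y) Z).comp ((Term.α_hom X Y Z).whiskerLeft W)))
        ((Term.α_hom (W.tensor X) Y Z).comp (Term.α_hom W X (Y.tensor Z)))
  | triangle (X Y) :
      TermRel E ((Term.α_hom X Word.unit Y).comp ((Term.l_hom Y).whiskerLeft X))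
        ((Term.ρ_hom X).whiskerRight Y)
  | β_right (X) {Y Z} (f : Term Y Z) :
      TermRel E ((f.whiskerLeft X).comp (Term.β X Z)) ((Term.β X Y).comp (f.whiskerRight X))
  | β_left {X Y} (f : Term X Y) (Z) :
      TermRel E ((f.whiskerRight Z).comp (Term.β Y Z)) ((Term.β X Z).comp (f.whiskerLeft Z))
  | hexagon_forward (X Y Z) :
      TermRel E ((Term.α_hom X Y Z).comp ((Term.β X (Y.tensor Z)).comp (Term.α_hom Y Z X)))
        (((Term.β X Y).whiskerRight Z).comp
          ((Term.α_hom Y X Z).comp ((Term.β X Z).whiskerLeft Y)))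
  | hexagon_reverse (X Y Z) :
      TermRel E ((Term.α_inv X Y Z).comp ((Term.β (X.tensor Y) Z).comp (Term.α_inv Z X Y)))
        (((Term.β Y Z).whiskerLeft X).comp
          ((Term.α_inv X Z Y).comp ((Term.β X Z).whiskerRight Y)))
  | symmetry (X Y) : TermRel E ((Term.β X Y).comp (Term.β Y X)) (Term.id _)

/-- The symmetric monoidal category presented by the generators `μ, η, R^{±1}, κ^{±1}` and the
equations `E`. -/
def Presented (_E : Eqns) : Type := Word

namespace Presented

variable {E : Eqns}

/-- The class of a formal arrow. -/
def mk (E : Eqns) {X Y : Word} (f : Term X Y) : Quot (@TermRel E X Y) := Quot.mk _ f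

instance : Category (Presented E) where
  Hom X Y := Quot (@TermRel E X Y)
  id X := Quot.mk _ (Term.id X)
  comp := Quot.map₂ Term.comp (fun _ _ _ h => .comp (.refl _) h) (fun _ _ _ h => .comp h (.refl _))
  id_comp := by rintro X Y ⟨f⟩; exact Quot.sound (.id_comp f)
  comp_id := by rintro X Y ⟨f⟩; exact Quot.sound (.comp_id f)
  assoc := by rintro W X Y Z ⟨f⟩ ⟨g⟩ ⟨h⟩; exact Quot.sound (.assoc f g h)

instance : MonoidalCategoryStruct (Presented E) where
  tensorObj X Y := Word.tensor X Y
  tensorUnit := Word.unit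
  whiskerLeft X _ _ f := Quot.map (fun f => Term.whiskerLeft X f) (fun _ _ h => .whiskerLeft X h) f
  whiskerRight f Y := Quot.map (fun f => Term.whiskerRight f Y) (fun _ _ h => .whiskerRight Y h) f
  associator X Y Z := ⟨Quot.mk _ (.α_hom X Y Z), Quot.mk _ (.α_inv X Y Z),
    Quot.sound (.α_hom_inv X Y Z), Quot.sound (.α_inv_hom X Y Z)⟩
  leftUnitor X := ⟨Quot.mk _ (.l_hom X), Quot.mk _ (.l_inv X),
    Quot.sound (.l_hom_inv X), Quot.sound (.l_inv_hom X)⟩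
  rightUnitor X := ⟨Quot.mk _ (.ρ_hom X), Quot.mk _ (.ρ_inv X),
    Quot.sound (.ρ_hom_inv X), Quot.sound (.ρ_inv_hom X)⟩

theorem wl_comp (W : Presented E) {X Y Z : Presented E} (f : X ⟶ Y) (g : Y ⟶ Z) :
    W ◁ (f ≫ g) = W ◁ f ≫ W ◁ g := by
  induction f using Quot.ind; induction g using Quot.ind
  exact Quot.sound (.whiskerLeft_comp _ _ _)

theorem wr_comp {X Y Z : Presented E} (f : X ⟶ Y) (g : Y ⟶ Z) (W : Presented E) :
    (f ≫ g) ▷ W = f ▷ W ≫ g ▷ W := by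
  induction f using Quot.ind; induction g using Quot.ind
  exact Quot.sound (.comp_whiskerRight _ _ _)

theorem w_exch {W X Y Z : Presented E} (f : W ⟶ X) (g : Y ⟶ Z) :
    W ◁ g ≫ f ▷ Z = f ▷ Y ≫ X ◁ g := by
  induction f using Quot.ind; induction g using Quot.ind
  exact Quot.sound (.whisker_exchange _ _)

theorem α_left {X X' : Presented E} (f : X ⟶ X') (Y Z : Presented E) :
    f ▷ Y ▷ Z ≫ (α_ X' Y Z).hom = (α_ X Y Z).hom ≫ f ▷ (Y ⊗ Z) := by
  induction f using Quot.ind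
  exact Quot.sound (.α_left _ _ _)

theorem α_middle (X : Presented E) {Y Y' : Presented E} (f : Y ⟶ Y') (Z : Presented E) :
    (X ◁ f) ▷ Z ≫ (α_ X Y' Z).hom = (α_ X Y Z).hom ≫ X ◁ f ▷ Z := by
  induction f using Quot.ind
  exact Quot.sound (.α_middle _ _ _)

theorem α_right (X Y : Presented E) {Z Z' : Presented E} (f : Z ⟶ Z') :
    (X ⊗ Y) ◁ f ≫ (α_ X Y Z').hom = (α_ X Y Z).hom ≫ X ◁ Y ◁ f := by
  induction f using Quot.ind
  exact Quot.sound (.α_right _ _ _)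

theorem wl_id (X Y : Presented E) : X ◁ 𝟙 Y = 𝟙 (X ⊗ Y) :=
  Quot.sound (.whiskerLeft_id X Y)

theorem wr_id (X Y : Presented E) : 𝟙 X ▷ Y = 𝟙 (X ⊗ Y) :=
  Quot.sound (.id_whiskerRight X Y)

instance : MonoidalCategory (Presented E) where
  tensorHom_def _ _ := rfl
  id_tensorHom_id X Y := by
    change 𝟙 X ▷ Y ≫ X ◁ 𝟙 Y = _
    rw [wr_id, wl_id, Category.comp_id]
  tensorHom_comp_tensorHom {X₁ Y₁ Z₁ X₂ Y₂ Z₂} f₁ f₂ g₁ g₂ := by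
    change (f₁ ▷ X₂ ≫ Y₁ ◁ f₂) ≫ (g₁ ▷ Y₂ ≫ Z₁ ◁ g₂) = (f₁ ≫ g₁) ▷ X₂ ≫ Z₁ ◁ (f₂ ≫ g₂)
    rw [wr_comp, wl_comp, Category.assoc, Category.assoc, ← Category.assoc (Y₁ ◁ f₂), w_exch,
      Category.assoc]
  whiskerLeft_id := wl_id
  id_whiskerRight := wr_id
  associator_naturality {X₁ X₂ X₃ Y₁ Y₂ Y₃} f₁ f₂ f₃ := by
    change ((f₁ ▷ X₂ ≫ Y₁ ◁ f₂) ▷ X₃ ≫ (Y₁ ⊗ Y₂) ◁ f₃) ≫ (α_ Y₁ Y₂ Y₃).hom =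
      (α_ X₁ X₂ X₃).hom ≫ (f₁ ▷ (X₂ ⊗ X₃) ≫ Y₁ ◁ (f₂ ▷ X₃ ≫ Y₂ ◁ f₃))
    rw [wr_comp, wl_comp, Category.assoc, Category.assoc, α_right, ← Category.assoc (α_ _ _ _).hom,
      ← α_left, Category.assoc, ← Category.assoc (α_ _ _ _).hom, ← α_middle, Category.assoc]
  leftUnitor_naturality f := by
    induction f using Quot.ind
    exact Quot.sound (.l_naturality _)
  rightUnitor_naturality f := by
    induction f using Quot.ind
    exact Quot.sound (.ρ_naturality _)
  pentagon W X Y Z := Quot.sound (.pentagon W X Y Z)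
  triangle X Y := Quot.sound (.triangle X Y)

instance : SymmetricCategory (Presented E) where
  braiding X Y := ⟨Quot.mk _ (.β X Y), Quot.mk _ (.β Y X), Quot.sound (.symmetry X Y),
    Quot.sound (.symmetry Y X)⟩
  braiding_naturality_right X _ _ f := by
    induction f using Quot.ind
    exact Quot.sound (.β_right _ _)
  braiding_naturality_left f Z := by
    induction f using Quot.ind
    exact Quot.sound (.β_left _ _)
  hexagon_forward X Y Z := Quot.sound (.hexagon_forward X Y Z)
  hexagon_reverse X Y Z := Quot.sound (.hexagon_reverse X Y Z)
  symmetry X Y := Quot.sound (.symmetry X Y)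

/-- The generating object with the generating arrows. -/
def data (E : Eqns) : XCData (Presented E) where
  obj := Word.gen
  mul := Quot.mk _ Term.mul
  one := Quot.mk _ Term.one
  R := Quot.mk _ Term.R
  Rinv := Quot.mk _ Term.Rinv
  κ := Quot.mk _ Term.κ
  κinv := Quot.mk _ Term.κinv

section Eval

variable {C : Type u} [Category.{v} C] [MonoidalCategory C] [SymmetricCategory C] (d : XCData C)

/-- The interpretation of objects in a symmetric monoidal category. -/
def evalObj : Word → C
  | .unit => 𝟙_ C
  | .gen => d.obj
  | .tensor X Y => evalObj X ⊗ evalObj Y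

/-- The interpretation of formal arrows in a symmetric monoidal category. -/
def interpTerm : ∀ {X Y : Word}, Term X Y → (evalObj d X ⟶ evalObj d Y)
  | _, _, .id _ => 𝟙 _
  | _, _, .comp f g => interpTerm f ≫ interpTerm g
  | _, _, .whiskerLeft X f => evalObj d X ◁ interpTerm f
  | _, _, .whiskerRight f X => interpTerm f ▷ evalObj d X
  | _, _, .α_hom X Y Z => (α_ (evalObj d X) (evalObj d Y) (evalObj d Z)).hom
  | _, _, .α_inv X Y Z => (α_ (evalObj d X) (evalObj d Y) (evalObj d Z)).inv
  | _, _, .l_hom X => (λ_ (evalObj d X)).hom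
  | _, _, .l_inv X => (λ_ (evalObj d X)).inv
  | _, _, .ρ_hom X => (ρ_ (evalObj d X)).hom
  | _, _, .ρ_inv X => (ρ_ (evalObj d X)).inv
  | _, _, .β X Y => (β_ (evalObj d X) (evalObj d Y)).hom
  | _, _, .mul => d.mul
  | _, _, .one => d.one
  | _, _, .R => d.R
  | _, _, .Rinv => d.Rinv
  | _, _, .κ => d.κ
  | _, _, .κinv => d.κinv

theorem interpTerm_eq (hE : ∀ X Y f g, E X Y f g → interpTerm d f = interpTerm d g) {X Y : Word}
    {f g : Term X Y} (h : TermRel E f g) : interpTerm d f = interpTerm d g := by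
  induction h with
  | ax h => exact hE _ _ _ _ h
  | refl => rfl
  | symm _ h => exact h.symm
  | trans _ _ h h' => exact h.trans h'
  | comp _ _ h h' => simp only [interpTerm, h, h']
  | whiskerLeft X _ h => exact congrArg (evalObj d X ◁ ·) h
  | whiskerRight X _ h => exact congrArg (· ▷ evalObj d X) h
  | whisker_exchange f g => exact whisker_exchange _ _
  | hexagon_forward => exact BraidedCategory.hexagon_forward _ _ _
  | hexagon_reverse => exact BraidedCategory.hexagon_reverse _ _ _
  | pentagon => exact MonoidalCategory.pentagon _ _ _ _
  | triangle => exact MonoidalCategory.triangle _ _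
  | α_left => exact MonoidalCategory.associator_naturality_left _ _ _
  | α_middle => exact MonoidalCategory.associator_naturality_middle _ _ _
  | α_right => exact MonoidalCategory.associator_naturality_right _ _ _
  | ρ_naturality => exact MonoidalCategory.rightUnitor_naturality _
  | l_naturality => exact MonoidalCategory.leftUnitor_naturality _
  | β_left => exact BraidedCategory.braiding_naturality_left _ _
  | β_right => exact BraidedCategory.braiding_naturality_right _ _
  | symmetry => exact SymmetricCategory.symmetry _ _
  | whiskerLeft_id => exact MonoidalCategory.whiskerLeft_id _ _
  | id_whiskerRight => exact MonoidalCategory.id_whiskerRight _ _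
  | whiskerLeft_comp => exact MonoidalCategory.whiskerLeft_comp _ _ _
  | comp_whiskerRight => exact MonoidalCategory.comp_whiskerRight _ _ _
  | comp_id => exact Category.comp_id _
  | id_comp => exact Category.id_comp _
  | assoc => exact Category.assoc _ _ _
  | α_hom_inv => exact Iso.hom_inv_id _
  | α_inv_hom => exact Iso.inv_hom_id _
  | ρ_hom_inv => exact Iso.hom_inv_id _
  | ρ_inv_hom => exact Iso.inv_hom_id _
  | l_hom_inv => exact Iso.hom_inv_id _
  | l_inv_hom => exact Iso.inv_hom_id _

/-- The strict symmetric monoidal functor that sends the generators to the operations of `d`. -/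
def eval (hE : ∀ X Y f g, E X Y f g → interpTerm d f = interpTerm d g) : Presented E ⥤ C where
  obj := evalObj d
  map f := Quot.lift (interpTerm d) (fun _ _ h => interpTerm_eq d hE h) f
  map_comp f g := by induction f using Quot.ind; induction g using Quot.ind; rfl

variable {d} (hE : ∀ X Y f g, E X Y f g → interpTerm d f = interpTerm d g)

theorem eval_whiskerLeft (X : Presented E) {Y Z : Presented E} (f : Y ⟶ Z) :
    (eval d hE).map (X ◁ f) = evalObj d X ◁ (eval d hE).map f := by
  induction f using Quot.ind; rfl

theorem eval_whiskerRight {X Y : Presented E} (f : X ⟶ Y) (Z : Presented E) :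
    (eval d hE).map (f ▷ Z) = (eval d hE).map f ▷ evalObj d Z := by
  induction f using Quot.ind; rfl

instance : (eval d hE).Monoidal :=
  Functor.CoreMonoidal.toMonoidal
    { εIso := Iso.refl _
      μIso := fun _ _ => Iso.refl _
      μIso_hom_natural_left := fun f X => by
        rw [eval_whiskerRight]
        exact (Category.comp_id _).trans (Category.id_comp _).symm
      μIso_hom_natural_right := fun X f => by
        rw [eval_whiskerLeft]
        exact (Category.comp_id _).trans (Category.id_comp _).symm
      associativity := fun X Y Z => by
        change 𝟙 _ ▷ evalObj d Z ≫ 𝟙 _ ≫ (α_ (evalObj d X) (evalObj d Y) (evalObj d Z)).hom =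
          (α_ (evalObj d X) (evalObj d Y) (evalObj d Z)).hom ≫ evalObj d X ◁ 𝟙 _ ≫ 𝟙 _
        simp
      left_unitality := fun X => by
        change (λ_ (evalObj d X)).hom = 𝟙 _ ▷ evalObj d X ≫ 𝟙 _ ≫ (λ_ (evalObj d X)).hom
        simp
      right_unitality := fun X => by
        change (ρ_ (evalObj d X)).hom = evalObj d X ◁ 𝟙 _ ≫ 𝟙 _ ≫ (ρ_ (evalObj d X)).hom
        simp }

instance : (eval d hE).Braided where
  braided X Y := by
    change 𝟙 _ ≫ (β_ (evalObj d X) (evalObj d Y)).hom = (β_ (evalObj d X) (evalObj d Y)).hom ≫ 𝟙 _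
    simp

theorem data_map : (data E).map (eval d hE) = d := by
  change XCData.mk d.obj (𝟙 _ ≫ d.mul) (𝟙 _ ≫ d.one) (𝟙 _ ≫ d.R ≫ 𝟙 _) (𝟙 _ ≫ d.Rinv ≫ 𝟙 _)
    (𝟙 _ ≫ d.κ) (𝟙 _ ≫ d.κinv) = d
  simp

end Eval

end Presented

/-- The free symmetric monoidal category on the generators `μ, η, R^{±1}, κ^{±1}`, without
equations. -/
abbrev FreeSym : Type := Presented (fun _ _ _ _ => False)

/-- The equations of the theory of XC-algebras, between formal arrows. -/
def xcEqns : Eqns := fun X Y f g =>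
  (Presented.data _).AlgEqn (C := FreeSym) (Y := X) (Z := Y) (Quot.mk _ f) (Quot.mk _ g) ∨
  (Presented.data _).XCEqn (C := FreeSym) (Y := X) (Z := Y) (Quot.mk _ f) (Quot.mk _ g)

/-- The PROP for XC-algebras: the symmetric monoidal category generated by an XC-algebra
object. Its objects are the bracketed tensor powers of the generator; the set of arrows `n → m` of
the PROP is the set of arrows between the `n`-th and the `m`-th power of the generator. -/
abbrev XC : Type := Presented xcEqns

namespace XC

/-- The generating object. -/
def gen : XC := Word.gen

/-- The generating arrows of the PROP. -/
def mul : gen ⊗ gen ⟶ gen := (Presented.data xcEqns).mul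
def one : 𝟙_ XC ⟶ gen := (Presented.data xcEqns).one
def R : 𝟙_ XC ⟶ gen ⊗ gen := (Presented.data xcEqns).R
def Rinv : 𝟙_ XC ⟶ gen ⊗ gen := (Presented.data xcEqns).Rinv
def κ : 𝟙_ XC ⟶ gen := (Presented.data xcEqns).κ
def κinv : 𝟙_ XC ⟶ gen := (Presented.data xcEqns).κinv

section
variable {C : Type u} [Category.{v} C] [MonoidalCategory C] [SymmetricCategory C]
  {A : C} [MonObj A] (S : XCStructure A)

theorem eval_eqns (X Y : Word) (f g : Term X Y) (h : xcEqns X Y f g) :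
    Presented.interpTerm S.data f = Presented.interpTerm S.data g := by
  have hE : ∀ X Y f g, (fun _ _ _ _ => False : Eqns) X Y f g →
    Presented.interpTerm S.data f = Presented.interpTerm S.data g := by simp
  have key : ∀ {X Y : FreeSym} (f g : X ⟶ Y),
      (Presented.data _).AlgEqn f g ∨ (Presented.data _).XCEqn f g →
      (Presented.eval S.data hE).map f = (Presented.eval S.data hE).map g := by
    rintro X Y f g (h | h)
    · cases h with
      | one_mul => exact MonObj.one_mul A
      | mul_one => exact MonObj.mul_one A
      | mul_assoc => exact MonObj.mul_assoc A
    · refine (Presented.data _).map_eqn _ (fun h => ?_) h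
      rw [Presented.data_map] at h
      exact S.eqn' h
  exact key (X := X) (Y := Y) (Quot.mk _ f) (Quot.mk _ g) h

/-- The strict symmetric monoidal functor `XC ⥤ C` that corresponds to an XC-algebra object. -/
def functor : XC ⥤ C := Presented.eval S.data (eval_eqns S)

instance : (functor S).Braided := inferInstanceAs (Presented.eval S.data (eval_eqns S)).Braided

end
end XC

/-! ### Operations on permutations -/

/-- The block product of permutations. -/
def blockPerm {n m : ℕ} (σ : Equiv.Perm (Fin n)) (ξ : Equiv.Perm (Fin m)) :
    Equiv.Perm (Fin (n + m)) :=
  finSumFinEquiv.permCongr (σ.sumCongr ξ)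

/-- The permutation `i ↦ i + m (mod n + m)`. -/
def braidPerm (n m : ℕ) : Equiv.Perm (Fin (n + m)) :=
  finSumFinEquiv.symm.trans
    ((Equiv.sumComm _ _).trans (finSumFinEquiv.trans (finCongr (Nat.add_comm m n))))

/-- The `j`-th place of the `i`-th block, when `k_1 + ⋯ + k_r` places are divided into consecutive
blocks of lengths `k_1, …, k_r`. -/
def blockPos : ∀ {r : ℕ} (k : Fin r → ℕ) (i : Fin r), Fin (k i) → Fin (total k)
  | 0, _, i => i.elim0
  | r + 1, k, i =>
    Fin.lastCases (motive := fun i => Fin (k i) → Fin (total k))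
      (fun j => Fin.natAdd (total fun i : Fin r => k i.castSucc) j)
      (fun i j => Fin.castAdd (k (Fin.last r)) (blockPos (fun i : Fin r => k i.castSucc) i j)) i

/-- The permutation of the `r` strands that arise when the strands of each of the blocks of lengths
`k_1, …, k_r` are merged into one. A merged strand ends where the first strand of its block ended;
the endpoints of the other strands of the block disappear, and the remaining endpoints are
renumbered in their order. Where `k_i = 0`, a new strand is inserted that starts and ends at the
place `i`. In other words, with `S = {i | k_i ≠ 0}`, the elements of `S` are permuted among
themselves in such a way that the images of the elements `i ∈ S` are in the same relative order
as the images `σ(k_1 + ⋯ + k_{i-1} + 1)`; the elements outside `S` are fixed. -/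
def mergePerm {r : ℕ} (k : Fin r → ℕ) (σ : Equiv.Perm (Fin (total k))) : Equiv.Perm (Fin r) :=
  let S : Finset (Fin r) := {i | 0 < k i}
  let e : Fin S.card ≃o S := S.orderIsoOfFin rfl
  let f : Fin S.card → Fin (total k) := fun a =>
    σ (blockPos k (e a) ⟨0, (Finset.mem_filter.mp (e a).2).2⟩)
  Equiv.Perm.ofSubtype (e.toEquiv.permCongr (Tuple.sort f)⁻¹)

/-! ### The virtual category of elements -/

section Interp

open Functor.LaxMonoidal

variable {C : Type u} [Category.{v} C] [MonoidalCategory C] [SymmetricCategory C]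
  {A : C} [MonObj A] (S : XCStructure A)

/-- The isomorphism `A^{⊗ n} ≅ A(n)`, where the second `A` is the functor `XC ⥤ C`. -/
def XC.comparison (n : ℕ) : tpow A n ⟶ (XC.functor S).obj (tpow XC.gen n) :=
  powComp (XC.functor S) XC.gen n

instance (n : ℕ) : IsIso (XC.comparison S n) :=
  inferInstanceAs (IsIso (powComp (XC.functor S) XC.gen n))

/-- The map `Hom_{XC}(0, n) ⟶ Hom_C(𝟙, A^{⊗ n})` induced by the functor `XC ⥤ C`. -/
noncomputable def XC.interp {n : ℕ} (f : 𝟙_ XC ⟶ tpow XC.gen n) : 𝟙_ C ⟶ tpow A n :=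
  ε (XC.functor S) ≫ (XC.functor S).map f ≫ inv (XC.comparison S n)

theorem XC.interp_eq_iff {n : ℕ} (f : 𝟙_ XC ⟶ tpow XC.gen n) (a : 𝟙_ C ⟶ tpow A n) :
    XC.interp S f = a ↔
      ε (XC.functor S) ≫ (XC.functor S).map f = a ≫ powComp (XC.functor S) XC.gen n := by
  rw [XC.interp, ← Category.assoc, IsIso.comp_inv_eq]; rfl

theorem XC.interp_comp {n : ℕ} (f : 𝟙_ XC ⟶ tpow XC.gen n) :
    ε (XC.functor S) ≫ (XC.functor S).map f =
      XC.interp S f ≫ powComp (XC.functor S) XC.gen n :=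
  (XC.interp_eq_iff S f _).mp rfl

open scoped MonObj

theorem XC.map_mul : Functor.LaxMonoidal.μ (XC.functor S) XC.gen XC.gen ≫ (XC.functor S).map XC.mul = μ[A] :=
  Category.id_comp _

theorem XC.map_one : ε (XC.functor S) ≫ (XC.functor S).map XC.one = η[A] :=
  Category.id_comp _

theorem XC.interp_unitPow (n : ℕ) : XC.interp S (unitPow XC.one n) = unitPow η[A] n := by
  rw [XC.interp_eq_iff, map_unitPow]
  exact congrArg (fun e => unitPow e n ≫ _) (XC.map_one S)

theorem XC.interp_dot {n : ℕ} (f g : 𝟙_ XC ⟶ tpow XC.gen n) :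
    XC.interp S (dot XC.mul f g) = dot μ[A] (XC.interp S f) (XC.interp S g) := by
  rw [XC.interp_eq_iff]
  refine (map_dot _ _ (XC.interp_comp S f) (XC.interp_comp S g)).trans ?_
  exact congrArg (fun m => dot m _ _ ≫ _) (XC.map_mul S)

theorem XC.interp_permMap {n : ℕ} (f : 𝟙_ XC ⟶ tpow XC.gen n) (σ : Equiv.Perm (Fin n)) :
    XC.interp S (f ≫ permMap XC.gen σ) = XC.interp S f ≫ permMap A σ := by
  rw [XC.interp_eq_iff, Functor.map_comp, reassoc_of% XC.interp_comp S f]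
  exact (Category.assoc _ _ _).trans ((congrArg (XC.interp S f ≫ ·) (map_permMap _ σ)).trans
    (Category.assoc _ _ _).symm)

theorem XC.interp_powTensor {n m : ℕ} (f : 𝟙_ XC ⟶ tpow XC.gen n) (g : 𝟙_ XC ⟶ tpow XC.gen m) :
    XC.interp S (powTensor f g) = powTensor (XC.interp S f) (XC.interp S g) := by
  rw [XC.interp_eq_iff]
  exact map_powTensor _ (XC.interp_comp S f) (XC.interp_comp S g)

theorem XC.interp_blockMul {r : ℕ} (k : Fin r → ℕ) (f : 𝟙_ XC ⟶ tpow XC.gen (total k)) :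
    XC.interp S (f ≫ blockMul XC.mul XC.one k) = XC.interp S f ≫ blockMul μ[A] η[A] k := by
  rw [XC.interp_eq_iff, Functor.map_comp, reassoc_of% XC.interp_comp S f]
  have h : blockMul (Functor.LaxMonoidal.μ (XC.functor S) XC.gen XC.gen ≫ (XC.functor S).map XC.mul)
      (ε (XC.functor S) ≫ (XC.functor S).map XC.one) k = blockMul μ[A] η[A] k := by
    rw [XC.map_mul, XC.map_one]
    rfl
  have h' := map_blockMul (XC.functor S) XC.mul XC.one k
  rw [h] at h'
  exact (Category.assoc _ _ _).trans ((congrArg (XC.interp S f ≫ ·) h').trans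
    (Category.assoc _ _ _).symm)

theorem XC.interp_toPow1 (f : 𝟙_ XC ⟶ XC.gen) (a : 𝟙_ C ⟶ A)
    (h : ε (XC.functor S) ≫ (XC.functor S).map f = a) :
    XC.interp S (f ≫ toPow1 XC.gen) = a ≫ toPow1 A := by
  rw [XC.interp_eq_iff, Functor.map_comp, map_toPow1, reassoc_of% h]
  exact (Category.assoc _ _ _).symm

theorem XC.interp_toPow2 (f : 𝟙_ XC ⟶ XC.gen ⊗ XC.gen) (a : 𝟙_ C ⟶ A ⊗ A)
    (h : ε (XC.functor S) ≫ (XC.functor S).map f = a ≫ Functor.LaxMonoidal.μ (XC.functor S) XC.gen XC.gen) :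
    XC.interp S (f ≫ toPow2 XC.gen) = a ≫ toPow2 A := by
  rw [XC.interp_eq_iff, Functor.map_comp, reassoc_of% h]
  exact (Category.assoc _ _ _).trans ((congrArg (a ≫ ·) (map_toPow2 _)).trans
    (Category.assoc _ _ _).symm)

end Interp

section VE

open scoped MonObj

variable {C : Type u} [Category.{v} C] [MonoidalCategory C] [SymmetricCategory C]
  {A : C} [MonObj A] (S : XCStructure A)

/-- The endomorphisms of the object `n` in the virtual category of elements of `A`:
the set `A(Hom_{XC}(0, n)) × 𝔖_n`. -/
@[ext]
structure VE (n : ℕ) where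
  elt : 𝟙_ C ⟶ tpow A n
  mem : elt ∈ Set.range (XC.interp S (n := n))
  perm : Equiv.Perm (Fin n)

namespace VE

variable {S}

/-- The identity `(η^{⊗ n}, Id)`. -/
instance (n : ℕ) : One (VE S n) where
  one := ⟨unitPow η[A] n, ⟨_, XC.interp_unitPow S n⟩, 1⟩

/-- The composition `(u, σ) ∘ (v, τ) = (P_{τ⁻¹}(u) · v, σ τ)`. -/
instance (n : ℕ) : Mul (VE S n) where
  mul x y := ⟨dot μ[A] (x.elt ≫ permMap A y.perm⁻¹) y.elt, by
    obtain ⟨f, hf⟩ := x.mem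
    obtain ⟨g, hg⟩ := y.mem
    exact ⟨dot XC.mul (f ≫ permMap XC.gen y.perm⁻¹) g, by
      rw [XC.interp_dot, XC.interp_permMap, hf, hg]⟩, x.perm * y.perm⟩

theorem one_elt (n : ℕ) : (1 : VE S n).elt = unitPow η[A] n := rfl
theorem one_perm (n : ℕ) : (1 : VE S n).perm = 1 := rfl
theorem mul_elt {n : ℕ} (x y : VE S n) :
    (x * y).elt = dot μ[A] (x.elt ≫ permMap A y.perm⁻¹) y.elt := rfl
theorem mul_perm {n : ℕ} (x y : VE S n) : (x * y).perm = x.perm * y.perm := rfl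

instance (n : ℕ) : Monoid (VE S n) where
  one_mul x := by
    ext1
    · rw [mul_elt, one_elt, unitPow_permMap, unitPow_dot]
    · rw [mul_perm, one_perm, one_mul]
  mul_one x := by
    ext1
    · rw [mul_elt, one_elt, one_perm, inv_one, permMap_one, Category.comp_id, dot_unitPow]
    · rw [mul_perm, one_perm, mul_one]
  mul_assoc x y z := by
    ext1
    · simp only [mul_elt, mul_perm, mul_inv_rev, permMap_mul, dot_permMap, dot_assoc,
        Category.assoc]
    · simp only [mul_perm, mul_assoc]

/-- The monoidal product `(u, σ) ⊗ (v, ξ) = (u ⊗ v, σ ⊗ ξ)`. -/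
def tensor {n m : ℕ} (x : VE S n) (y : VE S m) : VE S (n + m) :=
  ⟨powTensor x.elt y.elt, by
    obtain ⟨f, hf⟩ := x.mem
    obtain ⟨g, hg⟩ := y.mem
    exact ⟨powTensor f g, by rw [XC.interp_powTensor, hf, hg]⟩, blockPerm x.perm y.perm⟩

/-- The symmetric braiding `P_{n,m} = (η^{⊗ (n + m)}, i ↦ i + m)`. -/
def braid (n m : ℕ) : VE S (n + m) :=
  ⟨unitPow η[A] (n + m), ⟨_, XC.interp_unitPow S (n + m)⟩, braidPerm n m⟩

/-- The action of permutations: the places at which the strands start (and with them the tensor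
factors) are renumbered by `τ`, and the places at which they end are renumbered by `ρ`. -/
def permute {n : ℕ} (ρ τ : Equiv.Perm (Fin n)) (x : VE S n) : VE S n :=
  ⟨x.elt ≫ permMap A τ, by
    obtain ⟨f, hf⟩ := x.mem
    exact ⟨f ≫ permMap XC.gen τ, by rw [XC.interp_permMap, hf]⟩, ρ * x.perm * τ⁻¹⟩

/-- The action of `μ_{k_1, …, k_r}`. -/
def merge {r : ℕ} (k : Fin r → ℕ) (x : VE S (total k)) : VE S r :=
  ⟨x.elt ≫ blockMul μ[A] η[A] k, by
    obtain ⟨f, hf⟩ := x.mem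
    exact ⟨f ≫ blockMul XC.mul XC.one k, by rw [XC.interp_blockMul, hf]⟩, mergePerm k x.perm⟩

variable (S)

/-- `(R, (12))`. -/
def X : VE S 2 :=
  ⟨S.R ≫ toPow2 A, ⟨XC.R ≫ toPow2 XC.gen, XC.interp_toPow2 S _ _
    ((Category.id_comp S.R).trans (Category.comp_id S.R).symm)⟩, Equiv.swap 0 1⟩

/-- `(R_{21}^{-1}, (12))`. -/
def Xinv : VE S 2 :=
  ⟨(S.Rinv ≫ (β_ A A).hom) ≫ toPow2 A, ⟨(XC.Rinv ≫ (β_ XC.gen XC.gen).hom) ≫ toPow2 XC.gen,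
    XC.interp_toPow2 S _ _ (by
      refine (Category.id_comp (S.Rinv ≫ (β_ A A).hom)).trans (Category.comp_id _).symm)⟩,
    Equiv.swap 0 1⟩

/-- `(κ^{-1}, Id)`. -/
def K : VE S 1 :=
  ⟨S.κinv ≫ toPow1 A, ⟨XC.κinv ≫ toPow1 XC.gen, XC.interp_toPow1 S _ _ (Category.id_comp S.κinv)⟩, 1⟩

/-- `(κ, Id)`. -/
def Kinv : VE S 1 :=
  ⟨S.κ ≫ toPow1 A, ⟨XC.κ ≫ toPow1 XC.gen, XC.interp_toPow1 S _ _ (Category.id_comp S.κ)⟩, 1⟩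

end VE

end VE

/-! ### Paths -/

/-- A path: an alternating sequence `e_0, v_1, e_1, …, v_l, e_l` of edges and interior vertices,
where edges and vertices are recorded by labels in `E` and `V`. -/
@[ext]
structure EPath (E V : Type) where
  head : E
  tail : List (V × E)

namespace EPath

variable {E E' V W : Type}

/-- The path with one edge. -/
def edge (e : E) : EPath E V := ⟨e, []⟩

/-- The path `p`, then the vertex `v`, then the path `q`. -/
def glue (v : V) (p q : EPath E V) : EPath E V := ⟨p.head, p.tail ++ (v, q.head) :: q.tail⟩

/-- Relabel the vertices. -/
def mapV (f : V → W) (p : EPath E V) : EPath E W := ⟨p.head, p.tail.map (Prod.map f id)⟩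

/-- Replace every edge by a path. -/
def bind (p : EPath E V) (f : E → EPath E' V) : EPath E' V :=
  ⟨(f p.head).head, (f p.head).tail ++
    p.tail.flatMap fun ve => (ve.1, (f ve.2).head) :: (f ve.2).tail⟩

/-- The number of interior vertices with the label `v`. -/
noncomputable def count (v : V) (p : EPath E V) : ℕ :=
  open Classical in p.tail.countP fun ve => decide (ve.1 = v)

theorem glue_assoc (v w : V) (p q r : EPath E V) :
    glue w (glue v p q) r = glue v p (glue w q r) := by
  simp [glue]

theorem mapV_glue (f : V → W) (v : V) (p q : EPath E V) :
    (glue v p q).mapV f = glue (f v) (p.mapV f) (q.mapV f) := by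
  simp [glue, mapV]

theorem mapV_mapV {U : Type} (f : V → W) (g : W → U) (p : EPath E V) :
    (p.mapV f).mapV g = p.mapV (g ∘ f) := by
  simp [mapV]

theorem bind_glue (v : V) (p q : EPath E V) (f : E → EPath E' V) :
    (glue v p q).bind f = glue v (p.bind f) (q.bind f) := by
  simp [glue, bind]

theorem bind_edge (e : E) (f : E → EPath E' V) : (edge e : EPath E V).bind f = f e := by
  simp [edge, bind]

theorem mapV_bind (f : V → W) (p : EPath E V) (g : E → EPath E' V) :
    (p.bind g).mapV f = (p.mapV f).bind fun e => (g e).mapV f := by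
  simp [bind, mapV, List.map_flatMap, List.flatMap_map]

theorem count_glue (u v : V) (p q : EPath E V) (h : v ≠ u) :
    (glue v p q).count u = p.count u + q.count u := by
  simp [count, glue, h]

theorem count_edge (u : V) (e : E) : (edge e).count u = 0 := rfl

theorem count_mapV (f : V → W) (hf : Function.Injective f) (v : V) (p : EPath E V) :
    (p.mapV f).count (f v) = p.count v := by
  simp only [count, mapV, List.countP_map]
  exact List.countP_congr fun ve _ => by simp [hf.eq_iff]

theorem count_mapV_of_ne (f : V → W) (w : W) (hw : ∀ v, f v ≠ w) (p : EPath E V) :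
    (p.mapV f).count w = 0 := by
  simp [count, mapV, List.countP_map, Function.comp_def, hw]

end EPath

/-! ### XC-tangle diagrams -/

/-- The labels of the interior vertices of a strand: a bivalent vertex, or one of the two passages
through the crossing (tetravalent vertex) `x`. -/
inductive Vtx (X : Type) : Type
  | bi : Vtx X
  | cross (x : X) (isOver : Bool) : Vtx X

/-- Relabel the crossings. -/
def Vtx.map {X Y : Type} (f : X → Y) : Vtx X → Vtx Y
  | bi => bi
  | cross x o => cross (f x) o

theorem Vtx.map_comp {X Y Z : Type} (f : X → Y) (g : Y → Z) :
    Vtx.map g ∘ Vtx.map f = Vtx.map (g ∘ f) := by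
  funext v; cases v <;> rfl

theorem Vtx.map_injective {X Y : Type} {f : X → Y} (hf : Function.Injective f) :
    Function.Injective (Vtx.map f) := by
  rintro (_ | ⟨x, o⟩) (_ | ⟨y, o'⟩) h <;> simp_all [Vtx.map, hf.eq_iff]

/-- A directed path in an XC-tangle diagram with set of crossings `X`. The edges are labelled by
their rotation numbers `-1`, `0`, `1`. -/
abbrev Strand (X : Type) : Type := EPath SignType (Vtx X)

/-- Relabel the crossings on a strand. -/
def EPath.rename {X Y : Type} {E : Type} (f : X → Y) (p : EPath E (Vtx X)) : EPath E (Vtx Y) :=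
  p.mapV (Vtx.map f)

/-- Glue the end of the strand `p` to the start of the strand `q`, which become one bivalent
vertex. -/
def EPath.join {X : Type} {E : Type} (p q : EPath E (Vtx X)) : EPath E (Vtx X) :=
  EPath.glue Vtx.bi p q

/-- An XC-tangle diagram with `n` strands. A diagram is a union of its strands, each of which is a
directed path between univalent vertices, and a tetravalent vertex (crossing) is a place where two
passages of strands meet. So a diagram is given by
* the finite set `X` of crossings and their signs,
* for each `i`, the strand that starts at the `i`-th outgoing univalent vertex, with the
  rotation numbers of its edges; a crossing has two incoming half-edges, which are adjacent in the
  cyclic order, and thus there are two ways in which the strands may pass through it, of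
  which one enters by the first and the other one by the second of these half-edges. When a crossing
  is drawn according to its sign, these are the overpassing and the underpassing strand, and
  a passage is recorded by the crossing and by whether it is the overpassing one (`true`),
* the bijection `perm` from outgoing to incoming univalent vertices: the `i`-th strand ends at
  the incoming vertex number `perm i`. -/
structure XCDiagram (n : ℕ) where
  X : Type
  finite : Finite X
  sign : X → Bool
  strand : Fin n → Strand X
  perm : Equiv.Perm (Fin n)
  once : ∀ (x : X) (isOver : Bool), ∑ i, (strand i).count (Vtx.cross x isOver) = 1

namespace EPath

variable {X Y Z E : Type}

theorem rename_join (f : X → Y) (p q : EPath E (Vtx X)) :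
    rename f (join p q) = join (rename f p) (rename f q) := EPath.mapV_glue _ _ _ _

theorem rename_rename (f : X → Y) (g : Y → Z) (p : EPath E (Vtx X)) :
    rename g (rename f p) = rename (g ∘ f) p := by
  simp [rename, EPath.mapV_mapV, Vtx.map_comp]

theorem rename_id (p : EPath E (Vtx X)) : rename id p = p := by
  have : Vtx.map (id : X → X) = id := by funext v; cases v <;> rfl
  simp [rename, this, EPath.mapV]

theorem count_join (x : X) (o : Bool) (p q : EPath E (Vtx X)) :
    (join p q).count (Vtx.cross x o) = p.count (Vtx.cross x o) + q.count (Vtx.cross x o) :=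
  EPath.count_glue _ _ _ _ (by simp)

theorem count_rename (f : X → Y) (hf : Function.Injective f) (x : X) (o : Bool)
    (p : EPath E (Vtx X)) : (rename f p).count (Vtx.cross (f x) o) = p.count (Vtx.cross x o) :=
  EPath.count_mapV _ (Vtx.map_injective hf) (Vtx.cross x o) p

theorem count_rename_of_ne (f : X → Y) (y : Y) (hy : ∀ x, f x ≠ y) (o : Bool)
    (p : EPath E (Vtx X)) : (rename f p).count (Vtx.cross y o) = 0 := by
  apply EPath.count_mapV_of_ne
  rintro (_ | ⟨x, o'⟩) <;> simp [Vtx.map, hy]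

/-- Glue the strands of a list one after the other; for the empty list, take an edge with
rotation number zero. -/
def joinAll (e : E) : List (EPath E (Vtx X)) → EPath E (Vtx X)
  | [] => EPath.edge e
  | [p] => p
  | p :: q :: l => join p (joinAll e (q :: l))

theorem rename_joinAll (f : X → Y) (e : E) : ∀ l : List (EPath E (Vtx X)),
    rename f (joinAll e l) = joinAll e (l.map (rename f))
  | [] => rfl
  | [_] => rfl
  | p :: q :: l => by
    have := rename_joinAll f e (q :: l)
    simp only [List.map_cons] at this
    simp only [List.map_cons, joinAll, rename_join, this]

theorem count_joinAll (x : X) (o : Bool) (e : E) : ∀ l : List (EPath E (Vtx X)),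
    (joinAll e l).count (Vtx.cross x o) = (l.map (EPath.count (Vtx.cross x o))).sum
  | [] => rfl
  | [p] => by simp [joinAll]
  | p :: q :: l => by
    have := count_joinAll x o e (q :: l)
    simp only [List.map_cons, List.sum_cons] at this
    simp only [List.map_cons, List.sum_cons, joinAll, count_join, this]

end EPath

theorem blockPos_last {r : ℕ} (k : Fin (r + 1) → ℕ) (j : Fin (k (Fin.last r))) :
    blockPos k (Fin.last r) j = Fin.natAdd (total fun i : Fin r => k i.castSucc) j :=
  congrFun (Fin.lastCases_last (motive := fun i => Fin (k i) → Fin (total k))) j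

theorem blockPos_castSucc {r : ℕ} (k : Fin (r + 1) → ℕ) (i : Fin r) (j : Fin (k i.castSucc)) :
    blockPos k i.castSucc j =
      Fin.castAdd (k (Fin.last r)) (blockPos (fun i : Fin r => k i.castSucc) i j) :=
  congrFun (Fin.lastCases_castSucc (motive := fun i => Fin (k i) → Fin (total k)) i) j

theorem sum_blockPos {M : Type*} [AddCommMonoid M] : ∀ {r : ℕ} (k : Fin r → ℕ)
    (g : Fin (total k) → M), ∑ i, ∑ j, g (blockPos k i j) = ∑ t, g t
  | 0, _, _ => rfl
  | r + 1, k, g => by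
    rw [Fin.sum_univ_castSucc]
    have h := Fin.sum_univ_add (a := total fun i : Fin r => k i.castSucc) (b := k (Fin.last r)) g
    refine Eq.trans ?_ h.symm
    rw [← sum_blockPos (fun i : Fin r => k i.castSucc)]
    simp only [blockPos_castSucc, blockPos_last]

namespace XCDiagram

open EPath

/-- The identity diagram. -/
def id (n : ℕ) : XCDiagram n where
  X := Empty
  finite := inferInstance
  sign := Empty.elim
  strand _ := EPath.edge 0
  perm := 1
  once x := x.elim

/-- The composite `T₂ ∘ T₁`: join the incoming vertices of `T₁` to the outgoing vertices
of `T₂`. -/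
def comp {n : ℕ} (T₂ T₁ : XCDiagram n) : XCDiagram n where
  X := T₁.X ⊕ T₂.X
  finite := have := T₁.finite; have := T₂.finite; inferInstance
  sign := Sum.elim T₁.sign T₂.sign
  strand i := join ((T₁.strand i).rename Sum.inl) ((T₂.strand (T₁.perm i)).rename Sum.inr)
  perm := T₂.perm * T₁.perm
  once := by
    rintro (x | x) o
    · simp [count_join, count_rename _ Sum.inl_injective, count_rename_of_ne, T₁.once]
    · simp [count_join, count_rename _ Sum.inr_injective, count_rename_of_ne,
        Equiv.sum_comp T₁.perm fun i => (T₂.strand i).count (Vtx.cross x o), T₂.once]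

/-- The disjoint union. -/
def tensor {n m : ℕ} (T₁ : XCDiagram n) (T₂ : XCDiagram m) : XCDiagram (n + m) where
  X := T₁.X ⊕ T₂.X
  finite := have := T₁.finite; have := T₂.finite; inferInstance
  sign := Sum.elim T₁.sign T₂.sign
  strand := Fin.addCases (fun i => (T₁.strand i).rename Sum.inl) (fun i => (T₂.strand i).rename Sum.inr)
  perm := blockPerm T₁.perm T₂.perm
  once := by
    rintro (x | x) o
    · simp [Fin.sum_univ_add, count_rename _ Sum.inl_injective, count_rename_of_ne, T₁.once]
    · simp [Fin.sum_univ_add, count_rename _ Sum.inr_injective, count_rename_of_ne, T₂.once]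

/-- The symmetric braiding. -/
def braid (n m : ℕ) : XCDiagram (n + m) where
  X := Empty
  finite := inferInstance
  sign := Empty.elim
  strand _ := EPath.edge 0
  perm := braidPerm n m
  once x := x.elim

/-- Change the order of the outgoing vertices by `τ` and that of the incoming vertices by `ρ`: the
vertex number `i` gets the number `τ i`, respectively `ρ i`. -/
def permute {n : ℕ} (ρ τ : Equiv.Perm (Fin n)) (T : XCDiagram n) : XCDiagram n where
  X := T.X
  finite := T.finite
  sign := T.sign
  strand i := T.strand (τ⁻¹ i)
  perm := ρ * T.perm * τ⁻¹
  once x o := by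
    rw [← T.once x o]
    exact Equiv.sum_comp τ⁻¹ fun i => (T.strand i).count (Vtx.cross x o)

/-- Merge the first `k_1` strands, then the next `k_2` strands, etc.; where `k_i = 0`, insert an
edge with rotation number zero. As in a product `a b` of arrows, the strand on the right is traversed
first: the start of each strand of a block is glued to the end of the next strand of the block. -/
def merge {r : ℕ} (k : Fin r → ℕ) (T : XCDiagram (total k)) : XCDiagram r where
  X := T.X
  finite := T.finite
  sign := T.sign
  strand i := joinAll 0 (List.ofFn fun j => T.strand (blockPos k i j)).reverse
  perm := mergePerm k T.perm
  once x o := by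
    simp only [count_joinAll, List.map_reverse, List.sum_reverse, List.map_ofFn, List.sum_ofFn,
      Function.comp_apply]
    rw [sum_blockPos k fun t => (T.strand t).count (Vtx.cross x o), T.once]

end XCDiagram

/-! ### The XC-Reidemeister moves -/

/-- A picture of a part of a diagram: `k` arcs that meet in crossings. -/
structure Picture (k : ℕ) where
  X : Type
  sign : X → Bool
  arc : Fin k → Strand X

/-- A diagram in which some edges are holes (the edges labelled by the elements of `Fin k`), where
the arcs of a picture are to be inserted. -/
structure Context (n k : ℕ) where
  X : Type
  sign : X → Bool
  strand : Fin n → EPath (SignType ⊕ Fin k) (Vtx X)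
  perm : Equiv.Perm (Fin n)

/-- Insert the arcs of a picture in the holes of a strand. -/
def Picture.fill {k : ℕ} (L : Picture k) {Y : Type} (p : EPath (SignType ⊕ Fin k) (Vtx Y)) :
    Strand (Y ⊕ L.X) :=
  (EPath.rename Sum.inl p).bind (Sum.elim EPath.edge fun j => (L.arc j).rename Sum.inr)

/-- `D` is the diagram that arises when the picture `L` is inserted in `c` (up to the names of the
crossings). As every passage of a crossing occurs exactly once in a diagram, each arc with a
crossing is then inserted exactly once. -/
def Context.Fills {n k : ℕ} (c : Context n k) (L : Picture k) (D : XCDiagram n) : Prop :=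
  ∃ e : c.X ⊕ L.X ≃ D.X, (∀ y, D.sign (e (Sum.inl y)) = c.sign y) ∧
    (∀ x, D.sign (e (Sum.inr x)) = L.sign x) ∧
    (∀ i, D.strand i = (L.fill (c.strand i)).rename e) ∧ D.perm = c.perm

namespace EPath

theorem fill_join {k : ℕ} (L : Picture k) {Y : Type} (p q : EPath (SignType ⊕ Fin k) (Vtx Y)) :
    L.fill (join p q) = join (L.fill p) (L.fill q) := by
  simp only [Picture.fill, rename_join]
  exact EPath.bind_glue _ _ _ _

theorem fill_rename {k : ℕ} (L : Picture k) {Y Z : Type} (f : Y → Z)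
    (p : EPath (SignType ⊕ Fin k) (Vtx Y)) :
    L.fill (rename f p) = rename (Sum.map f _root_.id) (L.fill p) := by
  have h : (fun e => EPath.mapV (Vtx.map (Sum.map f _root_.id))
      ((Sum.elim EPath.edge fun j => (L.arc j).rename Sum.inr : SignType ⊕ Fin k → Strand (Y ⊕ L.X)) e)) =
      Sum.elim EPath.edge fun j => (L.arc j).rename Sum.inr := by
    funext e
    rcases e with e | j
    · rfl
    · exact rename_rename _ _ _
  have h2 : Sum.map f _root_.id ∘ Sum.inl = (Sum.inl ∘ f : Y → Z ⊕ L.X) := rfl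
  rw [Picture.fill, Picture.fill, rename_rename, rename, rename, EPath.mapV_bind, h, ← rename, ← rename, rename_rename, h2]

/-- A strand, viewed as a strand without holes. -/
def closed {k : ℕ} {X : Type} (p : Strand X) : EPath (SignType ⊕ Fin k) (Vtx X) :=
  ⟨Sum.inl p.head, p.tail.map (Prod.map id Sum.inl)⟩

theorem fill_closed {k : ℕ} (L : Picture k) {Y : Type} (p : Strand Y) :
    L.fill (closed p) = p.rename Sum.inl := by
  have h : ∀ l : List (Vtx Y × SignType),
      ((l.map (Prod.map id Sum.inl : _ → Vtx Y × (SignType ⊕ Fin k))).map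
        (Prod.map (Vtx.map Sum.inl : _ → Vtx (Y ⊕ L.X)) id)).flatMap (fun ve => (ve.1,
          ((Sum.elim edge fun j => (L.arc j).rename Sum.inr :
            SignType ⊕ Fin k → Strand (Y ⊕ L.X)) ve.2).head) ::
          ((Sum.elim edge fun j => (L.arc j).rename Sum.inr :
            SignType ⊕ Fin k → Strand (Y ⊕ L.X)) ve.2).tail) =
        l.map (Prod.map (Vtx.map Sum.inl) id) := by
    intro l
    induction l with
    | nil => rfl
    | cons a l ih =>
      simp only [List.map_cons, List.flatMap_cons, ih]
      rfl
  ext1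
  · rfl
  · exact (List.nil_append _).trans (h p.tail)

theorem fill_joinAll {k : ℕ} (L : Picture k) {Y : Type} (s : SignType) :
    ∀ l : List (EPath (SignType ⊕ Fin k) (Vtx Y)),
      L.fill (joinAll (Sum.inl s) l) = joinAll s (l.map L.fill)
  | [] => rfl
  | [_] => rfl
  | p :: q :: l => by
    have := fill_joinAll L s (q :: l)
    simp only [List.map_cons] at this
    simp only [List.map_cons, joinAll, fill_join, this]

end EPath

/-- An overpassing strand at `x`. -/
def Vtx.o {X : Type} (x : X) : Vtx X := Vtx.cross x true

/-- An underpassing strand at `x`. -/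
def Vtx.u {X : Type} (x : X) : Vtx X := Vtx.cross x false

open Vtx in
/-- The XC-Reidemeister moves. In a list, vertices and the edges that follow them are paired:
`⟨e₀, [(v₁, e₁), (v₂, e₂)]⟩` is the path `e₀, v₁, e₁, v₂, e₂`. -/
inductive XCMove : ∀ {k : ℕ}, Picture k → Picture k → Prop
  /-- `Ω0r`: two edges with a bivalent vertex between them are replaced by one. -/
  | r0r (i j k : SignType) (h : (i : ℤ) + (j : ℤ) = (k : ℤ)) :
      XCMove ⟨Empty, Empty.elim, ![⟨i, [(bi, j)]⟩]⟩ ⟨Empty, Empty.elim, ![⟨k, []⟩]⟩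
  /-- `Ω0a`, `Ω0b`: a crossing is rotated. -/
  | r0 (ε : Bool) :
      XCMove ⟨Unit, fun _ => ε, ![⟨0, [(o (), 0)]⟩, ⟨0, [(u (), 0)]⟩]⟩
        ⟨Unit, fun _ => ε, ![⟨1, [(o (), -1)]⟩, ⟨1, [(u (), -1)]⟩]⟩
  /-- `Ω1f`: positive curls of opposite rotation number. -/
  | r1f :
      XCMove ⟨Unit, fun _ => true, ![⟨0, [(o (), -1), (u (), 0)]⟩]⟩
        ⟨Unit, fun _ => true, ![⟨0, [(u (), 1), (o (), 0)]⟩]⟩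
  /-- `Ω2a`, `Ω2b`: two parallel strands, with crossings of the signs `ε`, `-ε`. -/
  | r2ab (ε : Bool) :
      XCMove ⟨Bool, fun x => cond x ε !ε, ![⟨0, [(o true, 0), (o false, 0)]⟩,
          ⟨0, [(u true, 0), (u false, 0)]⟩]⟩
        ⟨Empty, Empty.elim, ![⟨0, []⟩, ⟨0, []⟩]⟩
  /-- `Ω2c`: two antiparallel strands, where the underpassing one turns. The crossing `true` is
  positive and the crossing `false` is negative. -/
  | r2c :
      XCMove ⟨Bool, fun x => x, ![⟨0, [(o false, 0), (o true, 0)]⟩,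
          ⟨0, [(u true, 1), (u false, 0)]⟩]⟩
        ⟨Empty, Empty.elim, ![⟨0, []⟩, ⟨1, []⟩]⟩
  /-- `Ω2d`: two antiparallel strands, where the overpassing one turns. -/
  | r2d :
      XCMove ⟨Bool, fun x => x, ![⟨0, [(o true, -1), (o false, 0)]⟩,
          ⟨0, [(u false, 0), (u true, 0)]⟩]⟩
        ⟨Empty, Empty.elim, ![⟨-1, []⟩, ⟨0, []⟩]⟩
  /-- `Ω3`: three strands with positive crossings `0` (between the first and the second strand),
  `1` (between the first and the third) and `2` (between the second and the third). -/
  | r3 :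
      XCMove ⟨Fin 3, fun _ => true, ![⟨0, [(o 1, 0), (o 0, 0)]⟩, ⟨0, [(o 2, 0), (u 0, 0)]⟩,
          ⟨0, [(u 2, 0), (u 1, 0)]⟩]⟩
        ⟨Fin 3, fun _ => true, ![⟨0, [(o 0, 0), (o 1, 0)]⟩, ⟨0, [(u 0, 0), (o 2, 0)]⟩,
          ⟨0, [(u 1, 0), (u 2, 0)]⟩]⟩

/-- Two diagrams are related if they are isomorphic or if they differ by one move. -/
inductive Step {n : ℕ} : XCDiagram n → XCDiagram n → Prop
  | iso {D D' : XCDiagram n} (e : D.X ≃ D'.X) (hsign : ∀ x, D'.sign (e x) = D.sign x)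
      (hstrand : ∀ i, D'.strand i = (D.strand i).rename e) (hperm : D'.perm = D.perm) : Step D D'
  | move {k : ℕ} {L R : Picture k} (h : XCMove L R) (c : Context n k) {D D' : XCDiagram n}
      (hL : c.Fills L D) (hR : c.Fills R D') : Step D D'

theorem Step.of_fills {n k : ℕ} {c : Context n k} {L : Picture k} {D D' : XCDiagram n}
    (h : c.Fills L D) (h' : c.Fills L D') : Step D D' := by
  obtain ⟨e, h1, h2, h3, h4⟩ := h
  obtain ⟨e', h1', h2', h3', h4'⟩ := h'
  refine .iso (e.symm.trans e') ?_ ?_ (h4'.trans h4.symm)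
  · intro x
    obtain ⟨y | y, rfl⟩ := e.surjective x <;> simp [h1, h2, h1', h2']
  · intro i
    rw [h3, h3', EPath.rename_rename]
    congr 1
    funext x
    simp

/-- The context of a diagram without holes. -/
def XCDiagram.context {n : ℕ} (D : XCDiagram n) (k : ℕ) : Context n k :=
  ⟨D.X, D.sign, fun i => EPath.closed (D.strand i), D.perm⟩

theorem Step.exists_fills {n : ℕ} {D D' : XCDiagram n} (e : D.X ≃ D'.X)
    (hsign : ∀ x, D'.sign (e x) = D.sign x) (hstrand : ∀ i, D'.strand i = (D.strand i).rename e)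
    (hperm : D'.perm = D.perm) :
    (D.context 0).Fills ⟨Empty, Empty.elim, Fin.elim0⟩ D' :=
  ⟨(Equiv.sumEmpty D.X Empty).trans e, hsign, fun x => x.elim, fun i => by
    have := EPath.fill_closed (k := 0) ⟨Empty, Empty.elim, Fin.elim0⟩ (D.strand i)
    refine (hstrand i).trans (Eq.trans ?_ (congrArg (EPath.rename _) this.symm))
    exact (EPath.rename_rename Sum.inl ((Equiv.sumEmpty D.X Empty).trans e) (D.strand i)).symm,
    hperm⟩

theorem Step.map {n m : ℕ} (f : XCDiagram n → XCDiagram m)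
    (h : ∀ (k : ℕ) (c : Context n k), ∃ c' : Context m k, ∀ (L : Picture k) (D : XCDiagram n),
      c.Fills L D → c'.Fills L (f D)) {D D' : XCDiagram n} (hD : Step D D') :
    Step (f D) (f D') := by
  cases hD with
  | iso e h1 h2 h3 =>
    obtain ⟨c', hc⟩ := h 0 (D.context 0)
    exact .of_fills
      (hc _ _ (Step.exists_fills (Equiv.refl _) (fun _ => rfl)
        (fun i => (EPath.rename_id (D.strand i)).symm) rfl))
      (hc _ _ (Step.exists_fills e h1 h2 h3))
  | move hm c hL hR =>
    obtain ⟨c', hc⟩ := h _ c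
    exact .move hm c' (hc _ _ hL) (hc _ _ hR)

namespace XCDiagram

open EPath

theorem permute_step {n : ℕ} (ρ τ : Equiv.Perm (Fin n)) {D D' : XCDiagram n} (h : Step D D') :
    Step (D.permute ρ τ) (D'.permute ρ τ) := by
  refine h.map (permute ρ τ) fun k c => ?_
  refine ⟨⟨c.X, c.sign, fun i => c.strand (τ⁻¹ i), ρ * c.perm * τ⁻¹⟩, ?_⟩
  rintro L D ⟨e, h1, h2, h3, h4⟩
  exact ⟨e, h1, h2, fun i => h3 _, by rw [permute, h4]⟩

theorem merge_step {r : ℕ} (k : Fin r → ℕ) {D D' : XCDiagram (total k)} (h : Step D D') :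
    Step (D.merge k) (D'.merge k) := by
  refine h.map (merge k) fun l c => ?_
  refine ⟨⟨c.X, c.sign, fun i => joinAll (Sum.inl 0)
    (List.ofFn fun j => c.strand (blockPos k i j)).reverse, mergePerm k c.perm⟩, ?_⟩
  rintro L D ⟨e, h1, h2, h3, h4⟩
  refine ⟨e, h1, h2, fun i => ?_, by rw [merge, h4]⟩
  simp only [merge, h3, fill_joinAll, rename_joinAll, List.map_reverse, List.map_ofFn]
  rfl

/-- Exchange the second and the third summand. -/
def sumSwap (X Y Z : Type) : (X ⊕ Y) ⊕ Z ≃ (X ⊕ Z) ⊕ Y :=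
  (Equiv.sumAssoc X Y Z).trans
    (((Equiv.refl X).sumCongr (Equiv.sumComm Y Z)).trans (Equiv.sumAssoc X Z Y).symm)

theorem fill_comp_aux {k : ℕ} (L : Picture k) {X Y Z : Type} (e : X ⊕ L.X ≃ Z)
    (p : EPath (SignType ⊕ Fin k) (Vtx X)) :
    (L.fill (p.rename Sum.inl)).rename ((sumSwap X Y L.X).trans (e.sumCongr (Equiv.refl Y))) =
      ((L.fill p).rename e).rename Sum.inl := by
  rw [fill_rename, rename_rename, rename_rename]
  congr 1
  funext x
  rcases x with x | x <;> rfl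

theorem fill_comp_aux' {k : ℕ} (L : Picture k) {X Y Z : Type} (e : X ⊕ L.X ≃ Z) (p : Strand Y) :
    (L.fill ((closed p).rename Sum.inr)).rename
      ((sumSwap X Y L.X).trans (e.sumCongr (Equiv.refl Y))) = p.rename Sum.inr := by
  rw [fill_rename, fill_closed, rename_rename, rename_rename]
  rfl

theorem fill_comp_aux₂ {k : ℕ} (L : Picture k) {X Y Z : Type} (e : X ⊕ L.X ≃ Z)
    (p : EPath (SignType ⊕ Fin k) (Vtx X)) :
    (L.fill (p.rename Sum.inr)).rename ((Equiv.sumAssoc Y X L.X).trans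
      ((Equiv.refl Y).sumCongr e)) = ((L.fill p).rename e).rename Sum.inr := by
  rw [fill_rename, rename_rename, rename_rename]
  congr 1
  funext x
  rcases x with x | x <;> rfl

theorem fill_comp_aux₂' {k : ℕ} (L : Picture k) {X Y Z : Type} (e : X ⊕ L.X ≃ Z) (p : Strand Y) :
    (L.fill ((closed p).rename Sum.inl)).rename
      ((Equiv.sumAssoc Y X L.X).trans ((Equiv.refl Y).sumCongr e)) = p.rename Sum.inl := by
  rw [fill_rename, fill_closed, rename_rename, rename_rename]
  rfl

theorem comp_step_right {n : ℕ} (T : XCDiagram n) {D D' : XCDiagram n} (h : Step D D') :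
    Step (T.comp D) (T.comp D') := by
  refine h.map (fun D => T.comp D) fun k c => ?_
  refine ⟨⟨c.X ⊕ T.X, Sum.elim c.sign T.sign, fun i => join ((c.strand i).rename Sum.inl)
    ((closed (T.strand (c.perm i))).rename Sum.inr), T.perm * c.perm⟩, ?_⟩
  rintro L D ⟨e, h1, h2, h3, h4⟩
  refine ⟨(sumSwap c.X T.X L.X).trans (e.sumCongr (Equiv.refl T.X)), ?_, h2, fun i => ?_, by
    simp only [comp, h4]⟩
  · rintro (y | y)
    · exact h1 y
    · rfl
  · have := congrArg₂ join (fill_comp_aux L (Y := T.X) e (c.strand i))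
      (fill_comp_aux' L e (T.strand (c.perm i)))
    rw [← rename_join, ← fill_join, ← h3, ← h4] at this
    rw [← h4]
    exact this.symm

theorem comp_step_left {n : ℕ} (T : XCDiagram n) {D D' : XCDiagram n} (h : Step D D') :
    Step (D.comp T) (D'.comp T) := by
  refine h.map (fun D => D.comp T) fun k c => ?_
  refine ⟨⟨T.X ⊕ c.X, Sum.elim T.sign c.sign, fun i => join ((closed (T.strand i)).rename Sum.inl)
    ((c.strand (T.perm i)).rename Sum.inr), c.perm * T.perm⟩, ?_⟩
  rintro L D ⟨e, h1, h2, h3, h4⟩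
  refine ⟨(Equiv.sumAssoc T.X c.X L.X).trans ((Equiv.refl T.X).sumCongr e), ?_, h2, fun i => ?_, by
    simp only [comp, h4]⟩
  · rintro (y | y)
    · rfl
    · exact h1 y
  · have := congrArg₂ join (fill_comp_aux₂' L e (T.strand i))
      (fill_comp_aux₂ L (Y := T.X) e (c.strand (T.perm i)))
    rw [← rename_join, ← fill_join, ← h3] at this
    exact this.symm

theorem tensor_step_left {n m : ℕ} (T : XCDiagram m) {D D' : XCDiagram n} (h : Step D D') :
    Step (D.tensor T) (D'.tensor T) := by
  refine h.map (fun D => D.tensor T) fun k c => ?_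
  refine ⟨⟨c.X ⊕ T.X, Sum.elim c.sign T.sign, Fin.addCases (fun i => (c.strand i).rename Sum.inl)
    (fun i => (closed (T.strand i)).rename Sum.inr), blockPerm c.perm T.perm⟩, ?_⟩
  rintro L D ⟨e, h1, h2, h3, h4⟩
  refine ⟨(sumSwap c.X T.X L.X).trans (e.sumCongr (Equiv.refl T.X)), ?_, h2, fun i => ?_, by
    simp only [tensor, h4]⟩
  · rintro (y | y)
    · exact h1 y
    · rfl
  · refine Fin.addCases (fun i => ?_) (fun i => ?_) i
    · have := fill_comp_aux L (Y := T.X) e (c.strand i)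
      rw [← h3] at this
      simp only [tensor, Fin.addCases_left]
      exact this.symm
    · have := fill_comp_aux' L e (T.strand i)
      simp only [tensor, Fin.addCases_right]
      exact this.symm

theorem tensor_step_right {n m : ℕ} (T : XCDiagram n) {D D' : XCDiagram m} (h : Step D D') :
    Step (T.tensor D) (T.tensor D') := by
  refine h.map (fun D => T.tensor D) fun k c => ?_
  refine ⟨⟨T.X ⊕ c.X, Sum.elim T.sign c.sign, Fin.addCases
    (fun i => (closed (T.strand i)).rename Sum.inl) (fun i => (c.strand i).rename Sum.inr),
    blockPerm T.perm c.perm⟩, ?_⟩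
  rintro L D ⟨e, h1, h2, h3, h4⟩
  refine ⟨(Equiv.sumAssoc T.X c.X L.X).trans ((Equiv.refl T.X).sumCongr e), ?_, h2, fun i => ?_, by
    simp only [tensor, h4]⟩
  · rintro (y | y)
    · rfl
    · exact h1 y
  · refine Fin.addCases (fun i => ?_) (fun i => ?_) i
    · have := fill_comp_aux₂' L e (T.strand i)
      simp only [tensor, Fin.addCases_left]
      exact this.symm
    · have := fill_comp_aux₂ L (Y := T.X) e (c.strand i)
      rw [← h3] at this
      simp only [tensor, Fin.addCases_right]
      exact this.symm

end XCDiagram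

/-! ### The category of XC-tangles -/

/-- The set of XC-tangles with `n` strands, i.e. the endomorphisms of the object `n` in the
category of XC-tangles: the diagrams up to the equivalence relation generated by the
moves (and by isomorphism). -/
def Tangle (n : ℕ) : Type 1 := Quot (@Step n)

namespace Tangle

/-- The tangle of a diagram. -/
def mk {n : ℕ} (D : XCDiagram n) : Tangle n := Quot.mk _ D

/-- The identity. -/
instance (n : ℕ) : One (Tangle n) := ⟨mk (XCDiagram.id n)⟩

/-- The composition of tangles, `T₂ * T₁ = T₂ ∘ T₁`. -/
instance (n : ℕ) : Mul (Tangle n) where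
  mul := Quot.map₂ XCDiagram.comp (fun T _ _ h => XCDiagram.comp_step_right T h)
    (fun _ _ T h => XCDiagram.comp_step_left T h)

/-- The monoidal product of tangles. -/
def tensor {n m : ℕ} : Tangle n → Tangle m → Tangle (n + m) :=
  Quot.map₂ XCDiagram.tensor (fun T _ _ h => XCDiagram.tensor_step_right T h)
    (fun _ _ T h => XCDiagram.tensor_step_left T h)

/-- The symmetric braiding. -/
def braid (n m : ℕ) : Tangle (n + m) := mk (XCDiagram.braid n m)

/-- The action of permutations. -/
def permute {n : ℕ} (ρ τ : Equiv.Perm (Fin n)) : Tangle n → Tangle n :=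
  Quot.map (XCDiagram.permute ρ τ) (fun _ _ h => XCDiagram.permute_step ρ τ h)

/-- The action of `μ_{k_1, …, k_r}`. -/
def merge {r : ℕ} (k : Fin r → ℕ) : Tangle (total k) → Tangle r :=
  Quot.map (XCDiagram.merge k) (fun _ _ h => XCDiagram.merge_step k h)

end Tangle

namespace EPath

theorem fill_glue {k : ℕ} (L : Picture k) {Y : Type} (v : Vtx Y)
    (p q : EPath (SignType ⊕ Fin k) (Vtx Y)) :
    L.fill (glue v p q) = glue (v.map Sum.inl) (L.fill p) (L.fill q) := by
  simp only [Picture.fill, rename, mapV_glue, bind_glue]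

/-- The last edge of a path, given by its first edge and the remainder. -/
def lastEdge {V : Type} : SignType → List (V × SignType) → SignType
  | h, [] => h
  | _, (_, e) :: t => lastEdge e t

/-- The path where the last edge is replaced by a hole. -/
def lastHole {V : Type} : SignType → List (V × SignType) → EPath (SignType ⊕ Fin 1) V
  | _, [] => edge (Sum.inr 0)
  | h, (v, e) :: t => glue v (edge (Sum.inl h)) (lastHole e t)

theorem fill_lastHole {Y : Type} (q : SignType → List (Vtx Y × SignType) → Strand Y)
    (hq : ∀ h v e t, q h ((v, e) :: t) = glue v (edge h) (q e t)) (L : Picture 1) :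
    ∀ (h : SignType) (t : List (Vtx Y × SignType)),
      ((L.arc 0).rename Sum.inr = (q (lastEdge h t) []).rename (Sum.inl : Y → Y ⊕ L.X)) →
      L.fill (lastHole h t) = (q h t).rename Sum.inl
  | h, [], ha => by
    rw [lastHole, Picture.fill]
    refine (bind_edge _ _).trans ?_
    exact ha
  | h, (v, e) :: t, ha => by
    rw [lastHole, fill_glue, fill_lastHole q hq L e t ha, hq, rename, rename, mapV_glue]
    congr 1

/-- The path where the first edge is replaced by a hole. -/
def firstHole {X : Type} (p : Strand X) : EPath (SignType ⊕ Fin 1) (Vtx X) :=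
  ⟨Sum.inr 0, (closed p).tail⟩

theorem fill_firstHole {Y : Type} (L : Picture 1) (p : Strand Y) :
    L.fill (firstHole p) =
      ⟨(L.arc 0).head, ((L.arc 0).rename Sum.inr).tail ++ (p.rename Sum.inl).tail⟩ := by
  have h := congrArg EPath.tail (fill_closed L (⟨0, p.tail⟩ : Strand Y))
  ext1
  · rfl
  · exact congrArg (((L.arc 0).rename Sum.inr).tail ++ ·) h

end EPath

namespace XCDiagram

open EPath

/-- Append an edge with rotation number zero at the end of some strands. -/
def padEnd {n : ℕ} (D : XCDiagram n) (s : Finset (Fin n)) : XCDiagram n where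
  X := D.X
  finite := D.finite
  sign := D.sign
  strand i := if i ∈ s then join (D.strand i) (edge 0) else D.strand i
  perm := D.perm
  once x o := by
    rw [← D.once x o]
    refine Finset.sum_congr rfl fun i _ => ?_
    split_ifs
    · rw [count_join, count_edge, add_zero]
    · rfl

/-- Insert an edge with rotation number zero at the start of some strands. -/
def padStart {n : ℕ} (D : XCDiagram n) (s : Finset (Fin n)) : XCDiagram n where
  X := D.X
  finite := D.finite
  sign := D.sign
  strand i := if i ∈ s then join (edge 0) (D.strand i) else D.strand i
  perm := D.perm
  once x o := by
    rw [← D.once x o]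
    refine Finset.sum_congr rfl fun i _ => ?_
    split_ifs
    · rw [count_join, count_edge, zero_add]
    · rfl

end XCDiagram

namespace Tangle

open EPath XCDiagram

theorem mk_eq_of_step {n : ℕ} {D D' : XCDiagram n} (h : Step D D') : mk D = mk D' := Quot.sound h

/-- A move on the strand `a` only, by a picture with one arc and without crossings. -/
theorem mk_eq_of_arc {n : ℕ} {D D' : XCDiagram n} (a : Fin n) (hX : D.X ≃ D'.X)
    (hsign : ∀ x, D'.sign (hX x) = D.sign x) (hperm : D'.perm = D.perm)
    (hstrand : ∀ i, i ≠ a → D'.strand i = (D.strand i).rename hX)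
    (p : EPath (SignType ⊕ Fin 1) (Vtx D.X)) (u v : Strand Empty)
    (h : XCMove ⟨Empty, Empty.elim, ![u]⟩ ⟨Empty, Empty.elim, ![v]⟩)
    (h1 : D.strand a = (Picture.fill ⟨Empty, Empty.elim, ![u]⟩ p).rename (Equiv.sumEmpty D.X Empty))
    (h2 : D'.strand a = ((Picture.fill ⟨Empty, Empty.elim, ![v]⟩ p).rename
      (Equiv.sumEmpty D.X Empty)).rename hX) : mk D = mk D' := by
  refine mk_eq_of_step (.move h ⟨D.X, D.sign, fun i => if i = a then p else closed (D.strand i),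
    D.perm⟩ ⟨Equiv.sumEmpty _ _, fun _ => rfl, fun x => x.elim, fun i => ?_, rfl⟩
    ⟨(Equiv.sumEmpty _ _).trans hX, hsign, fun x => x.elim, fun i => ?_, hperm⟩)
  · by_cases hi : i = a
    · subst hi
      simp only [if_true]
      exact h1
    · simp only [if_neg hi, fill_closed]
      exact ((rename_rename Sum.inl (Equiv.sumEmpty D.X Empty) (D.strand i)).trans
        (rename_id (D.strand i))).symm
  · by_cases hi : i = a
    · subst hi
      simp only [if_true]
      exact h2.trans (rename_rename _ _ _)
    · simp only [if_neg hi, fill_closed]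
      exact (hstrand i hi).trans (rename_rename Sum.inl ((Equiv.sumEmpty D.X Empty).trans hX) _).symm

theorem rename_sumEmpty {X : Type} (p : Strand X) :
    (p.rename (Sum.inl : X → X ⊕ Empty)).rename (Equiv.sumEmpty X Empty) = p :=
  (rename_rename Sum.inl (Equiv.sumEmpty X Empty) p).trans (rename_id p)

theorem mk_padEnd {n : ℕ} (D : XCDiagram n) (s : Finset (Fin n)) : mk (D.padEnd s) = mk D := by
  induction s using Finset.induction_on with
  | empty => rfl
  | insert a s ha ih =>
    rw [← ih]
    refine mk_eq_of_arc (D := D.padEnd (insert a s)) (D' := D.padEnd s) a (Equiv.refl _)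
      (fun _ => rfl) rfl ?_ (lastHole (D.strand a).head (D.strand a).tail) _ _
      (.r0r (lastEdge (D.strand a).head (D.strand a).tail) 0 _ (add_zero _)) ?_ ?_
    · intro i hi
      refine Eq.trans ?_ (rename_id _).symm
      simp only [padEnd, Finset.mem_insert, hi, false_or]
    · refine Eq.trans ?_ (congrArg (EPath.rename _) (fill_lastHole
        (fun h t => join (⟨h, t⟩ : Strand D.X) (edge 0)) (fun _ _ _ _ => rfl) _ _ _ rfl)).symm
      refine Eq.trans ?_ (rename_sumEmpty _).symm
      simp only [padEnd, Finset.mem_insert_self, if_true]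
    · refine Eq.trans ?_ (rename_id _).symm
      refine Eq.trans ?_ (congrArg (EPath.rename _) (fill_lastHole
        (fun h t => (⟨h, t⟩ : Strand D.X)) (fun _ _ _ _ => rfl) _ _ _ rfl)).symm
      refine Eq.trans ?_ (rename_sumEmpty _).symm
      simp only [padEnd, ha, if_false]

theorem mk_padStart {n : ℕ} (D : XCDiagram n) (s : Finset (Fin n)) : mk (D.padStart s) = mk D := by
  induction s using Finset.induction_on with
  | empty => rfl
  | insert a s ha ih =>
    rw [← ih]
    refine mk_eq_of_arc (D := D.padStart (insert a s)) (D' := D.padStart s) a (Equiv.refl _)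
      (fun _ => rfl) rfl ?_ (firstHole (D.strand a)) _ _
      (.r0r 0 (D.strand a).head _ (zero_add _)) ?_ ?_
    · intro i hi
      refine Eq.trans ?_ (rename_id _).symm
      simp only [padStart, Finset.mem_insert, hi, false_or]
    · refine Eq.trans ?_ (congrArg (EPath.rename _) (fill_firstHole _ _)).symm
      refine Eq.trans ?_ (rename_sumEmpty (join (edge 0) (D.strand a))).symm
      simp only [padStart, Finset.mem_insert_self, if_true]
    · refine Eq.trans ?_ (rename_id _).symm
      refine Eq.trans ?_ (congrArg (EPath.rename _) (fill_firstHole _ _)).symm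
      refine Eq.trans ?_ (rename_sumEmpty (D.strand a)).symm
      simp only [padStart, ha, if_false]

instance (n : ℕ) : Monoid (Tangle n) where
  one_mul := by
    rintro ⟨T⟩
    refine Eq.trans ?_ (mk_padEnd T Finset.univ)
    refine mk_eq_of_step (.iso (Equiv.sumEmpty T.X Empty) ?_ (fun i => ?_) rfl)
    · rintro (x | x)
      · rfl
      · exact x.elim
    · simp only [padEnd, Finset.mem_univ, if_true]
      refine Eq.trans ?_ (rename_join _ _ _).symm
      exact congrArg (fun p => join p (edge 0)) (rename_sumEmpty (T.strand i)).symm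
  mul_one := by
    rintro ⟨T⟩
    refine Eq.trans ?_ (mk_padStart T Finset.univ)
    refine mk_eq_of_step (.iso (Equiv.emptySum Empty T.X) ?_ (fun i => ?_) rfl)
    · rintro (x | x)
      · exact x.elim
      · rfl
    · simp only [padStart, Finset.mem_univ, if_true]
      refine Eq.trans ?_ (rename_join _ _ _).symm
      exact congrArg (join (edge 0)) ((rename_rename Sum.inr (Equiv.emptySum Empty T.X)
        (T.strand i)).trans (rename_id (T.strand i))).symm
  mul_assoc := by
    rintro ⟨T₁⟩ ⟨T₂⟩ ⟨T₃⟩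
    refine mk_eq_of_step (.iso (Equiv.sumAssoc T₃.X T₂.X T₁.X).symm ?_ (fun i => ?_) rfl)
    · rintro (x | x | x) <;> rfl
    · simp only [comp, rename_join, rename_rename]
      exact glue_assoc _ _ _ _ _

end Tangle

namespace XCDiagram

/-- The positive crossing: the overpassing strand starts at the first place and ends at the
second one. -/
def posCrossing : XCDiagram 2 where
  X := Unit
  finite := inferInstance
  sign _ := true
  strand := ![⟨0, [(Vtx.o (), 0)]⟩, ⟨0, [(Vtx.u (), 0)]⟩]
  perm := Equiv.swap 0 1
  once := by rintro ⟨⟩ (_ | _) <;> simp [Fin.sum_univ_two, EPath.count, Vtx.o, Vtx.u]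

/-- The negative crossing: the underpassing strand starts at the first place and ends at the
second one. -/
def negCrossing : XCDiagram 2 where
  X := Unit
  finite := inferInstance
  sign _ := false
  strand := ![⟨0, [(Vtx.u (), 0)]⟩, ⟨0, [(Vtx.o (), 0)]⟩]
  perm := Equiv.swap 0 1
  once := by rintro ⟨⟩ (_ | _) <;> simp [Fin.sum_univ_two, EPath.count, Vtx.o, Vtx.u]

/-- A single edge with the rotation number `i`. -/
def rotation (i : SignType) : XCDiagram 1 where
  X := Empty
  finite := inferInstance
  sign := Empty.elim
  strand _ := EPath.edge i
  perm := 1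
  once x := x.elim

end XCDiagram

namespace Tangle

/-- The positive crossing `X`. -/
def X : Tangle 2 := mk XCDiagram.posCrossing

/-- The negative crossing `X⁻`. -/
def Xinv : Tangle 2 := mk XCDiagram.negCrossing

/-- The edge `C` with rotation number `1`. -/
def K : Tangle 1 := mk (XCDiagram.rotation 1)

/-- The edge `C⁻` with rotation number `-1`. -/
def Kinv : Tangle 1 := mk (XCDiagram.rotation (-1))

end Tangle

/-! ### Functors from XC-tangles to the virtual category of elements -/

section Functors

variable {C : Type u} [Category.{v} C] [MonoidalCategory C] [SymmetricCategory C]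
  {A : C} [MonObj A] (S : XCStructure A)

/-- A symmetric monoidal functor from the category of XC-tangles to the virtual category of elements
of `A` which is the identity on objects. In both categories the objects are the natural numbers,
there are no arrows between different objects, and the monoidal structure is strict; so such a
functor consists of homomorphisms between the monoids of endomorphisms which preserve the monoidal
product of arrows and the symmetric braiding. -/
@[ext]
structure XCFunctor where
  map : ∀ n : ℕ, Tangle n →* VE S n
  map_tensor : ∀ {n m : ℕ} (T₁ : Tangle n) (T₂ : Tangle m),
    map (n + m) (T₁.tensor T₂) = (map n T₁).tensor (map m T₂)
  map_braid : ∀ n m : ℕ, map (n + m) (Tangle.braid n m) = VE.braid n m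

namespace XCFunctor

variable {S}

/-- Compatibility with the external algebra actions, which are given by the actions of
permutations and of the iterated multiplications `μ_{k_1, …, k_r}`. -/
structure Compatible (Z : XCFunctor S) : Prop where
  permute : ∀ {n : ℕ} (ρ τ : Equiv.Perm (Fin n)) (T : Tangle n),
    Z.map n (T.permute ρ τ) = (Z.map n T).permute ρ τ
  merge : ∀ {r : ℕ} (k : Fin r → ℕ) (T : Tangle (total k)),
    Z.map r (T.merge k) = (Z.map (total k) T).merge k

/-- The functor is full. -/
def Full (Z : XCFunctor S) : Prop := ∀ n : ℕ, Function.Surjective (Z.map n)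

end XCFunctor

end Functors

end XCT

set_option linter.unusedSectionVars false

namespace XCT

open Presented (evalObj)

/-! ### Coherence for structural isomorphisms between labelled words -/

/-- A labelling of the leaves of a word. -/
inductive Lab (ν : Type) : Word → Type
  | unit : Lab ν .unit
  | gen (x : ν) : Lab ν .gen
  | tensor {X Y : Word} (a : Lab ν X) (b : Lab ν Y) : Lab ν (X.tensor Y)

namespace Lab

variable {ν ν' : Type}

/-- The list of labels, from right to left. -/
def names : ∀ {w : Word}, Lab ν w → List ν
  | _, .unit => []
  | _, .gen x => [x]
  | _, .tensor a b => names b ++ names a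

/-- Relabel the leaves. -/
def map (f : ν → ν') : ∀ {w : Word}, Lab ν w → Lab ν' w
  | _, .unit => .unit
  | _, .gen x => .gen (f x)
  | _, .tensor a b => .tensor (map f a) (map f b)

theorem names_map (f : ν → ν') : ∀ {w : Word} (l : Lab ν w), (l.map f).names = l.names.map f
  | _, .unit => rfl
  | _, .gen _ => rfl
  | _, .tensor a b => by simp [map, names, names_map f a, names_map f b]

end Lab

section Coherence

variable {C : Type u} [Category.{v} C] [MonoidalCategory C] [SymmetricCategory C]

/-- The structural isomorphisms between the interpretations of two labelled words. -/
inductive Str (d : XCData C) {ν : Type} : ∀ {w w' : Word}, Lab ν w → Lab ν w' →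
    (evalObj d w ⟶ evalObj d w') → Prop
  | id {w} (a : Lab ν w) : Str d a a (𝟙 _)
  | comp {w₁ w₂ w₃} {a : Lab ν w₁} {b : Lab ν w₂} {c : Lab ν w₃} {s t} :
      Str d a b s → Str d b c t → Str d a c (s ≫ t)
  | whiskerLeft {x w w'} (k : Lab ν x) {a : Lab ν w} {b : Lab ν w'} {s} :
      Str d a b s → Str d (k.tensor a) (k.tensor b) (evalObj d x ◁ s)
  | whiskerRight {x w w'} (k : Lab ν x) {a : Lab ν w} {b : Lab ν w'} {s} :
      Str d a b s → Str d (a.tensor k) (b.tensor k) (s ▷ evalObj d x)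
  | α_hom {x y z} (a : Lab ν x) (b : Lab ν y) (c : Lab ν z) :
      Str d ((a.tensor b).tensor c) (a.tensor (b.tensor c)) (α_ (evalObj d x) (evalObj d y) (evalObj d z)).hom
  | α_inv {x y z} (a : Lab ν x) (b : Lab ν y) (c : Lab ν z) :
      Str d (a.tensor (b.tensor c)) ((a.tensor b).tensor c) (α_ (evalObj d x) (evalObj d y) (evalObj d z)).inv
  | l_hom {x} (a : Lab ν x) : Str d (Lab.unit.tensor a) a (λ_ (evalObj d x)).hom
  | l_inv {x} (a : Lab ν x) : Str d a (Lab.unit.tensor a) (λ_ (evalObj d x)).inv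
  | ρ_hom {x} (a : Lab ν x) : Str d (a.tensor Lab.unit) a (ρ_ (evalObj d x)).hom
  | ρ_inv {x} (a : Lab ν x) : Str d a (a.tensor Lab.unit) (ρ_ (evalObj d x)).inv
  | β {x y} (a : Lab ν x) (b : Lab ν y) : Str d (a.tensor b) (b.tensor a) (β_ (evalObj d x) (evalObj d y)).hom

/-- The rearrangements of a tensor power with named factors, where the first name in a list belongs
to the last factor. -/
inductive Reorder (A : C) {ν : Type} : ∀ vs ws : List ν,
    (tpow A vs.length ⟶ tpow A ws.length) → Prop
  | refl (vs) : Reorder A vs vs (𝟙 _)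
  | cons (x) {vs ws r} : Reorder A vs ws r → Reorder A (x :: vs) (x :: ws) (r ▷ A)
  | swap (x y vs) : Reorder A (x :: y :: vs) (y :: x :: vs) (swapLast (tpow A vs.length) A)
  | trans {vs ws zs r s} : Reorder A vs ws r → Reorder A ws zs s → Reorder A vs zs (r ≫ s)

namespace Reorder

variable {A : C} {ν : Type}

theorem perm {vs ws : List ν} {r} (h : Reorder A vs ws r) : vs.Perm ws := by
  induction h with
  | refl => exact .refl _
  | cons x _ ih => exact ih.cons x
  | swap x y vs => exact .swap _ _ _
  | trans _ _ h h' => exact h.trans h'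

theorem exists_inv {vs ws : List ν} {r} (h : Reorder A vs ws r) :
    ∃ s, Reorder A ws vs s ∧ r ≫ s = 𝟙 _ ∧ s ≫ r = 𝟙 _ := by
  induction h with
  | refl => exact ⟨_, .refl _, by simp, by simp⟩
  | cons x _ ih =>
    obtain ⟨s, hs, h1, h2⟩ := ih
    refine ⟨_, hs.cons x, ?_, ?_⟩
    · exact (comp_whiskerRight _ _ _).symm.trans ((congrArg (· ▷ A) h1).trans (id_whiskerRight _ _))
    · exact (comp_whiskerRight _ _ _).symm.trans ((congrArg (· ▷ A) h2).trans (id_whiskerRight _ _))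
  | swap x y vs => exact ⟨_, .swap _ _ _, swapLast_swapLast _ _, swapLast_swapLast _ _⟩
  | trans _ _ h h' =>
    obtain ⟨s, hs, h1, h2⟩ := h
    obtain ⟨t, ht, h3, h4⟩ := h'
    refine ⟨_, ht.trans hs, ?_, ?_⟩
    · rw [Category.assoc, ← Category.assoc _ t, h3, Category.id_comp, h1]
    · rw [Category.assoc, ← Category.assoc s, h2, Category.id_comp, h4]

/-- The label of a factor. -/
def label : ∀ vs : List ν, Fin vs.length → ν
  | [] => Fin.elim0
  | x :: vs => Fin.lastCases (motive := fun _ => ν) x (label vs)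

theorem label_last (x : ν) (vs : List ν) : label (x :: vs) (Fin.last vs.length) = x :=
  Fin.lastCases_last

theorem label_castSucc (x : ν) (vs : List ν) (i : Fin vs.length) :
    label (x :: vs) i.castSucc = label vs i :=
  Fin.lastCases_castSucc _

theorem label_mem : ∀ (vs : List ν) (i : Fin vs.length), label vs i ∈ vs
  | [], i => i.elim0
  | x :: vs, i => by
    refine Fin.lastCases ?_ (fun i => ?_) i
    · exact (label_last x vs).symm ▸ List.mem_cons_self
    · exact (label_castSucc x vs i).symm ▸ List.mem_cons_of_mem _ (label_mem vs i)

theorem label_injective : ∀ {vs : List ν}, vs.Nodup → Function.Injective (label vs)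
  | [], _ => fun i => i.elim0
  | x :: vs, h => by
    rw [List.nodup_cons] at h
    intro i j
    refine Fin.lastCases ?_ (fun i => ?_) i <;> refine Fin.lastCases ?_ (fun j => ?_) j
    · exact fun _ => rfl
    · intro hij
      have : x = label vs j := (label_last x vs).symm.trans (hij.trans (label_castSucc x vs j))
      exact absurd (this ▸ label_mem vs j) h.1
    · intro hij
      have : label vs i = x := (label_castSucc x vs i).symm.trans (hij.trans (label_last x vs))
      exact absurd (this ▸ label_mem vs i) h.1
    · intro hij
      have : label vs i = label vs j :=
        (label_castSucc x vs i).symm.trans (hij.trans (label_castSucc x vs j))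
      exact congrArg _ (label_injective h.2 this)

variable (A) in
/-- A permutation of the factors that is compatible with labels. -/
def IsPerm {n m : ℕ} (a : Fin n → ν) (b : Fin m → ν) (r : tpow A n ⟶ tpow A m) : Prop :=
  ∃ (h : n = m) (σ : Equiv.Perm (Fin n)), r = permMap A σ ≫ eqToHom (congrArg (tpow A) h) ∧
    ∀ i, b (Fin.cast h (σ i)) = a i

theorem IsPerm.refl {n : ℕ} (a : Fin n → ν) : IsPerm A a a (𝟙 _) :=
  ⟨rfl, 1, by simp [permMap_one], fun _ => rfl⟩

theorem IsPerm.trans {n m k : ℕ} {a : Fin n → ν} {b : Fin m → ν} {c : Fin k → ν} {r s}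
    (h : IsPerm A a b r) (h' : IsPerm A b c s) : IsPerm A a c (r ≫ s) := by
  obtain ⟨rfl, σ, rfl, hσ⟩ := h
  obtain ⟨rfl, τ, rfl, hτ⟩ := h'
  refine ⟨rfl, τ * σ, by simp [permMap_mul], fun i => ?_⟩
  exact (hτ _).trans (hσ i)

theorem IsPerm.cons (x : ν) {vs ws : List ν} {r} (h : IsPerm A (label vs) (label ws) r) :
    IsPerm A (label (x :: vs)) (label (x :: ws)) (r ▷ A) := by
  revert h
  generalize ha : label vs = a
  generalize hb : label ws = b
  have ha' : label (x :: vs) = Fin.lastCases (motive := fun _ => ν) x a := ha ▸ rfl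
  have hb' : label (x :: ws) = Fin.lastCases (motive := fun _ => ν) x b := hb ▸ rfl
  rw [ha', hb']
  clear ha hb ha' hb'
  revert a b r
  change ∀ {r : tpow A vs.length ⟶ tpow A ws.length} (a : Fin vs.length → ν)
    (b : Fin ws.length → ν), IsPerm A a b r → IsPerm A (n := vs.length + 1) (m := ws.length + 1) _ _ (r ▷ A)
  generalize vs.length = n
  generalize ws.length = m
  rintro r a b ⟨rfl, σ, rfl, hσ⟩
  let σ' : Equiv.Perm (Fin (n + 1)) := finSuccEquivLast.symm.permCongr (Equiv.optionCongr σ)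
  have h1 : σ' (Fin.last n) = Fin.last n := by simp [σ', Equiv.permCongr_apply]
  have h2 : ∀ i : Fin n, σ' i.castSucc = (σ i).castSucc := fun i => by
    simp [σ', Equiv.permCongr_apply]
  have h3 : dropLast σ' = σ := by
    ext i : 1
    have := succAbove_dropLast σ' i
    rw [h1, h2, Fin.succAbove_last] at this
    exact Fin.castSucc_injective _ this
  refine ⟨rfl, σ', ?_, ?_⟩
  · simp [permMap, h3, h1, moveLast_self]
  · intro i
    refine Fin.lastCases ?_ (fun i => ?_) i
    · simp [h1]
    · have := hσ i
      simp only [Fin.cast_eq_self] at this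
      simp [h2, this]

theorem IsPerm.swap (x y : ν) (vs : List ν) : IsPerm A (label (x :: y :: vs)) (label (y :: x :: vs))
    (swapLast (tpow A vs.length) A) := by
  refine ⟨rfl, adjSwap vs.length (Nat.lt_succ_self _), ?_, ?_⟩
  · rw [← adj_self, ← permMap_swap]
    exact (Category.comp_id _).symm
  · intro i
    change label (y :: x :: vs) (adjSwap vs.length _ i) = _
    revert i
    change ∀ i : Fin (vs.length + 2), _
    intro i
    refine Fin.lastCases ?_ (fun i => ?_) i
    · have h : adjSwap (n := vs.length + 2) vs.length (Nat.lt_succ_self _) (Fin.last _) =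
          (Fin.last vs.length).castSucc := by
        ext; rw [adjSwap_val]; simp
      refine (congrArg _ h).trans ((label_castSucc y (x :: vs) _).trans ?_)
      exact (label_last x vs).trans (label_last x (y :: vs)).symm
    · refine Fin.lastCases ?_ (fun i => ?_) i
      · have h : adjSwap (n := vs.length + 2) vs.length (Nat.lt_succ_self _)
            (Fin.last vs.length).castSucc = Fin.last _ := by
          ext; rw [adjSwap_val]; simp
        refine (congrArg _ h).trans ((label_last y (x :: vs)).trans ?_)
        exact (label_last y vs).symm.trans (label_castSucc x (y :: vs) _).symm
      · have h : adjSwap (n := vs.length + 2) vs.length (Nat.lt_succ_self _)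
            i.castSucc.castSucc = i.castSucc.castSucc := by
          ext; rw [adjSwap_val]
          have := i.isLt
          simp only [Fin.val_castSucc]
          split_ifs <;> omega
        refine (congrArg _ h).trans ((label_castSucc y (x :: vs) _).trans ?_)
        refine (label_castSucc x vs i).trans ?_
        exact (label_castSucc y vs i).symm.trans (label_castSucc x (y :: vs) _).symm

theorem isPerm {vs ws : List ν} {r} (h : Reorder A vs ws r) : IsPerm A (label vs) (label ws) r := by
  induction h with
  | refl => exact .refl _
  | cons x _ ih => exact ih.cons x
  | swap x y vs => exact .swap x y vs
  | trans _ _ h h' => exact h.trans h'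

theorem IsPerm.eq {n m : ℕ} {a : Fin n → ν} {b : Fin m → ν} (hb : Function.Injective b) {r s}
    (h : IsPerm A a b r) (h' : IsPerm A a b s) : r = s := by
  obtain ⟨rfl, σ, rfl, hσ⟩ := h
  obtain ⟨h, τ, rfl, hτ⟩ := h'
  have : σ = τ := by
    ext i : 1
    exact hb ((hσ i).trans (hτ i).symm)
  rw [this]

theorem eq {vs ws : List ν} {r s} (h : Reorder A vs ws r) (h' : Reorder A vs ws s)
    (hw : ws.Nodup) : r = s :=
  h.isPerm.eq (label_injective hw) h'.isPerm

end Reorder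

/-- `X^{⊗ m} ⊗ X^{⊗ n} ≅ X^{⊗ (n + m)}` for tensor powers with named factors. -/
def namedAdd (A : C) {ν : Type} : ∀ us ws : List ν,
    tpow A ws.length ⊗ tpow A us.length ≅ tpow A (us ++ ws).length
  | [], _ => ρ_ _
  | _ :: us, ws => (α_ _ _ _).symm ≪≫ whiskerRightIso (namedAdd A us ws) A

section NamedAdd

variable {A : C} {ν : Type}

theorem namedAdd_cons (x : ν) (us ws : List ν) : (namedAdd A (x :: us) ws).hom =
    (α_ (tpow A ws.length) (tpow A us.length) A).inv ≫ (namedAdd A us ws).hom ▷ A := rfl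

theorem Reorder.append_right {ws ws' : List ν} {r} (h : Reorder A ws ws' r) : ∀ us : List ν,
    ∃ r', Reorder A (us ++ ws) (us ++ ws') r' ∧
      (namedAdd A us ws).hom ≫ r' = r ▷ tpow A us.length ≫ (namedAdd A us ws').hom
  | [] => ⟨r, h, (rightUnitor_naturality r).symm⟩
  | x :: us => by
    obtain ⟨r', h', e⟩ := h.append_right us
    refine ⟨_, h'.cons x, ?_⟩
    rw [namedAdd_cons, namedAdd_cons, Category.assoc]
    refine (congrArg (_ ≫ ·) (comp_whiskerRight _ _ _).symm).trans ?_
    rw [e]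
    change _ = r ▷ (tpow A us.length ⊗ A) ≫ _
    rw [comp_whiskerRight, associator_inv_naturality_left_assoc]

theorem Reorder.append_left {us us' : List ν} {r} (h : Reorder A us us' r) (ws : List ν) :
    ∃ r', Reorder A (us ++ ws) (us' ++ ws) r' ∧
      (namedAdd A us ws).hom ≫ r' = tpow A ws.length ◁ r ≫ (namedAdd A us' ws).hom := by
  induction h with
  | refl => exact ⟨_, .refl _, by simp⟩
  | cons x _ ih =>
    obtain ⟨r', h', e⟩ := ih
    refine ⟨_, h'.cons x, ?_⟩
    rw [namedAdd_cons, namedAdd_cons, Category.assoc]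
    refine (congrArg (_ ≫ ·) (comp_whiskerRight _ _ _).symm).trans ?_
    rw [e, comp_whiskerRight, associator_inv_naturality_middle_assoc]
  | swap x y vs =>
    refine ⟨_, .swap x y (vs ++ ws), ?_⟩
    rw [namedAdd_cons, namedAdd_cons, namedAdd_cons, namedAdd_cons]
    have h1 := swapLast_natural A (namedAdd A vs ws).hom
    simp only [comp_whiskerRight, Category.assoc]
    refine (congrArg (fun z => _ ≫ _ ≫ z) h1).trans ?_
    change (α_ (tpow A ws.length) (tpow A vs.length ⊗ A) A).inv ≫ _ =
      _ ≫ (α_ (tpow A ws.length) (tpow A vs.length ⊗ A) A).inv ≫ _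
    simp only [← Category.assoc]
    congr 1
    simp only [swapLast]
    monoidal
  | trans _ _ h h' =>
    obtain ⟨r, hr, e⟩ := h
    obtain ⟨r', hr', e'⟩ := h'
    exact ⟨_, hr.trans hr', by rw [reassoc_of% e, e', MonoidalCategory.whiskerLeft_comp_assoc]⟩

theorem Reorder.append_nil : ∀ us : List ν, ∃ r, Reorder A (us ++ []) us r ∧
    (namedAdd A us []).hom ≫ r = (λ_ (tpow A us.length)).hom
  | [] => ⟨_, .refl _, (Category.comp_id _).trans unitors_equal.symm⟩
  | x :: us => by
    obtain ⟨r, h, e⟩ := Reorder.append_nil us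
    refine ⟨_, h.cons x, ?_⟩
    rw [namedAdd_cons, Category.assoc]
    refine (congrArg (_ ≫ ·) (comp_whiskerRight _ _ _).symm).trans ?_
    rw [e]
    change _ = (λ_ (tpow A us.length ⊗ A)).hom
    simp

theorem Reorder.append_assoc (us ws : List ν) : ∀ zs : List ν,
    ∃ r, Reorder A (zs ++ (us ++ ws)) ((zs ++ us) ++ ws) r ∧
      (namedAdd A us ws).hom ▷ tpow A zs.length ≫ (namedAdd A zs (us ++ ws)).hom ≫ r =
      (α_ _ _ _).hom ≫ tpow A ws.length ◁ (namedAdd A zs us).hom ≫ (namedAdd A (zs ++ us) ws).hom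
  | [] => ⟨_, .refl _, by
      change (namedAdd A us ws).hom ▷ 𝟙_ C ≫ (ρ_ _).hom ≫ 𝟙 _ =
        (α_ _ _ (𝟙_ C)).hom ≫ _ ◁ (ρ_ _).hom ≫ (namedAdd A us ws).hom
      simp⟩
  | x :: zs => by
    obtain ⟨r, h, e⟩ := Reorder.append_assoc us ws zs
    refine ⟨_, h.cons x, ?_⟩
    have e' := congrArg (· ▷ A) e
    simp only [comp_whiskerRight] at e'
    change (namedAdd A us ws).hom ▷ (tpow A zs.length ⊗ A) ≫
      ((α_ _ (tpow A zs.length) A).inv ≫ (namedAdd A zs (us ++ ws)).hom ▷ A) ≫ r ▷ A =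
      (α_ _ _ (tpow A zs.length ⊗ A)).hom ≫ _ ◁ ((α_ _ (tpow A zs.length) A).inv ≫
        (namedAdd A zs us).hom ▷ A) ≫ (α_ _ _ A).inv ≫ (namedAdd A (zs ++ us) ws).hom ▷ A
    have e2 := (α_ (tpow A ws.length ⊗ tpow A us.length) (tpow A zs.length) A).inv ≫= e'
    refine Eq.trans ?_ (e2.trans ?_)
    · simp
    · simp

end NamedAdd

theorem whiskerLeft_flatten_aux {X K W W' V V' Z Z' : C} {s : W ⟶ W'} {fk : X ⟶ K} {fa : W ⟶ V}
    {fb : W' ⟶ V'} {r : V ⟶ V'} {N : K ⊗ V ⟶ Z} {N' : K ⊗ V' ⟶ Z'} {r' : Z ⟶ Z'}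
    (e : s ≫ fb = fa ≫ r) (e' : N ≫ r' = K ◁ r ≫ N') :
    X ◁ s ≫ (fk ⊗ₘ fb) ≫ N' = ((fk ⊗ₘ fa) ≫ N) ≫ r' := by
  rw [Category.assoc, e', ← id_tensorHom, ← id_tensorHom, tensorHom_comp_tensorHom_assoc,
    tensorHom_comp_tensorHom_assoc, e]
  simp

theorem whiskerRight_flatten_aux {X K W W' V V' Z Z' : C} {s : W ⟶ W'} {fk : X ⟶ K} {fa : W ⟶ V}
    {fb : W' ⟶ V'} {r : V ⟶ V'} {N : V ⊗ K ⟶ Z} {N' : V' ⊗ K ⟶ Z'} {r' : Z ⟶ Z'}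
    (e : s ≫ fb = fa ≫ r) (e' : N ≫ r' = r ▷ K ≫ N') :
    s ▷ X ≫ (fb ⊗ₘ fk) ≫ N' = ((fa ⊗ₘ fk) ≫ N) ≫ r' := by
  rw [Category.assoc, e', ← tensorHom_id, ← tensorHom_id, tensorHom_comp_tensorHom_assoc,
    tensorHom_comp_tensorHom_assoc, e]
  simp

theorem whiskerLeft_inv_aux {X Y Z : C} {f : Y ⟶ Z} {g : Z ⟶ Y} (h : f ≫ g = 𝟙 _) :
    X ◁ f ≫ X ◁ g = 𝟙 _ := by
  rw [← MonoidalCategory.whiskerLeft_comp, h, MonoidalCategory.whiskerLeft_id]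

theorem whiskerRight_inv_aux {X Y Z : C} {f : Y ⟶ Z} {g : Z ⟶ Y} (h : f ≫ g = 𝟙 _) :
    f ▷ X ≫ g ▷ X = 𝟙 _ := by
  rw [← comp_whiskerRight, h, id_whiskerRight]

section Flatten

variable (d : XCData C) {ν : Type}

/-- The coherence isomorphism from the interpretation of a word to a tensor power. -/
def flatten : ∀ {w : Word} (a : Lab ν w), evalObj d w ≅ tpow d.obj a.names.length
  | _, .unit => Iso.refl (𝟙_ C)
  | _, .gen _ => (λ_ d.obj).symm
  | _, .tensor a b => (flatten a ⊗ᵢ flatten b) ≪≫ namedAdd d.obj b.names a.names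

/-- The morphism corresponds to a rearrangement of the factors. -/
def Flat {w w' : Word} (a : Lab ν w) (b : Lab ν w') (s : evalObj d w ⟶ evalObj d w') : Prop :=
  ∃ r, Reorder d.obj a.names b.names r ∧ s ≫ (flatten d b).hom = (flatten d a).hom ≫ r

variable {d}

namespace Flat

theorem id {w : Word} (a : Lab ν w) : Flat d a a (𝟙 _) := ⟨_, .refl _, by simp⟩

theorem comp {w₁ w₂ w₃ : Word} {a : Lab ν w₁} {b : Lab ν w₂} {c : Lab ν w₃} {s t}
    (h : Flat d a b s) (h' : Flat d b c t) : Flat d a c (s ≫ t) := by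
  obtain ⟨r, hr, e⟩ := h
  obtain ⟨r', hr', e'⟩ := h'
  exact ⟨_, hr.trans hr', by rw [Category.assoc, e', reassoc_of% e]⟩

theorem whiskerLeft {x w w' : Word} (k : Lab ν x) {a : Lab ν w} {b : Lab ν w'} {s}
    (h : Flat d a b s) : Flat d (k.tensor a) (k.tensor b) (evalObj d x ◁ s) := by
  obtain ⟨r, hr, e⟩ := h
  obtain ⟨r', hr', e'⟩ := hr.append_left k.names
  refine ⟨r', hr', ?_⟩
  exact whiskerLeft_flatten_aux e e'

theorem whiskerRight {x w w' : Word} (k : Lab ν x) {a : Lab ν w} {b : Lab ν w'} {s}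
    (h : Flat d a b s) : Flat d (a.tensor k) (b.tensor k) (s ▷ evalObj d x) := by
  obtain ⟨r, hr, e⟩ := h
  obtain ⟨r', hr', e'⟩ := hr.append_right k.names
  refine ⟨r', hr', ?_⟩
  exact whiskerRight_flatten_aux e e'

theorem of_inv {w w' : Word} {a : Lab ν w} {b : Lab ν w'} {s t} (h : Flat d a b s)
    (h2 : t ≫ s = 𝟙 _) : Flat d b a t := by
  obtain ⟨r, hr, e⟩ := h
  obtain ⟨r', hr', e1, e2⟩ := hr.exists_inv
  refine ⟨r', hr', ?_⟩
  have := t ≫= e =≫ r'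
  rw [Category.assoc, Category.assoc, e1, reassoc_of% h2] at this
  simpa using this.symm

theorem α_hom {x y z : Word} (a : Lab ν x) (b : Lab ν y) (c : Lab ν z) :
    Flat d ((a.tensor b).tensor c) (a.tensor (b.tensor c))
      (α_ (evalObj d x) (evalObj d y) (evalObj d z)).hom := by
  obtain ⟨r, hr, e⟩ := Reorder.append_assoc (A := d.obj) b.names a.names c.names
  refine ⟨r, hr, ?_⟩
  change _ ≫ ((flatten d a).hom ⊗ₘ (((flatten d b).hom ⊗ₘ (flatten d c).hom) ≫ _)) ≫ _ =
    (((((flatten d a).hom ⊗ₘ (flatten d b).hom) ≫ _) ⊗ₘ (flatten d c).hom) ≫ _) ≫ r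
  have h1 := (((flatten d a).hom ⊗ₘ (flatten d b).hom) ⊗ₘ (flatten d c).hom) ≫= e
  rw [associator_naturality_assoc, ← tensorHom_id, ← id_tensorHom,
    tensorHom_comp_tensorHom_assoc, tensorHom_comp_tensorHom_assoc, Category.comp_id,
    Category.comp_id] at h1
  exact h1.symm.trans (Category.assoc _ _ _).symm

theorem l_hom {x : Word} (a : Lab ν x) : Flat d (Lab.unit.tensor a) a (λ_ (evalObj d x)).hom := by
  obtain ⟨r, hr, e⟩ := Reorder.append_nil (A := d.obj) a.names
  refine ⟨r, hr, ?_⟩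
  change _ = ((𝟙 (𝟙_ C) ⊗ₘ (flatten d a).hom) ≫ (namedAdd d.obj a.names []).hom) ≫ r
  rw [Category.assoc, e, id_tensorHom]
  exact (leftUnitor_naturality _).symm

theorem ρ_hom {x : Word} (a : Lab ν x) : Flat d (a.tensor Lab.unit) a (ρ_ (evalObj d x)).hom := by
  refine ⟨𝟙 _, .refl _, ?_⟩
  change _ = (((flatten d a).hom ⊗ₘ 𝟙 (𝟙_ C)) ≫ (ρ_ _).hom) ≫ 𝟙 _
  rw [Category.comp_id, tensorHom_id]
  exact (rightUnitor_naturality _).symm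

theorem α_inv {x y z : Word} (a : Lab ν x) (b : Lab ν y) (c : Lab ν z) :
    Flat d (a.tensor (b.tensor c)) ((a.tensor b).tensor c)
      (α_ (evalObj d x) (evalObj d y) (evalObj d z)).inv :=
  (α_hom a b c).of_inv (Iso.inv_hom_id _)

theorem l_inv {x : Word} (a : Lab ν x) : Flat d a (Lab.unit.tensor a) (λ_ (evalObj d x)).inv :=
  (l_hom a).of_inv (Iso.inv_hom_id _)

theorem ρ_inv {x : Word} (a : Lab ν x) : Flat d a (a.tensor Lab.unit) (ρ_ (evalObj d x)).inv :=
  (ρ_hom a).of_inv (Iso.inv_hom_id _)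

theorem congr {w w' : Word} {a : Lab ν w} {b : Lab ν w'} {s t} (h : Flat d a b s) (e : s = t) :
    Flat d a b t := e ▸ h

theorem β_gen_gen (x y : ν) : Flat d (Lab.gen x |>.tensor (.gen y)) (Lab.gen y |>.tensor (.gen x))
    (β_ d.obj d.obj).hom := by
  refine ⟨_, .swap y x [], ?_⟩
  change _ ≫ ((λ_ d.obj).inv ⊗ₘ (λ_ d.obj).inv) ≫ (α_ _ _ _).inv ≫ (ρ_ _).hom ▷ _ =
    (((λ_ d.obj).inv ⊗ₘ (λ_ d.obj).inv) ≫ (α_ _ _ _).inv ≫ (ρ_ _).hom ▷ _) ≫ swapLast (𝟙_ C) d.obj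
  have h : ((λ_ d.obj).inv ⊗ₘ (λ_ d.obj).inv) ≫ (α_ (𝟙_ C ⊗ d.obj) (𝟙_ C) d.obj).inv ≫ (ρ_ (𝟙_ C ⊗ d.obj)).hom ▷ d.obj
    = (λ_ (d.obj ⊗ d.obj)).inv ≫ (α_ _ _ _).inv := by monoidal
  have h' := congrArg (((β_ d.obj d.obj).hom) ≫ ·) h
  rw [swapLast]
  refine h'.trans ?_
  refine Eq.trans ?_ (congrArg (· ≫ (_ ≫ _ ≫ _)) h).symm
  simp

theorem β_unit {x : Word} (a : Lab ν x) : Flat d (a.tensor .unit) (Lab.unit.tensor a)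
    (β_ (evalObj d x) (𝟙_ C)).hom :=
  ((ρ_hom a).comp (l_inv a)).congr (braiding_tensorUnit_right _).symm

theorem β_symm {x y : Word} {a : Lab ν x} {b : Lab ν y}
    (h : Flat d (a.tensor b) (b.tensor a) (β_ (evalObj d x) (evalObj d y)).hom) :
    Flat d (b.tensor a) (a.tensor b) (β_ (evalObj d y) (evalObj d x)).hom :=
  h.of_inv (SymmetricCategory.symmetry _ _)

theorem β_tensor {x y z : Word} {a : Lab ν x} {b : Lab ν y} {c : Lab ν z}
    (h1 : Flat d (a.tensor b) (b.tensor a) (β_ (evalObj d x) (evalObj d y)).hom)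
    (h2 : Flat d (a.tensor c) (c.tensor a) (β_ (evalObj d x) (evalObj d z)).hom) :
    Flat d (a.tensor (b.tensor c)) ((b.tensor c).tensor a)
      (β_ (evalObj d x) (evalObj d y ⊗ evalObj d z)).hom :=
  ((α_inv a b c).comp ((h1.whiskerRight c).comp ((α_hom b a c).comp
    ((h2.whiskerLeft b).comp (α_inv b c a))))).congr (BraidedCategory.braiding_tensor_right_hom _ _ _).symm

theorem β_gen (y : ν) : ∀ {x : Word} (a : Lab ν x), Flat d (a.tensor (.gen y)) ((Lab.gen y).tensor a)
    (β_ (evalObj d x) d.obj).hom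
  | _, .unit => β_symm (β_unit _)
  | _, .gen x => β_gen_gen x y
  | _, .tensor a b => β_symm (β_tensor (β_symm (β_gen y a)) (β_symm (β_gen y b)))

theorem β {x : Word} (a : Lab ν x) : ∀ {y : Word} (b : Lab ν y), Flat d (a.tensor b) (b.tensor a)
    (β_ (evalObj d x) (evalObj d y)).hom
  | _, .unit => β_unit a
  | _, .gen y => β_gen y a
  | _, .tensor b c => β_tensor (β a b) (β a c)

end Flat

namespace Str

variable {w w' : Word} {a : Lab ν w} {b : Lab ν w'}

theorem flat {s} (h : Str d a b s) : Flat d a b s := by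
  induction h with
  | id a => exact .id a
  | comp _ _ h h' => exact h.comp h'
  | whiskerLeft k _ ih => exact ih.whiskerLeft k
  | whiskerRight k _ ih => exact ih.whiskerRight k
  | α_hom a b c => exact .α_hom a b c
  | α_inv a b c => exact .α_inv a b c
  | l_hom a => exact .l_hom a
  | l_inv a => exact .l_inv a
  | ρ_hom a => exact .ρ_hom a
  | ρ_inv a => exact .ρ_inv a
  | β a b => exact .β a b

/-- Coherence: there is at most one structural isomorphism if the names are different. -/
theorem eq {s t} (h : Str d a b s) (h' : Str d a b t) (hb : b.names.Nodup) : s = t := by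
  obtain ⟨r, hr, e⟩ := h.flat
  obtain ⟨r', hr', e'⟩ := h'.flat
  rw [← cancel_mono (flatten d b).hom, e, e', hr.eq hr' hb]

theorem perm {s} (h : Str d a b s) : a.names.Perm b.names :=
  h.flat.choose_spec.1.perm

theorem map {ν' : Type} (f : ν → ν') {s} (h : Str d a b s) : Str d (a.map f) (b.map f) s := by
  induction h with
  | id a => exact .id _
  | comp _ _ h h' => exact h.comp h'
  | whiskerLeft k _ ih => exact ih.whiskerLeft _
  | whiskerRight k _ ih => exact ih.whiskerRight _
  | α_hom a b c => exact .α_hom _ _ _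
  | α_inv a b c => exact .α_inv _ _ _
  | l_hom a => exact .l_hom _
  | l_inv a => exact .l_inv _
  | ρ_hom a => exact .ρ_hom _
  | ρ_inv a => exact .ρ_inv _
  | β a b => exact .β _ _

theorem exists_inv {s} (h : Str d a b s) : ∃ t, Str d b a t ∧ s ≫ t = 𝟙 _ ∧ t ≫ s = 𝟙 _ := by
  induction h with
  | id a => exact ⟨_, .id _, by simp, by simp⟩
  | comp _ _ h h' =>
    obtain ⟨s, hs, h1, h2⟩ := h
    obtain ⟨t, ht, h3, h4⟩ := h'
    exact ⟨_, ht.comp hs, by rw [Category.assoc, reassoc_of% h3, h1],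
      by rw [Category.assoc, reassoc_of% h2, h4]⟩
  | whiskerLeft k _ ih =>
    obtain ⟨s, hs, h1, h2⟩ := ih
    refine ⟨_, hs.whiskerLeft k, ?_, ?_⟩
    · exact whiskerLeft_inv_aux h1
    · exact whiskerLeft_inv_aux h2
  | whiskerRight k _ ih =>
    obtain ⟨s, hs, h1, h2⟩ := ih
    refine ⟨_, hs.whiskerRight k, ?_, ?_⟩
    · exact whiskerRight_inv_aux h1
    · exact whiskerRight_inv_aux h2
  | α_hom a b c => exact ⟨_, .α_inv _ _ _, Iso.hom_inv_id _, Iso.inv_hom_id _⟩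
  | α_inv a b c => exact ⟨_, .α_hom _ _ _, Iso.inv_hom_id _, Iso.hom_inv_id _⟩
  | l_hom a => exact ⟨_, .l_inv _, Iso.hom_inv_id _, Iso.inv_hom_id _⟩
  | l_inv a => exact ⟨_, .l_hom _, Iso.inv_hom_id _, Iso.hom_inv_id _⟩
  | ρ_hom a => exact ⟨_, .ρ_inv _, Iso.hom_inv_id _, Iso.inv_hom_id _⟩
  | ρ_inv a => exact ⟨_, .ρ_hom _, Iso.inv_hom_id _, Iso.hom_inv_id _⟩
  | β a b => exact ⟨_, .β _ _, SymmetricCategory.symmetry _ _, SymmetricCategory.symmetry _ _⟩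

end Str

/-- The word with the factors of a list, from right to left. -/
def combWord : List ν → Word
  | [] => .unit
  | _ :: vs => (combWord vs).tensor .gen

/-- The labels of `combWord`. -/
def combLab : ∀ vs : List ν, Lab ν (combWord vs)
  | [] => .unit
  | x :: vs => (combLab vs).tensor (.gen x)

theorem Str.exists_comb_append (ws : List ν) : ∀ us : List ν,
    ∃ s, Str d ((combLab ws).tensor (combLab us)) (combLab (us ++ ws)) s
  | [] => ⟨_, .ρ_hom _⟩
  | _ :: us =>
    have ⟨_, h⟩ := Str.exists_comb_append ws us
    ⟨_, (Str.α_inv _ _ _).comp (h.whiskerRight _)⟩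

theorem Str.exists_comb : ∀ {w : Word} (a : Lab ν w), ∃ s, Str d a (combLab a.names) s
  | _, .unit => ⟨_, .id _⟩
  | _, .gen _ => ⟨_, .l_inv _⟩
  | _, .tensor a b =>
    have ⟨_, h⟩ := Str.exists_comb a
    have ⟨_, h'⟩ := Str.exists_comb b
    have ⟨_, h''⟩ := Str.exists_comb_append a.names b.names
    ⟨_, (h.whiskerRight _).comp ((h'.whiskerLeft _).comp h'')⟩

theorem Str.exists_comb_perm {us vs : List ν} (h : us.Perm vs) :
    ∃ s, Str d (combLab us) (combLab vs) s := by
  induction h with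
  | nil => exact ⟨_, .id _⟩
  | cons x _ ih => exact ih.elim fun _ h => ⟨_, h.whiskerRight _⟩
  | swap x y l =>
    exact ⟨_, (Str.α_hom _ _ _).comp (((Str.β _ _).whiskerLeft _).comp (Str.α_inv _ _ _))⟩
  | trans _ _ h h' => exact h.elim fun _ h => h'.elim fun _ h' => ⟨_, h.comp h'⟩

theorem Str.exists_of_perm {w w' : Word} {a : Lab ν w} {b : Lab ν w'}
    (h : a.names.Perm b.names) : ∃ s, Str d a b s := by
  obtain ⟨s, hs⟩ := Str.exists_comb (d := d) a
  obtain ⟨t, ht⟩ := Str.exists_comb (d := d) b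
  obtain ⟨r, hr⟩ := Str.exists_comb_perm (d := d) h
  obtain ⟨t', ht', -⟩ := ht.exists_inv
  exact ⟨_, hs.comp (hr.comp ht')⟩

end Flatten

end Coherence

end XCT

namespace XCT

open Presented (evalObj)
open scoped MonObj

/-! ### Expressions with named variables -/

section Expressions

variable {C : Type u} [Category.{v} C] [MonoidalCategory C] [SymmetricCategory C]

section PTensor

variable {Y Y' Z Z' W : C}

theorem ptensor_comp_tensorHom (y : 𝟙_ C ⟶ Y) (z : 𝟙_ C ⟶ Z) (f : Y ⟶ Y') (g : Z ⟶ Z') :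
    ptensor y z ≫ (f ⊗ₘ g) = ptensor (y ≫ f) (z ≫ g) := by
  simp [ptensor]

theorem ptensor_associator (x : 𝟙_ C ⟶ Y) (y : 𝟙_ C ⟶ Z) (z : 𝟙_ C ⟶ W) :
    ptensor (ptensor x y) z ≫ (α_ _ _ _).hom = ptensor x (ptensor y z) := by
  have h1 : ((λ_ (𝟙_ C)).inv ≫ (x ⊗ₘ y)) ⊗ₘ z = (λ_ (𝟙_ C)).inv ▷ 𝟙_ C ≫ ((x ⊗ₘ y) ⊗ₘ z) := by
    simp only [← tensorHom_id, tensorHom_comp_tensorHom, Category.id_comp]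
  have h2 : x ⊗ₘ ((λ_ (𝟙_ C)).inv ≫ (y ⊗ₘ z)) = 𝟙_ C ◁ (λ_ (𝟙_ C)).inv ≫ (x ⊗ₘ (y ⊗ₘ z)) := by
    simp only [← id_tensorHom, tensorHom_comp_tensorHom, Category.id_comp]
  simp only [ptensor, h1, h2, Category.assoc, associator_naturality]
  simp [unitors_inv_equal]

theorem ptensor_leftUnitor (y : 𝟙_ C ⟶ Y) : ptensor (𝟙 _) y ≫ (λ_ Y).hom = y := by
  simp [ptensor]

theorem ptensor_rightUnitor (y : 𝟙_ C ⟶ Y) : ptensor y (𝟙 _) ≫ (ρ_ Y).hom = y := by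
  simp [ptensor, unitors_inv_equal]

theorem ptensor_braiding (y : 𝟙_ C ⟶ Y) (z : 𝟙_ C ⟶ Z) :
    ptensor y z ≫ (β_ Y Z).hom = ptensor z y := by
  simp [ptensor, unitors_inv_equal]

end PTensor

variable (d : XCData C) (ν : Type)

/-- An arrow whose source is a tensor product of copies of the generating object with names. -/
structure PreMono (Y : C) where
  {word : Word}
  lab : Lab ν word
  hom : evalObj d word ⟶ Y

instance PreMono.setoid (Y : C) : Setoid (PreMono d ν Y) where
  r a b := ∃ s, Str d a.lab b.lab s ∧ a.hom = s ≫ b.hom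
  iseqv :=
    ⟨fun _ => ⟨_, .id _, (Category.id_comp _).symm⟩, by
      rintro a b ⟨s, hs, e⟩
      obtain ⟨t, ht, -, h⟩ := hs.exists_inv
      exact ⟨t, ht, by rw [e, reassoc_of% h]⟩, by
      rintro a b c ⟨s, hs, e⟩ ⟨t, ht, e'⟩
      exact ⟨_, hs.comp ht, by rw [e, e', Category.assoc]⟩⟩

/-- Arrows to `Y` with named variables, up to structural isomorphisms. -/
def Mono (Y : C) : Type v := Quotient (PreMono.setoid d ν Y)

/-- A point of a tensor product of copies of the generating object with names. -/
structure PrePt where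
  {word : Word}
  lab : Lab ν word
  hom : 𝟙_ C ⟶ evalObj d word

instance PrePt.setoid : Setoid (PrePt d ν) where
  r a b := ∃ s, Str d a.lab b.lab s ∧ a.hom ≫ s = b.hom
  iseqv :=
    ⟨fun _ => ⟨_, .id _, Category.comp_id _⟩, by
      rintro a b ⟨s, hs, e⟩
      obtain ⟨t, ht, h, -⟩ := hs.exists_inv
      exact ⟨t, ht, by rw [← e, Category.assoc, h, Category.comp_id]⟩, by
      rintro a b c ⟨s, hs, e⟩ ⟨t, ht, e'⟩
      exact ⟨_, hs.comp ht, by rw [← e', ← e, Category.assoc]⟩⟩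

/-- Points of tensor products with named factors, up to structural isomorphisms. -/
def Pt : Type v := Quotient (PrePt.setoid d ν)

variable {d ν}

namespace Mono

variable {X Y Z W : C} {w w' : Word}

/-- The class of an arrow. -/
def mk (a : Lab ν w) (f : evalObj d w ⟶ Y) : Mono d ν Y := Quotient.mk _ ⟨a, f⟩

theorem mk_eq_iff {a : Lab ν w} {b : Lab ν w'} {f : evalObj d w ⟶ Y} {g : evalObj d w' ⟶ Y} :
    mk a f = mk b g ↔ ∃ s, Str d a b s ∧ f = s ≫ g :=
  Quotient.eq (r := PreMono.setoid d ν Y)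

theorem mk_eq {a : Lab ν w} {b : Lab ν w'} {f : evalObj d w ⟶ Y} {g : evalObj d w' ⟶ Y}
    {s} (h : Str d a b s) (e : f = s ≫ g) : mk a f = mk b g :=
  mk_eq_iff.mpr ⟨s, h, e⟩

theorem ind {p : Mono d ν Y → Prop} (h : ∀ (w) (a : Lab ν w) (f : evalObj d w ⟶ Y), p (mk a f))
    (ξ : Mono d ν Y) : p ξ := by
  induction ξ using Quotient.ind with
  | _ a => exact h _ a.lab a.hom

/-- Postcomposition with an arrow. -/
def post (g : Y ⟶ Z) : Mono d ν Y → Mono d ν Z :=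
  Quotient.map (fun a => ⟨a.lab, a.hom ≫ g⟩) fun _ _ ⟨s, hs, e⟩ =>
    ⟨s, hs, by rw [e, Category.assoc]⟩

/-- The tensor product of expressions. -/
def box : Mono d ν Y → Mono d ν Z → Mono d ν (Y ⊗ Z) :=
  Quotient.map₂ (fun a b => ⟨a.lab.tensor b.lab, a.hom ⊗ₘ b.hom⟩)
    fun _ _ ⟨_, hs, e⟩ _ _ ⟨_, ht, e'⟩ =>
    ⟨_, (hs.whiskerRight _).comp (ht.whiskerLeft _), by
      rw [e, e', ← tensorHom_comp_tensorHom, MonoidalCategory.tensorHom_def]; rfl⟩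

/-- An expression without variables. -/
def pt (y : 𝟙_ C ⟶ Y) : Mono d ν Y := mk .unit y

/-- A variable. -/
def var (x : ν) : Mono d ν d.obj := mk (.gen x) (𝟙 _)

theorem post_post (g : Y ⟶ Z) (h : Z ⟶ W) (ξ : Mono d ν Y) :
    post h (post g ξ) = post (g ≫ h) ξ := by
  induction ξ using ind with
  | _ w a f => exact congrArg (mk a) (Category.assoc _ _ _)

theorem post_id (ξ : Mono d ν Y) : post (𝟙 _) ξ = ξ := by
  induction ξ using ind with
  | _ w a f => exact congrArg (mk a) (Category.comp_id _)

theorem post_pt (g : Y ⟶ Z) (y : 𝟙_ C ⟶ Y) : post g (pt y : Mono d ν Y) = pt (y ≫ g) := rfl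

theorem box_post_post (f : X ⟶ Y) (g : Z ⟶ W) (ξ : Mono d ν X) (ζ : Mono d ν Z) :
    box (post f ξ) (post g ζ) = post (f ⊗ₘ g) (box ξ ζ) := by
  induction ξ using ind with
  | _ w a x =>
    induction ζ using ind with
    | _ w' b y => exact congrArg (mk _) (tensorHom_comp_tensorHom _ _ _ _).symm

theorem box_post_left (f : X ⟶ Y) (ξ : Mono d ν X) (ζ : Mono d ν Z) :
    box (post f ξ) ζ = post (f ▷ Z) (box ξ ζ) := by
  rw [← tensorHom_id, ← box_post_post, post_id]

theorem box_post_right (g : Z ⟶ W) (ξ : Mono d ν X) (ζ : Mono d ν Z) :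
    box ξ (post g ζ) = post (X ◁ g) (box ξ ζ) := by
  rw [← id_tensorHom, ← box_post_post, post_id]

theorem post_associator (ξ : Mono d ν X) (ζ : Mono d ν Y) (ω : Mono d ν Z) :
    post (α_ X Y Z).hom (box (box ξ ζ) ω) = box ξ (box ζ ω) := by
  induction ξ using ind with
  | _ w a x =>
    induction ζ using ind with
    | _ w' b y =>
      induction ω using ind with
      | _ w'' c z => exact mk_eq (.α_hom a b c) (associator_naturality x y z)

theorem post_associator_inv (ξ : Mono d ν X) (ζ : Mono d ν Y) (ω : Mono d ν Z) :
    post (α_ X Y Z).inv (box ξ (box ζ ω)) = box (box ξ ζ) ω := by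
  rw [← post_associator, post_post, Iso.hom_inv_id, post_id]

theorem post_leftUnitor (ξ : Mono d ν X) : post (λ_ X).hom (box (pt (𝟙 _)) ξ) = ξ := by
  induction ξ using ind with
  | _ w a x =>
    refine mk_eq (.l_hom a) ?_
    exact (congrArg (· ≫ _) (id_tensorHom _ _)).trans (leftUnitor_naturality x)

theorem post_rightUnitor (ξ : Mono d ν X) : post (ρ_ X).hom (box ξ (pt (𝟙 _))) = ξ := by
  induction ξ using ind with
  | _ w a x =>
    refine mk_eq (.ρ_hom a) ?_
    exact (congrArg (· ≫ _) (tensorHom_id _ _)).trans (rightUnitor_naturality x)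

theorem post_leftUnitor_inv (ξ : Mono d ν X) : post (λ_ X).inv ξ = box (pt (𝟙 _)) ξ := by
  conv_lhs => rw [← post_leftUnitor ξ]
  rw [post_post, Iso.hom_inv_id, post_id]

theorem post_rightUnitor_inv (ξ : Mono d ν X) : post (ρ_ X).inv ξ = box ξ (pt (𝟙 _)) := by
  conv_lhs => rw [← post_rightUnitor ξ]
  rw [post_post, Iso.hom_inv_id, post_id]

theorem post_braiding (ξ : Mono d ν X) (ζ : Mono d ν Y) :
    post (β_ X Y).hom (box ξ ζ) = box ζ ξ := by
  induction ξ using ind with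
  | _ w a x =>
    induction ζ using ind with
    | _ w' b y => exact mk_eq (.β a b) (BraidedCategory.braiding_naturality x y)

theorem box_pt_pt (x : 𝟙_ C ⟶ X) (y : 𝟙_ C ⟶ Y) :
    box (pt x : Mono d ν X) (pt y) = pt (ptensor x y) := by
  refine mk_eq (.l_hom _) ?_
  simp only [ptensor]
  exact (Iso.hom_inv_id_assoc _ _).symm

theorem post_swapLast (ξ : Mono d ν X) (ζ ω : Mono d ν Y) :
    post (swapLast X Y) (box (box ξ ζ) ω) = box (box ξ ω) ζ := by
  rw [swapLast, ← post_post, post_associator, ← post_post, ← box_post_right, post_braiding,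
    post_associator_inv]

theorem post_tensorμ (ξ : Mono d ν X) (ζ : Mono d ν Y) (ω : Mono d ν Z) (θ : Mono d ν W) :
    post (tensorμ X Y Z W) (box (box ξ ζ) (box ω θ)) = box (box ξ ω) (box ζ θ) := by
  simp only [tensorμ, ← post_post]
  rw [post_associator, ← box_post_right, post_associator_inv, ← box_post_right,
    ← box_post_left, post_braiding, ← box_post_right, post_associator, post_associator_inv]

section Monoid

variable {B : C} [MonObj B]

instance : Monoid (Mono d ν B) where
  mul ξ ζ := post μ (box ξ ζ)
  one := pt η
  mul_assoc ξ ζ ω := by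
    change post μ (box (post μ (box ξ ζ)) ω) = post μ (box ξ (post μ (box ζ ω)))
    rw [box_post_left, box_post_right, post_post, post_post, MonObj.mul_assoc, ← post_associator,
      post_post]
  one_mul ξ := by
    change post μ (box (pt η) ξ) = ξ
    have : (pt η : Mono d ν B) = post η (pt (𝟙 _)) := by rw [post_pt, Category.id_comp]
    rw [this, box_post_left, post_post, MonObj.one_mul, post_leftUnitor]
  mul_one ξ := by
    change post μ (box ξ (pt η)) = ξ
    have : (pt η : Mono d ν B) = post η (pt (𝟙 _)) := by rw [post_pt, Category.id_comp]
    rw [this, box_post_right, post_post, MonObj.mul_one, post_rightUnitor]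

theorem mul_def (ξ ζ : Mono d ν B) : ξ * ζ = post μ (box ξ ζ) := rfl
theorem one_def : (1 : Mono d ν B) = pt η := rfl

end Monoid

/-- The names of the variables. -/
def names : Mono d ν Y → Multiset ν :=
  Quotient.lift (fun a => (a.lab.names : Multiset ν))
    fun _ _ ⟨_, hs, _⟩ => Multiset.coe_eq_coe.mpr hs.perm

theorem names_mk (a : Lab ν w) (f : evalObj d w ⟶ Y) : (mk a f).names = a.names := rfl

theorem names_post (g : Y ⟶ Z) (ξ : Mono d ν Y) : (post g ξ).names = ξ.names := by
  induction ξ using ind with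
  | _ w a f => rfl

theorem names_box (ξ : Mono d ν Y) (ζ : Mono d ν Z) : (box ξ ζ).names = ξ.names + ζ.names := by
  induction ξ using ind with
  | _ w a x =>
    induction ζ using ind with
    | _ w' b y =>
      rw [add_comm]
      exact (Multiset.coe_add _ _).symm

theorem names_mul {B : C} [MonObj B] (ξ ζ : Mono d ν B) : (ξ * ζ).names = ξ.names + ζ.names := by
  rw [mul_def, names_post, names_box]

theorem names_one {B : C} [MonObj B] : (1 : Mono d ν B).names = 0 := rfl

section Map

variable {ν' : Type} (f : ν → ν')

/-- Rename the variables. -/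
def map : Mono d ν Y → Mono d ν' Y :=
  Quotient.map (fun a => ⟨a.lab.map f, a.hom⟩) fun _ _ ⟨s, hs, e⟩ => ⟨s, hs.map f, e⟩

theorem map_mk (a : Lab ν w) (g : evalObj d w ⟶ Y) : map f (mk a g) = mk (a.map f) g := rfl

theorem map_post (g : Y ⟶ Z) (ξ : Mono d ν Y) : map f (post g ξ) = post g (map f ξ) := by
  induction ξ using ind with
  | _ w a x => rfl

theorem map_box (ξ : Mono d ν Y) (ζ : Mono d ν Z) : map f (box ξ ζ) = box (map f ξ) (map f ζ) := by
  induction ξ using ind with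
  | _ w a x =>
    induction ζ using ind with
    | _ w' b y => rfl

/-- Renaming is multiplicative. -/
def mapHom {B : C} [MonObj B] : Mono d ν B →* Mono d ν' B where
  toFun := map f
  map_one' := rfl
  map_mul' ξ ζ := by rw [mul_def, map_post, map_box, mul_def]

theorem names_map (ξ : Mono d ν Y) : (map f ξ).names = ξ.names.map f := by
  induction ξ using ind with
  | _ w a x =>
    rw [map_mk, names_mk, names_mk, Lab.names_map]
    rfl

end Map

end Mono

namespace Pt

variable {w w' : Word}

/-- The class of a point. -/
def mk (a : Lab ν w) (f : 𝟙_ C ⟶ evalObj d w) : Pt d ν := Quotient.mk _ ⟨a, f⟩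

theorem mk_eq_iff {a : Lab ν w} {b : Lab ν w'} {f : 𝟙_ C ⟶ evalObj d w} {g : 𝟙_ C ⟶ evalObj d w'} :
    mk a f = mk b g ↔ ∃ s, Str d a b s ∧ f ≫ s = g :=
  Quotient.eq (r := PrePt.setoid d ν)

theorem mk_eq {a : Lab ν w} {b : Lab ν w'} {f : 𝟙_ C ⟶ evalObj d w} {g : 𝟙_ C ⟶ evalObj d w'}
    {s} (h : Str d a b s) (e : f ≫ s = g) : mk a f = mk b g :=
  mk_eq_iff.mpr ⟨s, h, e⟩

theorem ind {p : Pt d ν → Prop} (h : ∀ (w) (a : Lab ν w) (f : 𝟙_ C ⟶ evalObj d w), p (mk a f))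
    (ξ : Pt d ν) : p ξ := by
  induction ξ using Quotient.ind with
  | _ a => exact h _ a.lab a.hom

instance : Mul (Pt d ν) where
  mul := Quotient.map₂ (fun a b => ⟨a.lab.tensor b.lab, ptensor a.hom b.hom⟩)
    fun _ _ ⟨_, hs, e⟩ _ _ ⟨_, ht, e'⟩ =>
    ⟨_, (hs.whiskerRight _).comp (ht.whiskerLeft _), by
      rw [← e, ← e', ← ptensor_comp_tensorHom, MonoidalCategory.tensorHom_def]; rfl⟩

instance : CommMonoid (Pt d ν) where
  one := mk .unit (𝟙 _)
  mul_assoc ξ ζ ω := by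
    induction ξ using ind with
    | _ w a x =>
      induction ζ using ind with
      | _ w' b y =>
        induction ω using ind with
        | _ w'' c z => exact mk_eq (.α_hom a b c) (ptensor_associator x y z)
  one_mul ξ := by
    induction ξ using ind with
    | _ w a x => exact mk_eq (.l_hom a) (ptensor_leftUnitor x)
  mul_one ξ := by
    induction ξ using ind with
    | _ w a x => exact mk_eq (.ρ_hom a) (ptensor_rightUnitor x)
  mul_comm ξ ζ := by
    induction ξ using ind with
    | _ w a x =>
      induction ζ using ind with
      | _ w' b y => exact mk_eq (.β a b) (ptensor_braiding x y)

/-- The names of the factors. -/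
def names : Pt d ν →* Multiplicative (Multiset ν) where
  toFun := Quotient.lift (fun a => .ofAdd (a.lab.names : Multiset ν))
    fun _ _ ⟨_, hs, _⟩ => congrArg _ (Multiset.coe_eq_coe.mpr hs.perm)
  map_one' := rfl
  map_mul' ξ ζ := by
    induction ξ using ind with
    | _ w a x =>
      induction ζ using ind with
      | _ w' b y =>
        rw [mul_comm (Quotient.lift _ _ (mk a x))]
        exact congrArg Multiplicative.ofAdd (Multiset.coe_add b.names a.names).symm

section Map

variable {ν' : Type} (f : ν → ν')

/-- Rename the factors. -/
def map : Pt d ν →* Pt d ν' where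
  toFun := Quotient.map (fun a => ⟨a.lab.map f, a.hom⟩) fun _ _ ⟨s, hs, e⟩ => ⟨s, hs.map f, e⟩
  map_one' := rfl
  map_mul' ξ ζ := by
    induction ξ using ind with
    | _ w a x =>
      induction ζ using ind with
      | _ w' b y => rfl

end Map

end Pt

/-- `u` is the value of the expression `ξ` at the point `τ`. -/
def Pairs {Y : C} (τ : Pt d ν) (ξ : Mono d ν Y) (u : 𝟙_ C ⟶ Y) : Prop :=
  ∃ (w : Word) (a : Lab ν w) (t : 𝟙_ C ⟶ evalObj d w) (f : evalObj d w ⟶ Y),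
    τ = Pt.mk a t ∧ ξ = Mono.mk a f ∧ u = t ≫ f

namespace Pairs

variable {Y Z : C} {τ τ' : Pt d ν} {ξ ξ' : Mono d ν Y} {u u' : 𝟙_ C ⟶ Y}

theorem unique (h : Pairs τ ξ u) (h' : Pairs τ ξ u') (hn : ξ.names.Nodup) : u = u' := by
  obtain ⟨w, a, t, f, rfl, rfl, rfl⟩ := h
  obtain ⟨w', b, t', f', ht, hf, rfl⟩ := h'
  obtain ⟨s, hs, rfl⟩ := Pt.mk_eq_iff.mp ht
  obtain ⟨s', hs', rfl⟩ := Mono.mk_eq_iff.mp hf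
  have hb : b.names.Nodup := by
    rw [Mono.names_mk, Multiset.coe_nodup] at hn
    exact hs.perm.nodup_iff.mp hn
  rw [hs.eq hs' hb, Category.assoc]

theorem exists_of_names (h : τ.names = .ofAdd ξ.names) : ∃ u, Pairs τ ξ u := by
  induction τ using Pt.ind with
  | _ w a t =>
    induction ξ using Mono.ind with
    | _ w' b f =>
      obtain ⟨s, hs⟩ := Str.exists_of_perm (d := d) (Multiset.coe_eq_coe.mp (congrArg Multiplicative.toAdd h))
      exact ⟨_, w', b, t ≫ s, f, Pt.mk_eq hs rfl, rfl, rfl⟩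

theorem box {ζ : Mono d ν Z} {v : 𝟙_ C ⟶ Z} (h : Pairs τ ξ u) (h' : Pairs τ' ζ v) :
    Pairs (τ * τ') (ξ.box ζ) (ptensor u v) := by
  obtain ⟨w, a, t, f, rfl, rfl, rfl⟩ := h
  obtain ⟨w', b, t', f', rfl, rfl, rfl⟩ := h'
  exact ⟨_, a.tensor b, ptensor t t', f ⊗ₘ f', rfl, rfl, (ptensor_comp_tensorHom _ _ _ _).symm⟩

theorem post (h : Pairs τ ξ u) (g : Y ⟶ Z) : Pairs τ (ξ.post g) (u ≫ g) := by
  obtain ⟨w, a, t, f, rfl, rfl, rfl⟩ := h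
  exact ⟨_, a, t, f ≫ g, rfl, rfl, Category.assoc _ _ _⟩

theorem map {ν' : Type} (f : ν → ν') (h : Pairs τ ξ u) : Pairs (τ.map f) (ξ.map f) u := by
  obtain ⟨w, a, t, g, rfl, rfl, rfl⟩ := h
  exact ⟨w, a.map f, t, g, rfl, rfl, rfl⟩

theorem pt (y : 𝟙_ C ⟶ Y) : Pairs (1 : Pt d ν) (Mono.pt y) y :=
  ⟨_, .unit, 𝟙 _, y, rfl, rfl, (Category.id_comp _).symm⟩

end Pairs

end Expressions

end XCT

namespace XCT

open Presented (evalObj)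
open scoped MonObj

/-! ### Tensor products of families of expressions -/

namespace Mono

variable {C : Type u} [Category.{v} C] [MonoidalCategory C] [SymmetricCategory C]
  {d : XCData C} {ν : Type} {A : C}

/-- The tensor product of a family of expressions. -/
def boxAll : ∀ {n : ℕ}, (Fin n → Mono d ν A) → Mono d ν (tpow A n)
  | 0, _ => pt (𝟙 _)
  | n + 1, q => box (boxAll fun i : Fin n => q i.castSucc) (q (Fin.last n))

theorem boxAll_succ {n : ℕ} (q : Fin (n + 1) → Mono d ν A) :
    boxAll q = box (boxAll fun i : Fin n => q i.castSucc) (q (Fin.last n)) := rfl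

theorem names_boxAll : ∀ {n : ℕ} (q : Fin n → Mono d ν A), (boxAll q).names = ∑ i, (q i).names
  | 0, _ => rfl
  | n + 1, q => by
    rw [Fin.sum_univ_castSucc, ← names_boxAll fun i : Fin n => q i.castSucc, boxAll_succ, names_box]

theorem map_boxAll {ν' : Type} (f : ν → ν') : ∀ {n : ℕ} (q : Fin n → Mono d ν A),
    (boxAll q).map f = boxAll fun i => (q i).map f
  | 0, _ => rfl
  | n + 1, q => by
    rw [boxAll_succ, boxAll_succ, map_box, map_boxAll]

theorem post_mulPow (m : A ⊗ A ⟶ A) : ∀ {n : ℕ} (a b : Fin n → Mono d ν A),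
    post (mulPow m n) (box (boxAll a) (boxAll b)) = boxAll fun i => post m (box (a i) (b i))
  | 0, _, _ => post_leftUnitor _
  | n + 1, a, b => by
    rw [boxAll_succ, boxAll_succ, boxAll_succ, mulPow, ← post_post, post_tensorμ, ← box_post_post,
      post_mulPow m]

theorem boxAll_pt (e : 𝟙_ C ⟶ A) : ∀ n : ℕ,
    boxAll (fun _ : Fin n => (pt e : Mono d ν A)) = pt (unitPow e n)
  | 0 => rfl
  | n + 1 => by rw [boxAll_succ, boxAll_pt e n, box_pt_pt]; rfl

theorem post_adj : ∀ {n : ℕ} (i : ℕ) (h : i + 1 < n) (q : Fin n → Mono d ν A),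
    post (adj A n i) (boxAll q) = boxAll (q ∘ adjSwap i h)
  | 0, i, h, _ => by omega
  | 1, i, h, _ => by omega
  | n + 2, i, h, q => by
    have key : ∀ a b : Fin (n + 2), (a : ℕ) = b → q a = q b := fun a b hab => by rw [Fin.ext hab]
    by_cases hi : i = n
    · subst hi
      rw [adj_self, boxAll_succ, boxAll_succ, post_swapLast, boxAll_succ, boxAll_succ]
      congr 1
      · congr 1
        · congr 1
          funext j
          refine key _ _ ?_
          have := j.isLt
          rw [adjSwap_val, if_neg (by simp; omega), if_neg (by simp; omega)]
        · refine key _ _ ?_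
          rw [adjSwap_val, if_pos (by simp)]; rfl
      · refine key _ _ ?_
        rw [adjSwap_val, if_neg (by simp), if_pos (by simp)]; rfl
    · rw [adj_succ A n i (by omega), boxAll_succ q, ← box_post_left, post_adj i (by omega),
        boxAll_succ (q ∘ _)]
      congr 1
      · congr 1
        funext j
        refine key _ _ ?_
        rw [adjSwap_val, Fin.val_castSucc, adjSwap_val]; rfl
      · refine key _ _ ?_
        rw [adjSwap_val, if_neg (by simp; omega), if_neg (by simp; omega)]

theorem post_permMap {n : ℕ} (σ : Equiv.Perm (Fin n)) (q : Fin n → Mono d ν A) :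
    post (permMap A σ) (boxAll q) = boxAll (q ∘ ⇑σ⁻¹) := by
  induction σ using perm_induction with
  | h1 => rw [permMap_one, post_id]; rfl
  | hs i h σ ih =>
    rw [permMap_adjSwap_mul, ← post_post, ih, post_adj i h, mul_inv_rev]
    have : (adjSwap i h)⁻¹ = adjSwap i h := Equiv.swap_inv _ _
    rw [this]
    rfl

theorem post_tpowAdd {n : ℕ} (a : Fin n → Mono d ν A) : ∀ {m : ℕ} (b : Fin m → Mono d ν A),
    post (tpowAdd A n m).hom (box (boxAll a) (boxAll b)) =
      boxAll (Fin.addCases (motive := fun _ => Mono d ν A) a b)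
  | 0, b => by
    refine (post_rightUnitor _).trans ?_
    congr 1
    funext i
    exact (Fin.addCases_left (m := n) (n := 0) (motive := fun _ => Mono d ν A) i).symm
  | m + 1, b => by
    refine (post_post (α_ (tpow A n) (tpow A m) A).inv ((tpowAdd A n m).hom ▷ A) _).symm.trans ?_
    rw [boxAll_succ b, post_associator_inv, ← box_post_left, post_tpowAdd]
    refine Eq.trans ?_ (boxAll_succ (n := n + m) _).symm
    congr 1
    · congr 1
      funext i
      refine Fin.addCases (fun i => ?_) (fun i => ?_) i
      · rw [Fin.addCases_left]
        exact (Fin.addCases_left (m := n) (n := m + 1) (motive := fun _ => Mono d ν A) i).symm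
      · rw [Fin.addCases_right]
        exact (Fin.addCases_right (m := n) (n := m + 1) (motive := fun _ => Mono d ν A) i.castSucc).symm
    · exact (Fin.addCases_right (m := n) (n := m + 1) (motive := fun _ => Mono d ν A) (Fin.last m)).symm

theorem post_tpowAdd_inv {n m : ℕ} (q : Fin (n + m) → Mono d ν A) :
    post (tpowAdd A n m).inv (boxAll q) =
      box (boxAll fun i => q (Fin.castAdd m i)) (boxAll fun i => q (Fin.natAdd n i)) := by
  have : q = Fin.addCases (motive := fun _ => Mono d ν A) (fun i => q (Fin.castAdd m i))
      (fun i => q (Fin.natAdd n i)) := by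
    funext i
    refine Fin.addCases (fun i => ?_) (fun i => ?_) i
    · rw [Fin.addCases_left]
    · rw [Fin.addCases_right]
  conv_lhs => rw [this, ← post_tpowAdd, post_post, Iso.hom_inv_id, post_id]

theorem post_placeAt (e : 𝟙_ C ⟶ A) (ξ : Mono d ν A) (a : ℕ) : ∀ b : ℕ,
    post (placeAt e a b) ξ = boxAll fun i : Fin (a + 1 + b) => if (i : ℕ) = a then ξ else pt e
  | 0 => by
    refine (post_post (λ_ A).inv (unitPow e a ▷ A) ξ).symm.trans ?_
    rw [post_leftUnitor_inv, ← box_post_left, post_pt, Category.id_comp, ← boxAll_pt]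
    refine Eq.trans ?_ (boxAll_succ (n := a) _).symm
    congr 1
    · congr 1
      funext i
      have := i.isLt
      rw [if_neg (by simp; omega)]
    · rw [if_pos (by simp)]
  | b + 1 => by
    refine (post_post (ρ_ A).inv (placeAt e a b ⊗ₘ e) ξ).symm.trans ?_
    rw [post_rightUnitor_inv, ← box_post_post, post_pt, Category.id_comp, post_placeAt e ξ a b]
    refine Eq.trans ?_ (boxAll_succ (n := a + 1 + b) _).symm
    congr 1
    rw [if_neg (by simp; omega)]

theorem post_toPow1 (ξ : Mono d ν A) : post (toPow1 A) ξ = boxAll ![ξ] := post_leftUnitor_inv ξ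

theorem post_toPow2 (ξ ζ : Mono d ν A) : post (toPow2 A) (box ξ ζ) = boxAll ![ξ, ζ] := by
  rw [toPow2, ← box_post_left, post_leftUnitor_inv]
  rfl

section Monoid

variable [MonObj A]

theorem boxAll_one (n : ℕ) : boxAll (fun _ : Fin n => (1 : Mono d ν A)) = pt (unitPow η[A] n) :=
  boxAll_pt _ n

theorem post_mulPow_mul {n : ℕ} (a b : Fin n → Mono d ν A) :
    post (mulPow μ[A] n) (box (boxAll a) (boxAll b)) = boxAll fun i => a i * b i :=
  post_mulPow _ a b

theorem post_iterMul : ∀ {k : ℕ} (q : Fin k → Mono d ν A),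
    post (iterMul μ[A] η[A] k) (boxAll q) = (List.ofFn q).prod
  | 0, _ => by
    rw [List.ofFn_zero, List.prod_nil]
    exact congrArg pt (Category.id_comp _)
  | k + 1, q => by
    rw [List.ofFn_succ', List.concat_eq_append, List.prod_append, List.prod_singleton,
      ← post_iterMul, mul_def, box_post_left, post_post]
    rfl

theorem post_blockMul : ∀ {r : ℕ} (k : Fin r → ℕ) (q : Fin (total k) → Mono d ν A),
    post (blockMul μ[A] η[A] k) (boxAll q) =
      boxAll fun i => (List.ofFn fun j => q (blockPos k i j)).prod
  | 0, _, q => post_id _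
  | r + 1, k, q => by
    refine (post_post _ _ _).symm.trans ?_
    refine (congrArg _ (post_tpowAdd_inv (n := total fun i : Fin r => k i.castSucc)
      (m := k (Fin.last r)) q)).trans ?_
    rw [← box_post_post, post_blockMul, post_iterMul, boxAll_succ]
    congr 1
    · congr 1
      funext i
      congr 2
      funext j
      rw [blockPos_castSucc]
    · congr 2
      funext j
      rw [blockPos_last]

end Monoid

end Mono

namespace Pairs

variable {C : Type u} [Category.{v} C] [MonoidalCategory C] [SymmetricCategory C]
  {d : XCData C} {ν : Type} {A : C} [MonObj A] {τ τ' : Pt d ν}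

theorem dot {n : ℕ} {a b : Fin n → Mono d ν A} {u v : 𝟙_ C ⟶ tpow A n}
    (h : Pairs τ (Mono.boxAll a) u) (h' : Pairs τ' (Mono.boxAll b) v) :
    Pairs (τ * τ') (Mono.boxAll fun i => a i * b i) (dot μ[A] u v) := by
  have := (h.box h').post (mulPow μ[A] n)
  rwa [Mono.post_mulPow_mul] at this

theorem powTensor {n m : ℕ} {a : Fin n → Mono d ν A} {b : Fin m → Mono d ν A}
    {u : 𝟙_ C ⟶ tpow A n} {v : 𝟙_ C ⟶ tpow A m}
    (h : Pairs τ (Mono.boxAll a) u) (h' : Pairs τ' (Mono.boxAll b) v) :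
    Pairs (τ * τ') (Mono.boxAll (Fin.addCases (motive := fun _ => Mono d ν A) a b))
      (powTensor u v) := by
  have := (h.box h').post (tpowAdd A n m).hom
  rwa [Mono.post_tpowAdd] at this

theorem permMap {n : ℕ} {a : Fin n → Mono d ν A} {u : 𝟙_ C ⟶ tpow A n}
    (h : Pairs τ (Mono.boxAll a) u) (σ : Equiv.Perm (Fin n)) :
    Pairs τ (Mono.boxAll (a ∘ ⇑σ⁻¹)) (u ≫ permMap A σ) := by
  have := h.post (XCT.permMap A σ)
  rwa [Mono.post_permMap] at this

theorem blockMul {r : ℕ} {k : Fin r → ℕ} {a : Fin (total k) → Mono d ν A}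
    {u : 𝟙_ C ⟶ tpow A (total k)} (h : Pairs τ (Mono.boxAll a) u) :
    Pairs τ (Mono.boxAll fun i => (List.ofFn fun j => a (blockPos k i j)).prod)
      (u ≫ blockMul μ[A] η[A] k) := by
  have := h.post (XCT.blockMul μ[A] η[A] k)
  rwa [Mono.post_blockMul] at this

end Pairs

end XCT

namespace XCT

open Presented (evalObj)
open scoped MonObj

/-! ### Values of paths in a monoid -/

namespace EPath

variable {E E' V V' M N : Type*} [Monoid M] [Monoid N]

/-- The product of the values of the vertices and edges of a list, from right to left. -/
def evTail (fe : E → M) (fv : V → M) : List (V × E) → M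
  | [] => 1
  | (v, e) :: t => evTail fe fv t * (fe e * fv v)

theorem evTail_append (fe : E → M) (fv : V → M) (t : List (V × E)) : ∀ s : List (V × E),
    evTail fe fv (s ++ t) = evTail fe fv t * evTail fe fv s
  | [] => (mul_one _).symm
  | (v, e) :: s => by simp only [List.cons_append, evTail, evTail_append fe fv t s, mul_assoc]

section

variable {E E' V V' : Type}

/-- The product of the values of the vertices and edges of a path, from right to left. -/
def ev (fe : E → M) (fv : V → M) (p : EPath E V) : M := evTail fe fv p.tail * fe p.head

theorem ev_edge (fe : E → M) (fv : V → M) (e : E) : ev fe fv (edge e : EPath E V) = fe e :=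
  one_mul _

theorem ev_glue (fe : E → M) (fv : V → M) (v : V) (p q : EPath E V) :
    ev fe fv (glue v p q) = ev fe fv q * fv v * ev fe fv p := by
  simp only [ev, glue, evTail_append, evTail, mul_assoc]

theorem ev_mapV (fe : E → M) (fv : V' → M) (f : V → V') (p : EPath E V) :
    ev fe fv (p.mapV f) = ev fe (fv ∘ f) p := by
  obtain ⟨h, t⟩ := p
  have : evTail fe fv (t.map (Prod.map f id)) = evTail fe (fv ∘ f) t := by
    induction t with
    | nil => rfl
    | cons a t ih => simp [evTail, ih, Prod.map]
  simp only [ev, mapV, this]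

theorem ev_bind (fe : E' → M) (fv : V → M) (f : E → EPath E' V) (p : EPath E V) :
    ev fe fv (p.bind f) = ev (fun e => ev fe fv (f e)) fv p := by
  obtain ⟨h, t⟩ := p
  have : evTail fe fv (t.flatMap fun ve => (ve.1, (f ve.2).head) :: (f ve.2).tail) =
      evTail (fun e => ev fe fv (f e)) fv t := by
    induction t with
    | nil => rfl
    | cons a t ih =>
      obtain ⟨v, e⟩ := a
      simp only [List.flatMap_cons, evTail_append, ih, evTail, ev, mul_assoc]
  simp only [ev, bind, evTail_append, this, mul_assoc]

theorem map_ev (g : M →* N) (fe : E → M) (fv : V → M) (p : EPath E V) :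
    g (ev fe fv p) = ev (g ∘ fe) (g ∘ fv) p := by
  obtain ⟨h, t⟩ := p
  have : g (evTail fe fv t) = evTail (g ∘ fe) (g ∘ fv) t := by
    induction t with
    | nil => exact g.map_one
    | cons a t ih => simp [evTail, ih]
  simp [ev, this]

theorem ev_joinAll {X : Type} (fe : E → M) (fv : Vtx X → M) (hb : fv .bi = 1) (e : E) (he : fe e = 1) :
    ∀ l : List (EPath E (Vtx X)), ev fe fv (joinAll e l) = ((l.map (ev fe fv)).reverse).prod
  | [] => by rw [joinAll, ev_edge, he]; rfl
  | [p] => by simp [joinAll]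
  | p :: q :: l => by
    have := ev_joinAll fe fv hb e he (q :: l)
    rw [joinAll, join, ev_glue, hb, this]
    simp [mul_assoc]

end

end EPath

/-! ### The value of a diagram -/

section Value

variable {C : Type u} [Category.{v} C] [MonoidalCategory C] [SymmetricCategory C]
  {A : C} [MonObj A] (S : XCStructure A) {X Y : Type}

/-- The value of an edge with a given rotation number. -/
def rotPoint : SignType → (𝟙_ C ⟶ A)
  | .zero => η[A]
  | .pos => S.κinv
  | .neg => S.κ

/-- The value of an edge as an expression. -/
def rotVal (ν : Type) (s : SignType) : Mono S.data ν A := Mono.pt (rotPoint S s)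

/-- The value of a passage. -/
def passVal (x : X) (o : Bool) : Mono S.data (X × Bool) A := Mono.var (d := S.data) (x, o)

/-- The value of an interior vertex of a strand. -/
def vtxVal : Vtx X → Mono S.data (X × Bool) A
  | .bi => 1
  | .cross x o => passVal S x o

/-- The value of a strand. -/
def strandVal (p : Strand X) : Mono S.data (X × Bool) A := p.ev (rotVal S _) (vtxVal S)

/-- The value of a crossing. -/
def crossPt (x : X) (ε : Bool) : Pt S.data (X × Bool) :=
  Pt.mk (d := S.data) ((Lab.gen (x, true)).tensor (.gen (x, false))) (cond ε S.R S.Rinv)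

/-- The product of the values of all crossings. -/
noncomputable def crossPts (sign : X → Bool) : Pt S.data (X × Bool) := ∏ᶠ x, crossPt S x (sign x)

theorem rotVal_zero (ν : Type) : rotVal S ν 0 = 1 := rfl

theorem map_strandVal (f : X → Y) (p : Strand X) :
    (strandVal S p).map (Prod.map f id) = strandVal S (p.rename f) := by
  have := p.map_ev (Mono.mapHom (d := S.data) (B := A) (Prod.map f id)) (rotVal S (X × Bool))
    (vtxVal S)
  refine this.trans ?_
  rw [strandVal, EPath.rename, EPath.ev_mapV]
  congr 1
  funext v
  cases v <;> rfl

theorem map_crossPt (f : X → Y) (x : X) (ε : Bool) :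
    (crossPt S x ε).map (Prod.map f id) = crossPt S (f x) ε := rfl

theorem crossPts_empty [IsEmpty X] (sign : X → Bool) : crossPts S sign = 1 :=
  finprod_of_isEmpty _

theorem crossPts_equiv (e : X ≃ Y) (sign : X → Bool) (sign' : Y → Bool)
    (h : ∀ x, sign' (e x) = sign x) [Finite X] :
    (crossPts S sign).map (Prod.map e id) = crossPts S sign' := by
  have := Fintype.ofFinite X
  have := Fintype.ofEquiv X e
  rw [crossPts, crossPts, finprod_eq_prod_of_fintype, finprod_eq_prod_of_fintype, map_prod]
  refine Fintype.prod_equiv e _ _ fun x => ?_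
  rw [map_crossPt, h]

theorem crossPts_sum (sign : X → Bool) (sign' : Y → Bool) [Finite X] [Finite Y] :
    crossPts S (Sum.elim sign sign') = (crossPts S sign).map (Prod.map Sum.inl id) *
      (crossPts S sign').map (Prod.map Sum.inr id) := by
  have := Fintype.ofFinite X
  have := Fintype.ofFinite Y
  simp only [crossPts, finprod_eq_prod_of_fintype]
  rw [Fintype.prod_sum_type, map_prod, map_prod]
  rfl

theorem names_crossPt (x : X) (ε : Bool) :
    (crossPt S x ε).names = .ofAdd {(x, false), (x, true)} := rfl

theorem count_names_crossPts [Finite X] [DecidableEq (X × Bool)] (sign : X → Bool) (a : X × Bool) :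
    (Multiplicative.toAdd (crossPts S sign).names).count a = 1 := by
  have := Fintype.ofFinite X
  obtain ⟨x, o⟩ := a
  rw [crossPts, finprod_eq_prod_of_fintype, map_prod, toAdd_prod, Multiset.count_sum']
  simp only [names_crossPt, toAdd_ofAdd]
  rw [Finset.sum_eq_single x]
  · cases o <;> simp
  · intro y _ hy
    have : (x, o) ∉ ({(y, false), (y, true)} : Multiset (X × Bool)) := by simp [hy.symm]
    exact Multiset.count_eq_zero_of_notMem this
  · simp

theorem names_rotVal (ν : Type) (s : SignType) : (rotVal S ν s).names = 0 := rfl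

theorem count_names_strandVal [DecidableEq (X × Bool)] (p : Strand X) (x : X) (o : Bool) :
    (strandVal S p).names.count (x, o) = p.count (Vtx.cross x o) := by
  obtain ⟨h, t⟩ := p
  rw [strandVal, EPath.ev, Mono.names_mul, names_rotVal, add_zero, EPath.count]
  induction t with
  | nil => rfl
  | cons a t ih =>
    obtain ⟨v, e⟩ := a
    rw [EPath.evTail, Mono.names_mul, Mono.names_mul, names_rotVal, zero_add, Multiset.count_add,
      ih, List.countP_cons]
    congr 1
    cases v with
    | bi => simp [vtxVal, Mono.names_one]
    | cross y o' =>
      rw [vtxVal, passVal]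
      have : (Mono.var (d := S.data) (y, o')).names = {(y, o')} := rfl
      refine (congrArg (Multiset.count (x, o)) this).trans ?_
      rw [Multiset.count_singleton]
      by_cases hxy : y = x ∧ o' = o
      · obtain ⟨rfl, rfl⟩ := hxy
        simp
      · rw [if_neg (by simpa [eq_comm] using hxy), if_neg (by simpa using hxy)]

/-- The expression given by the strands of a diagram. -/
def strandsVal {n : ℕ} (p : Fin n → Strand X) : Mono S.data (X × Bool) (tpow A n) :=
  Mono.boxAll fun i => strandVal S (p i)

theorem map_strandsVal (f : X → Y) {n : ℕ} (p : Fin n → Strand X) :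
    (strandsVal S p).map (Prod.map f id) = strandsVal S fun i => (p i).rename f := by
  rw [strandsVal, Mono.map_boxAll]
  simp only [map_strandVal]
  rfl

theorem count_names_strandsVal [DecidableEq (X × Bool)] {n : ℕ} (p : Fin n → Strand X) (x : X) (o : Bool) :
    (strandsVal S p).names.count (x, o) = ∑ i, (p i).count (Vtx.cross x o) := by
  rw [strandsVal, Mono.names_boxAll, Multiset.count_sum']
  simp only [count_names_strandVal]

section Once

variable {n : ℕ} {p : Fin n → Strand X}
  (h : ∀ (x : X) (o : Bool), ∑ i, (p i).count (Vtx.cross x o) = 1)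

include h

theorem nodup_names_strandsVal : (strandsVal S p).names.Nodup := by
  classical
  rw [Multiset.nodup_iff_count_le_one]
  rintro ⟨x, o⟩
  rw [count_names_strandsVal, h]

theorem names_crossPts_eq [Finite X] (sign : X → Bool) :
    (crossPts S sign).names = .ofAdd (strandsVal S p).names := by
  classical
  refine Multiplicative.toAdd.injective ?_
  ext ⟨x, o⟩
  rw [count_names_crossPts, toAdd_ofAdd, count_names_strandsVal, h]

end Once

namespace XCDiagram

variable {n m : ℕ}

theorem exists_pairs (D : XCDiagram n) : ∃ u, Pairs (crossPts S D.sign) (strandsVal S D.strand) u :=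
  have := D.finite
  Pairs.exists_of_names (names_crossPts_eq S D.once D.sign)

/-- The point of `A^{⊗ n}` that is associated with a diagram. -/
noncomputable def val (D : XCDiagram n) : 𝟙_ C ⟶ tpow A n := (D.exists_pairs S).choose

theorem pairs_val (D : XCDiagram n) : Pairs (crossPts S D.sign) (strandsVal S D.strand) (D.val S) :=
  (D.exists_pairs S).choose_spec

theorem pairs_val_map (D : XCDiagram n) (f : D.X → Y) :
    Pairs ((crossPts S D.sign).map (Prod.map f _root_.id)) (strandsVal S fun i => (D.strand i).rename f)
      (D.val S) := by
  rw [← map_strandsVal]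
  exact (D.pairs_val S).map _

theorem val_eq (D : XCDiagram n) {u} (h : Pairs (crossPts S D.sign) (strandsVal S D.strand) u) :
    D.val S = u :=
  (D.pairs_val S).unique h (nodup_names_strandsVal S D.once)

theorem val_eq_of_equiv (D : XCDiagram n) (e : X ≃ D.X) {sign : X → Bool} {p : Fin n → Strand X}
    (hsign : ∀ x, D.sign (e x) = sign x) (hp : ∀ i, D.strand i = (p i).rename e) {u}
    (h : Pairs (crossPts S sign) (strandsVal S p) u) : D.val S = u := by
  have := D.finite
  have := Finite.of_equiv _ e.symm
  refine D.val_eq S ?_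
  have h' := h.map (Prod.map e _root_.id)
  rw [crossPts_equiv S e sign D.sign hsign, map_strandsVal] at h'
  simp only [← hp] at h'
  exact h'

theorem val_iso {D D' : XCDiagram n} (e : D.X ≃ D'.X) (hsign : ∀ x, D'.sign (e x) = D.sign x)
    (hstrand : ∀ i, D'.strand i = (D.strand i).rename e) : D'.val S = D.val S :=
  D'.val_eq_of_equiv S e hsign hstrand (D.pairs_val S)

theorem strandVal_join (p q : Strand X) :
    strandVal S (EPath.join p q) = strandVal S q * strandVal S p := by
  rw [strandVal, EPath.join, EPath.ev_glue]
  exact congrArg (· * _) (mul_one _)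

theorem val_comp (T₂ T₁ : XCDiagram n) :
    (T₂.comp T₁).val S = dot μ[A] (T₂.val S ≫ permMap A T₁.perm⁻¹) (T₁.val S) := by
  have := T₁.finite
  have := T₂.finite
  refine val_eq S _ ?_
  have h := ((T₂.pairs_val_map S (Sum.inr : _ → T₁.X ⊕ T₂.X)).permMap T₁.perm⁻¹).dot
    (T₁.pairs_val_map S (Sum.inl : _ → T₁.X ⊕ T₂.X))
  rw [mul_comm, ← crossPts_sum, inv_inv] at h
  refine Eq.mp (congrArg (fun ξ => Pairs _ (Mono.boxAll ξ) _) ?_) h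
  funext i
  exact (strandVal_join S _ _).symm

theorem val_tensor (T₁ : XCDiagram n) (T₂ : XCDiagram m) :
    (T₁.tensor T₂).val S = powTensor (T₁.val S) (T₂.val S) := by
  have := T₁.finite
  have := T₂.finite
  refine val_eq S _ ?_
  have h := (T₁.pairs_val_map S (Sum.inl : _ → T₁.X ⊕ T₂.X)).powTensor
    (T₂.pairs_val_map S (Sum.inr : _ → T₁.X ⊕ T₂.X))
  rw [← crossPts_sum] at h
  refine Eq.mp (congrArg (fun ξ => Pairs _ (Mono.boxAll ξ) _) ?_) h
  funext i
  refine Fin.addCases (fun i => ?_) (fun i => ?_) i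
  · simp only [Fin.addCases_left, tensor]
  · simp only [Fin.addCases_right, tensor]

theorem val_permute (ρ τ : Equiv.Perm (Fin n)) (T : XCDiagram n) :
    (T.permute ρ τ).val S = T.val S ≫ permMap A τ :=
  val_eq S _ ((T.pairs_val S).permMap τ)

theorem val_merge {r : ℕ} (k : Fin r → ℕ) (T : XCDiagram (total k)) :
    (T.merge k).val S = T.val S ≫ blockMul μ[A] η[A] k := by
  refine val_eq S _ ?_
  refine Eq.mp (congrArg (fun ξ => Pairs _ (Mono.boxAll ξ) _) ?_) (T.pairs_val S).blockMul
  funext i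
  simp only [merge]
  rw [strandVal, EPath.ev_joinAll _ _ (by rfl) _ (by rfl), List.map_reverse, List.reverse_reverse,
    List.map_ofFn]
  rfl

theorem val_of_edges (T : XCDiagram n) (hX : IsEmpty T.X) (h : ∀ i, T.strand i = EPath.edge 0) :
    T.val S = unitPow η[A] n := by
  refine val_eq S _ ?_
  rw [crossPts_empty]
  have : strandsVal S T.strand = Mono.pt (unitPow η[A] n) := by
    rw [← Mono.boxAll_one]
    refine congrArg Mono.boxAll (funext fun i => ?_)
    rw [h, strandVal, EPath.ev_edge]
    rfl
  rw [this]
  exact Pairs.pt _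

theorem val_id : (XCDiagram.id n).val S = unitPow η[A] n :=
  val_of_edges S _ (inferInstanceAs (IsEmpty Empty)) fun _ => rfl

theorem val_braid : (XCDiagram.braid n m).val S = unitPow η[A] (n + m) :=
  val_of_edges S _ (inferInstanceAs (IsEmpty Empty)) fun _ => rfl

theorem val_rotation (s : SignType) : (rotation s).val S = rotPoint S s ≫ toPow1 A := by
  refine val_eq S _ ?_
  have : IsEmpty (rotation s).X := inferInstanceAs (IsEmpty Empty)
  rw [crossPts_empty]
  have h := (Pairs.pt (d := S.data) (ν := (rotation s).X × Bool) (rotPoint S s)).post (toPow1 A)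
  rw [Mono.post_toPow1] at h
  refine Eq.mp (congrArg (fun ξ => Pairs _ (Mono.boxAll ξ) _) ?_) h
  funext i
  fin_cases i
  exact (EPath.ev_edge (rotVal S _) (vtxVal S) s).symm

end XCDiagram

/-- The value of a crossing at the two passages. -/
theorem pairs_crossPt (x : X) (ε : Bool) :
    Pairs (crossPt S x ε) ((passVal S x true).box (passVal S x false)) (cond ε S.R S.Rinv) :=
  ⟨_, (Lab.gen (x, true)).tensor (.gen (x, false)), cond ε S.R S.Rinv, 𝟙 _, rfl,
    (congrArg (Mono.mk _) (id_tensorHom_id _ _)), (Category.comp_id _).symm⟩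

theorem strandVal_edges (e f : SignType) (x : X) (o : Bool) :
    strandVal S ⟨e, [(Vtx.cross x o, f)]⟩ = rotVal S _ f * passVal S x o * rotVal S _ e :=
  congrArg (· * _) (one_mul _)

namespace XCDiagram

theorem val_posCrossing : posCrossing.val S = S.R ≫ toPow2 A := by
  refine val_eq S _ ?_
  have h := (pairs_crossPt S () true).post (toPow2 A)
  rw [Mono.post_toPow2] at h
  have e : crossPts S posCrossing.sign = crossPt S () true :=
    have : Unique posCrossing.X := inferInstanceAs (Unique Unit)
    finprod_unique _
  rw [e]
  refine Eq.mp (congrArg (fun ξ => Pairs _ (Mono.boxAll ξ) _) ?_) h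
  funext i
  fin_cases i <;> exact (((strandVal_edges S 0 0 () _).trans (mul_one _)).trans (one_mul _)).symm

theorem val_negCrossing : negCrossing.val S = (S.Rinv ≫ (β_ A A).hom) ≫ toPow2 A := by
  refine val_eq S _ ?_
  have h := ((pairs_crossPt S () false).post (β_ A A).hom).post (toPow2 A)
  rw [Mono.post_braiding, Mono.post_toPow2] at h
  have e : crossPts S negCrossing.sign = crossPt S () false :=
    have : Unique negCrossing.X := inferInstanceAs (Unique Unit)
    finprod_unique _
  rw [e]
  refine Eq.mp (congrArg (fun ξ => Pairs _ (Mono.boxAll ξ) _) ?_) h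
  funext i
  fin_cases i <;> exact (((strandVal_edges S 0 0 () _).trans (mul_one _)).trans (one_mul _)).symm

end XCDiagram

end Value

end XCT

namespace XCT

open Presented (evalObj)
open scoped MonObj

/-! ### Cutting strands into pieces -/

namespace EPath

variable {E V : Type} {M : Type*} [Monoid M]

/-- The edges and vertices of a path, from the last one to the first one. -/
def pieces (p : EPath E V) : List (E ⊕ V) :=
  (Sum.inl p.head :: p.tail.flatMap fun a => [Sum.inr a.1, Sum.inl a.2]).reverse

theorem ev_eq_prod (fe : E → M) (fv : V → M) (p : EPath E V) :
    ev fe fv p = (p.pieces.map (Sum.elim fe fv)).prod := by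
  obtain ⟨h, t⟩ := p
  have : evTail fe fv t =
      (((t.flatMap fun a => [Sum.inr a.1, Sum.inl a.2]).reverse).map (Sum.elim fe fv)).prod := by
    induction t with
    | nil => rfl
    | cons a t ih => simp [evTail, ih]
  simp [ev, pieces, this]

end EPath

theorem exists_blockFun {α : Type*} : ∀ {r : ℕ} (k : Fin r → ℕ) (g : ∀ i, Fin (k i) → α),
    ∃ G : Fin (total k) → α, ∀ i j, G (blockPos k i j) = g i j
  | 0, _, _ => ⟨Fin.elim0, fun i => i.elim0⟩
  | r + 1, k, g => by
    obtain ⟨G, hG⟩ := exists_blockFun (fun i : Fin r => k i.castSucc) fun i => g i.castSucc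
    refine ⟨Fin.addCases (motive := fun _ => α) G (g (Fin.last r)), fun i => ?_⟩
    refine Fin.lastCases (fun j => ?_) (fun i j => ?_) i
    · rw [blockPos_last]
      exact Fin.addCases_right _
    · rw [blockPos_castSucc, ← hG]
      exact Fin.addCases_left _

/-- If every element of `Fin k` is taken exactly once, then it can be split off. -/
theorem exists_split {N k : ℕ} {P : Type} (G : Fin N → P ⊕ Fin k) (h : ∀ j, ∃! t, G t = Sum.inr j) :
    ∃ (N' : ℕ) (e : Fin N' ⊕ Fin k ≃ Fin N) (g : Fin N' → P),
      ∀ x, G (e x) = Sum.map g id x := by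
  classical
  choose s hs hs' using h
  let p : Fin N → Prop := fun t => (G t).isLeft
  let e₁ : Fin k ≃ {t // ¬ p t} := Equiv.ofBijective (fun j => ⟨s j, by simp [p, hs]⟩) ⟨by
    intro i j hij
    have : s i = s j := congrArg Subtype.val hij
    exact Sum.inr_injective ((hs i).symm.trans ((congrArg G this).trans (hs j))), by
    rintro ⟨t, ht⟩
    rcases hGt : G t with a | j
    · simp [p, hGt] at ht
    · exact ⟨j, Subtype.ext (hs' j t hGt).symm⟩⟩
  let e₂ := (Fintype.equivFin {t // p t}).symm
  refine ⟨_, (e₂.sumCongr e₁).trans (Equiv.sumCompl p), fun i => (G (e₂ i)).getLeft (e₂ i).2, ?_⟩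
  rintro (i | j)
  · exact (Sum.inl_getLeft _ (e₂ i).2).symm
  · exact hs j

section Value

variable {C : Type u} [Category.{v} C] [MonoidalCategory C] [SymmetricCategory C]
  {A : C} [MonObj A]

theorem Mono.exists_boxAll_split (d : XCData C) {N k : ℕ} {P : Type} (G : Fin N → P ⊕ Fin k)
    (h : ∀ j, ∃! t, G t = Sum.inr j) :
    ∃ (N' : ℕ) (g : Fin N' → P) (H : tpow A N' ⊗ tpow A k ⟶ tpow A N),
      ∀ {ν : Type} (f : P → Mono d ν A) (a : Fin k → Mono d ν A),
        Mono.boxAll (fun t => Sum.elim f a (G t)) =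
          Mono.post H (Mono.box (Mono.boxAll fun t => f (g t)) (Mono.boxAll a)) := by
  obtain ⟨N', e, g, he⟩ := exists_split G h
  have hN : N' + k = N := by simpa using Fintype.card_congr e
  subst hN
  let σ : Equiv.Perm (Fin (N' + k)) := finSumFinEquiv.symm.trans e
  refine ⟨N', g, (tpowAdd A N' k).hom ≫ permMap A σ, fun f a => ?_⟩
  rw [← Mono.post_post, Mono.post_tpowAdd, Mono.post_permMap]
  congr 1
  funext t
  obtain ⟨t, rfl⟩ := σ.surjective t
  have h1 : (⇑σ⁻¹) (σ t) = t := σ.symm_apply_apply t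
  rw [Function.comp_apply, h1]
  refine Fin.addCases (fun i => ?_) (fun i => ?_) t
  · have : σ (Fin.castAdd k i) = e (Sum.inl i) := by simp [σ]
    rw [this, he, Fin.addCases_left]
    rfl
  · have : σ (Fin.natAdd N' i) = e (Sum.inr i) := by simp [σ]
    rw [this, he, Fin.addCases_right]
    rfl

namespace Context

variable {n k : ℕ}

theorem exists_pieces (d : XCData C) (c : Context n k) :
    ∃ (N : ℕ) (G : Fin N → (SignType ⊕ Vtx c.X) ⊕ Fin k) (B : tpow A N ⟶ tpow A n),
      ∀ {ν : Type} (f : SignType ⊕ Vtx c.X → Mono d ν A) (a : Fin k → Mono d ν A),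
        Mono.boxAll (fun i => (c.strand i).ev (Sum.elim (f ∘ Sum.inl) a) (f ∘ Sum.inr)) =
          Mono.post B (Mono.boxAll fun t => Sum.elim f a (G t)) := by
  let conv : (SignType ⊕ Fin k) ⊕ Vtx c.X → (SignType ⊕ Vtx c.X) ⊕ Fin k :=
    Sum.elim (Sum.elim (Sum.inl ∘ Sum.inl) Sum.inr) (Sum.inl ∘ Sum.inr)
  obtain ⟨G, hG⟩ := exists_blockFun (fun i => (c.strand i).pieces.length)
    fun i j => conv ((c.strand i).pieces.get j)
  refine ⟨_, G, blockMul μ[A] η[A] _, fun f a => ?_⟩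
  rw [Mono.post_blockMul]
  congr 1
  funext i
  rw [EPath.ev_eq_prod]
  congr 1
  refine Eq.trans ?_ (congrArg List.ofFn (funext fun j => congrArg _ (hG i j).symm))
  have : Sum.elim (Sum.elim (f ∘ Sum.inl) a) (f ∘ Sum.inr) = Sum.elim f a ∘ conv := by
    funext x
    rcases x with (x | x) | x <;> rfl
  rw [this]
  have h2 := List.map_ofFn (f := fun j => (c.strand i).pieces.get j) (g := Sum.elim f a ∘ conv)
  rw [List.ofFn_get] at h2
  exact h2

variable (S : XCStructure A)

theorem strandVal_fill (L : Picture k) {X : Type} (p : EPath (SignType ⊕ Fin k) (Vtx X)) :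
    strandVal S (L.fill p) = p.ev (Sum.elim (rotVal S _) fun j => strandVal S ((L.arc j).rename Sum.inr))
      (vtxVal S ∘ Vtx.map Sum.inl) := by
  rw [strandVal, Picture.fill, EPath.ev_bind, EPath.rename, EPath.ev_mapV]
  congr 1
  funext e
  rcases e with e | j
  · exact EPath.ev_edge _ _ _
  · rfl

theorem Fills.finite {c : Context n k} {L : Picture k} {D : XCDiagram n} (h : c.Fills L D) :
    Finite c.X ∧ Finite L.X := by
  obtain ⟨e, -⟩ := h
  have := D.finite
  have := Finite.of_equiv _ e.symm
  exact ⟨Finite.of_injective (Sum.inl : _ → c.X ⊕ L.X) Sum.inl_injective,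
    Finite.of_injective (Sum.inr : _ → c.X ⊕ L.X) Sum.inr_injective⟩

theorem Fills.once {c : Context n k} {L : Picture k} {D : XCDiagram n} (h : c.Fills L D)
    (x : c.X ⊕ L.X) (o : Bool) : ∑ i, (L.fill (c.strand i)).count (Vtx.cross x o) = 1 := by
  obtain ⟨e, -, -, h3, -⟩ := h
  rw [← D.once (e x) o]
  refine Finset.sum_congr rfl fun i _ => ?_
  rw [h3, EPath.count_rename _ e.injective]

theorem Fills.val_eq {c : Context n k} {L : Picture k} {D : XCDiagram n} (h : c.Fills L D) {u}
    (hu : Pairs (crossPts S (Sum.elim c.sign L.sign)) (strandsVal S fun i => L.fill (c.strand i)) u) :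
    D.val S = u := by
  obtain ⟨e, h1, h2, h3, -⟩ := h
  refine D.val_eq_of_equiv S e ?_ h3 hu
  rintro (x | x)
  · exact h1 x
  · exact h2 x

open Classical in
/-- If an arc of the picture has a crossing, then it is inserted exactly once. -/
theorem Fills.existsUnique {c : Context n k} {L : Picture k} {D : XCDiagram n} (h : c.Fills L D)
    {N : ℕ} {G : Fin N → (SignType ⊕ Vtx c.X) ⊕ Fin k} {B : tpow A N ⟶ tpow A n}
    (hG : ∀ {ν : Type} (f : SignType ⊕ Vtx c.X → Mono S.data ν A) (a : Fin k → Mono S.data ν A),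
        Mono.boxAll (fun i => (c.strand i).ev (Sum.elim (f ∘ Sum.inl) a) (f ∘ Sum.inr)) =
          Mono.post B (Mono.boxAll fun t => Sum.elim f a (G t)))
    {j : Fin k} {x : L.X} {o : Bool}
    (hj : ∀ j', (L.arc j').count (Vtx.cross x o) = if j' = j then 1 else 0) :
    ∃! t, G t = Sum.inr j := by
  have h1 := count_names_strandsVal S (fun i => L.fill (c.strand i)) (Sum.inr x) o
  rw [h.once, strandsVal] at h1
  simp only [strandVal_fill] at h1
  have h2 := hG (Sum.elim (rotVal S _) (vtxVal S ∘ Vtx.map (Sum.inl : _ → c.X ⊕ L.X)))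
    (fun j => strandVal S ((L.arc j).rename Sum.inr))
  rw [Sum.elim_comp_inl, Sum.elim_comp_inr] at h2
  rw [h2, Mono.names_post, Mono.names_boxAll, Multiset.count_sum'] at h1
  have h3 : ∀ t, Multiset.count ((Sum.inr x : c.X ⊕ L.X), o)
      ((Sum.elim (Sum.elim (rotVal S _) (vtxVal S ∘ Vtx.map (Sum.inl : _ → c.X ⊕ L.X)))
        (fun j => strandVal S ((L.arc j).rename Sum.inr)) (G t)).names) =
      if G t = Sum.inr j then 1 else 0 := by
    intro t
    rcases hGt : G t with (s | v) | j'
    · rfl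
    · cases v with
      | bi => rfl
      | cross y o' =>
        have : Multiset.count ((Sum.inr x : c.X ⊕ L.X), o)
            {((Sum.inl y : c.X ⊕ L.X), o')} = 0 := by simp
        refine Eq.trans this ?_
        simp
    · rw [Sum.elim_inr, count_names_strandVal, EPath.count_rename _ Sum.inr_injective, hj]
      simp
  simp only [h3, Finset.sum_boole, Nat.cast_id] at h1
  obtain ⟨t, ht⟩ := Finset.card_eq_one.mp h1
  refine ⟨t, ?_, fun t' ht' => ?_⟩
  · have : t ∈ ({t} : Finset (Fin N)) := Finset.mem_singleton_self t
    rw [← ht] at this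
    exact (Finset.mem_filter.mp this).2
  · have : t' ∈ Finset.univ.filter fun t => G t = Sum.inr j := by simpa using ht'
    rw [ht] at this
    exact Finset.mem_singleton.mp this

open Classical in
/-- Two pictures with the same value may be exchanged if each arc of the first one has a
crossing. -/
theorem Fills.val_eq_val {c : Context n k} {L R : Picture k} {D D' : XCDiagram n}
    (hL : c.Fills L D) (hR : c.Fills R D') {u : 𝟙_ C ⟶ tpow A k}
    (huL : Pairs (crossPts S L.sign) (strandsVal S L.arc) u)
    (huR : Pairs (crossPts S R.sign) (strandsVal S R.arc) u)
    (hj : ∀ j, ∃ (x : L.X) (o : Bool),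
      ∀ j', (L.arc j').count (Vtx.cross x o) = if j' = j then 1 else 0) :
    D.val S = D'.val S := by
  obtain ⟨N, G, B, hG⟩ := exists_pieces (A := A) S.data c
  obtain ⟨N', g, H, hH⟩ := Mono.exists_boxAll_split (A := A) S.data G fun j =>
    have ⟨x, o, hj⟩ := hj j
    hL.existsUnique S hG hj
  have fin := hL.finite
  have := fin.1
  have := fin.2
  have key : ∀ L : Picture k, strandsVal S (fun i => L.fill (c.strand i)) =
      Mono.post (H ≫ B) (Mono.box
        ((Mono.boxAll fun t => (Sum.elim (rotVal S _) (vtxVal S) (g t))).map (Prod.map Sum.inl id))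
        ((strandsVal S L.arc).map (Prod.map Sum.inr id))) := by
    intro L
    rw [map_strandsVal, strandsVal]
    simp only [strandVal_fill]
    have h2 := hG (Sum.elim (rotVal S _) (vtxVal S ∘ Vtx.map (Sum.inl : _ → c.X ⊕ L.X)))
      (fun j => strandVal S ((L.arc j).rename Sum.inr))
    rw [Sum.elim_comp_inl, Sum.elim_comp_inr] at h2
    rw [h2, hH, Mono.post_post, Mono.map_boxAll]
    congr 3
    funext t
    rcases g t with s | v
    · rfl
    · cases v <;> rfl
  have hc : ∃ uc, Pairs (crossPts S c.sign)
      (Mono.boxAll fun t => (Sum.elim (rotVal S _) (vtxVal S) (g t))) uc := by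
    refine Pairs.exists_of_names (Multiplicative.toAdd.injective ?_)
    ext ⟨x, o⟩
    rw [count_names_crossPts, toAdd_ofAdd]
    have h1 := count_names_strandsVal S (fun i => L.fill (c.strand i)) (Sum.inl x) o
    rw [hL.once, key, Mono.names_post, Mono.names_box, Mono.names_map, Mono.names_map,
      Multiset.count_add] at h1
    have h2 : Multiset.count ((Sum.inl x : c.X ⊕ L.X), o)
        (Multiset.map (Prod.map Sum.inr id) (strandsVal S L.arc).names) = 0 := by
      refine Multiset.count_eq_zero_of_notMem ?_
      simp
    have inj : Function.Injective (Prod.map (Sum.inl : c.X → c.X ⊕ L.X) (id : Bool → Bool)) :=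
      Sum.inl_injective.prodMap Function.injective_id
    rw [h2, add_zero] at h1
    exact h1.symm.trans (Multiset.count_map_eq_count' _ _ inj (x, o))
  obtain ⟨uc, hc⟩ := hc
  have final : ∀ {L : Picture k} {D : XCDiagram n}, c.Fills L D →
      Pairs (crossPts S L.sign) (strandsVal S L.arc) u → D.val S = ptensor uc u ≫ H ≫ B := by
    intro L D h hu
    have := h.finite.2
    refine h.val_eq S ?_
    rw [crossPts_sum, key]
    exact ((hc.map _).box (hu.map _)).post _
  rw [final hL huL, final hR huR]

/-- Two pictures without crossings whose arcs have the same values may be exchanged. -/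
theorem Fills.val_eq_val_of_arc {c : Context n k} {X : Type} {sign : X → Bool}
    {l r : Fin k → Strand X} {D D' : XCDiagram n}
    (hL : c.Fills ⟨X, sign, l⟩ D) (hR : c.Fills ⟨X, sign, r⟩ D')
    (h : ∀ j, strandVal S (l j) = strandVal S (r j)) : D.val S = D'.val S := by
  have key : strandsVal S (fun i => (⟨X, sign, l⟩ : Picture k).fill (c.strand i)) =
      strandsVal S (fun i => (⟨X, sign, r⟩ : Picture k).fill (c.strand i)) := by
    refine congrArg Mono.boxAll (funext fun i => ?_)
    refine (strandVal_fill S ⟨X, sign, l⟩ _).trans (Eq.trans ?_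
      (strandVal_fill S ⟨X, sign, r⟩ _).symm)
    refine congrArg (fun w => EPath.ev (Sum.elim _ w) _ (c.strand i)) (funext fun j => ?_)
    exact (map_strandVal S Sum.inr (l j)).symm.trans
      ((congrArg _ (h j)).trans (map_strandVal S Sum.inr (r j)))
  have fin := hL.finite
  have := fin.1
  have : Finite X := fin.2
  obtain ⟨u, hu⟩ := Pairs.exists_of_names (names_crossPts_eq S hL.once (Sum.elim c.sign sign))
  have e := hL.val_eq S hu
  rw [key] at hu
  rw [e, hR.val_eq S hu]

end Context

end Value

end XCT

namespace XCT

open Presented (evalObj)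
open scoped MonObj

/-! ### The values of diagrams are invariant under the moves -/

section Moves

variable {C : Type u} [Category.{v} C] [MonoidalCategory C] [SymmetricCategory C]
  {A : C} [MonObj A] (S : XCStructure A)

namespace Mono

variable {d : XCData C} {ν : Type}

theorem boxAll_singleton_injective {ξ ζ : Mono d ν A} (h : boxAll ![ξ] = boxAll ![ζ]) : ξ = ζ := by
  rw [← post_toPow1, ← post_toPow1] at h
  have := congrArg (post (λ_ A).hom) h
  rwa [post_post, post_post, toPow1, Iso.inv_hom_id, post_id, post_id] at this

theorem pt_mul_pt_eq_one {a b : 𝟙_ C ⟶ A}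
    (h : dot μ[A] (a ≫ toPow1 A) (b ≫ toPow1 A) = unitPow η[A] 1) :
    (pt a : Mono d ν A) * pt b = 1 := by
  refine boxAll_singleton_injective ?_
  have h1 := post_mulPow_mul (d := d) (ν := ν) ![pt a] ![pt b]
  rw [← post_toPow1, ← post_toPow1, post_pt, post_pt, box_pt_pt, post_pt] at h1
  have h2 : pt (dot μ[A] (a ≫ toPow1 A) (b ≫ toPow1 A)) = boxAll fun _ : Fin 1 => (1 : Mono d ν A) := by
    rw [h, boxAll_one]
  refine Eq.trans (congrArg boxAll ?_) (h1.symm.trans (h2.trans (congrArg boxAll ?_))) <;>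
    exact funext fun i => by fin_cases i; rfl

end Mono

/-! #### Points of tensor powers with given legs -/

variable {ν : Type}

theorem post_i31 (ξ : Mono S.data ν A) : ξ.post S.data.i31 = Mono.boxAll ![ξ, 1, 1] :=
  (Mono.post_placeAt _ ξ 0 2).trans (congrArg Mono.boxAll (funext fun i => by fin_cases i <;> rfl))

theorem post_i32 (ξ : Mono S.data ν A) : ξ.post S.data.i32 = Mono.boxAll ![1, ξ, 1] :=
  (Mono.post_placeAt _ ξ 1 1).trans (congrArg Mono.boxAll (funext fun i => by fin_cases i <;> rfl))

theorem post_i33 (ξ : Mono S.data ν A) : ξ.post S.data.i33 = Mono.boxAll ![1, 1, ξ] :=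
  (Mono.post_placeAt _ ξ 2 0).trans (congrArg Mono.boxAll (funext fun i => by fin_cases i <;> rfl))

theorem post_i51 (ξ : Mono S.data ν A) : ξ.post S.data.i51 = Mono.boxAll ![ξ, 1, 1, 1, 1] :=
  (Mono.post_placeAt _ ξ 0 4).trans (congrArg Mono.boxAll (funext fun i => by fin_cases i <;> rfl))

theorem post_i52 (ξ : Mono S.data ν A) : ξ.post S.data.i52 = Mono.boxAll ![1, ξ, 1, 1, 1] :=
  (Mono.post_placeAt _ ξ 1 3).trans (congrArg Mono.boxAll (funext fun i => by fin_cases i <;> rfl))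

theorem post_i53 (ξ : Mono S.data ν A) : ξ.post S.data.i53 = Mono.boxAll ![1, 1, ξ, 1, 1] :=
  (Mono.post_placeAt _ ξ 2 2).trans (congrArg Mono.boxAll (funext fun i => by fin_cases i <;> rfl))

theorem post_i54 (ξ : Mono S.data ν A) : ξ.post S.data.i54 = Mono.boxAll ![1, 1, 1, ξ, 1] :=
  (Mono.post_placeAt _ ξ 3 1).trans (congrArg Mono.boxAll (funext fun i => by fin_cases i <;> rfl))

theorem post_i55 (ξ : Mono S.data ν A) : ξ.post S.data.i55 = Mono.boxAll ![1, 1, 1, 1, ξ] :=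
  (Mono.post_placeAt _ ξ 4 0).trans (congrArg Mono.boxAll (funext fun i => by fin_cases i <;> rfl))

variable {X : Type}

theorem pairs_legs (x : X) (ε : Bool) {n : ℕ} {p q : A ⟶ tpow A n}
    {a b : Fin n → Mono S.data (X × Bool) A}
    (hp : (passVal S x true).post p = Mono.boxAll a)
    (hq : (passVal S x false).post q = Mono.boxAll b) :
    Pairs (crossPt S x ε) (Mono.boxAll fun i => a i * b i)
      (S.data.legs (cond ε S.R S.Rinv) p q) := by
  have := (pairs_crossPt S x ε).post ((p ⊗ₘ q) ≫ mulPow μ[A] n)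
  rw [← Mono.post_post, ← Mono.box_post_post, hp, hq, Mono.post_mulPow_mul] at this
  exact this

theorem pairs_toPow2 (x : X) (ε : Bool) :
    Pairs (crossPt S x ε) (Mono.boxAll ![passVal S x true, passVal S x false])
      (cond ε S.R S.Rinv ≫ toPow2 A) := by
  rw [← Mono.post_toPow2]
  exact (pairs_crossPt S x ε).post _

theorem pairs_pt {n : ℕ} {y : 𝟙_ C ⟶ A} {p : A ⟶ tpow A n} {a : Fin n → Mono S.data ν A}
    (hp : (Mono.pt y).post p = Mono.boxAll a) : Pairs 1 (Mono.boxAll a) (y ≫ p) := by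
  rw [← hp]
  exact (Pairs.pt y).post p

theorem pairs_pt_pt (y z : 𝟙_ C ⟶ A) :
    Pairs 1 (Mono.boxAll ![(Mono.pt y : Mono S.data ν A), Mono.pt z]) (ptensor y z ≫ toPow2 A) := by
  have := ((Pairs.pt (d := S.data) (ν := ν) y).box (Pairs.pt z)).post (toPow2 A)
  rwa [Mono.post_toPow2, mul_one] at this

theorem crossPts_unit (sign : Unit → Bool) : crossPts S sign = crossPt S () (sign ()) :=
  finprod_unique _

theorem crossPts_bool (sign : Bool → Bool) :
    crossPts S sign = crossPt S true (sign true) * crossPt S false (sign false) := by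
  rw [crossPts, finprod_eq_prod_of_fintype, Fintype.prod_bool]

theorem crossPts_three (sign : Fin 3 → Bool) : crossPts S sign =
    crossPt S 0 (sign 0) * crossPt S 1 (sign 1) * crossPt S 2 (sign 2) := by
  rw [crossPts, finprod_eq_prod_of_fintype, Fin.prod_univ_three]

theorem rotVal_one : rotVal S ν 1 = Mono.pt S.κinv := rfl

theorem rotVal_neg_one : rotVal S ν (-1) = Mono.pt S.κ := rfl

theorem rotVal_mul {i j k : SignType} (h : (i : ℤ) + (j : ℤ) = (k : ℤ)) :
    rotVal S ν j * rotVal S ν i = rotVal S ν k := by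
  have h1 : (Mono.pt S.κ : Mono S.data ν A) * Mono.pt S.κinv = 1 :=
    Mono.pt_mul_pt_eq_one (S.eqn .κ_mul_inv)
  have h2 : (Mono.pt S.κinv : Mono S.data ν A) * Mono.pt S.κ = 1 :=
    Mono.pt_mul_pt_eq_one (S.eqn .κ_inv_mul)
  have h0 : rotVal S ν SignType.zero = 1 := rfl
  have hp : rotVal S ν SignType.pos = Mono.pt S.κinv := rfl
  have hn : rotVal S ν SignType.neg = Mono.pt S.κ := rfl
  cases i <;> cases j <;> cases k <;>
    first
    | exact absurd h (by decide)
    | simp only [h0, hp, hn, h1, h2, one_mul, mul_one]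

theorem strandVal_nil (h : SignType) : strandVal S (⟨h, []⟩ : Strand X) = rotVal S _ h := one_mul _

theorem strandVal_cons (h : SignType) (v : Vtx X) (e : SignType) (t : List (Vtx X × SignType)) :
    strandVal S ⟨h, (v, e) :: t⟩ = strandVal S ⟨e, t⟩ * vtxVal S v * rotVal S _ h := by
  simp only [strandVal, EPath.ev, EPath.evTail, mul_assoc]

theorem vtxVal_o (x : X) : vtxVal S (Vtx.o x) = passVal S x true := rfl

theorem vtxVal_u (x : X) : vtxVal S (Vtx.u x) = passVal S x false := rfl

theorem Pairs.of_eq {τ τ' : Pt S.data ν} {n : ℕ} {a b : Fin n → Mono S.data ν A}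
    {y : 𝟙_ C ⟶ tpow A n} (h : Pairs τ (Mono.boxAll a) y) (h1 : τ = τ') (h2 : ∀ i, a i = b i) :
    Pairs τ' (Mono.boxAll b) y := by
  rw [← h1, ← funext h2]
  exact h

theorem Pairs.strandsVal_of_eq {τ τ' : Pt S.data (X × Bool)} {n : ℕ}
    {a : Fin n → Mono S.data (X × Bool) A} {p : Fin n → Strand X} {y : 𝟙_ C ⟶ tpow A n}
    (h : Pairs τ (Mono.boxAll a) y) (h1 : τ = τ') (h2 : ∀ i, a i = strandVal S (p i)) :
    Pairs τ' (strandsVal S p) y :=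
  h.of_eq S h1 h2

/-- The values of both sides of the moves agree. -/
theorem XCMove.exists_pairs {k : ℕ} {L R : Picture k} (h : XCMove L R) :
    ((∃ (X : Type) (s : X → Bool) (l r : Fin k → Strand X), L = ⟨X, s, l⟩ ∧ R = ⟨X, s, r⟩ ∧
      ∀ j, strandVal S (l j) = strandVal S (r j)) ∨
    ((∃ u, Pairs (crossPts S L.sign) (strandsVal S L.arc) u ∧
        Pairs (crossPts S R.sign) (strandsVal S R.arc) u) ∧
      ∀ j, ∃ (x : L.X) (o : Bool),
        ∀ j', (L.arc j').count (Vtx.cross x o) = if j' = j then 1 else 0)) := by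
  cases h with
  | r0r i j k h =>
    refine .inl ⟨_, _, _, _, rfl, rfl, fun t => ?_⟩
    fin_cases t
    have := rotVal_mul S (ν := Empty × Bool) h
    simpa [strandVal, EPath.ev, EPath.evTail, vtxVal] using this
  | r0 ε =>
    refine .inr ⟨⟨cond ε S.R S.Rinv ≫ toPow2 A, ?_, ?_⟩, fun j => ?_⟩
    · refine (pairs_toPow2 S () ε).strandsVal_of_eq S (crossPts_unit S fun _ => ε).symm fun i => ?_
      fin_cases i <;> simp [strandVal_nil, strandVal_cons, vtxVal_o, vtxVal_u, rotVal_zero]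
    · have e : cond ε S.R S.Rinv ≫ toPow2 A =
          dot μ[A] (dot μ[A] (ptensor S.κ S.κ ≫ toPow2 A) (cond ε S.R S.Rinv ≫ toPow2 A))
            (ptensor S.κinv S.κinv ≫ toPow2 A) := by
        cases ε
        · exact S.eqn .xc0inv
        · exact S.eqn .xc0
      rw [e]
      refine (((pairs_pt_pt S S.κ S.κ).dot (pairs_toPow2 S () ε)).dot
        (pairs_pt_pt S S.κinv S.κinv)).strandsVal_of_eq S ?_ fun i => ?_
      · rw [one_mul, mul_one]; exact (crossPts_unit S fun _ => ε).symm
      · fin_cases i <;>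
          simp [strandVal_nil, strandVal_cons, vtxVal_o, vtxVal_u, rotVal_one, rotVal_neg_one]
    · refine ⟨(), j = 0, fun j' => ?_⟩
      fin_cases j <;> fin_cases j' <;> simp [EPath.count, Vtx.o, Vtx.u]
  | r1f =>
    refine .inr ⟨⟨dot μ[A] (S.data.legs S.R S.data.i33 S.data.i31) (S.κ ≫ S.data.i32) ≫
      iterMul μ[A] η[A] 3 ≫ toPow1 A, ?_, ?_⟩, fun j => ⟨(), true, fun j' => ?_⟩⟩
    · have := (((pairs_legs S () true (post_i33 S _) (post_i31 S _)).dot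
        (pairs_pt S (post_i32 S (.pt S.κ)))).post (iterMul μ[A] η[A] 3)).post (toPow1 A)
      rw [Mono.post_iterMul, Mono.post_toPow1, Category.assoc] at this
      refine this.strandsVal_of_eq S ((mul_one _).trans (crossPts_unit S fun _ => true).symm) fun i => ?_
      fin_cases i
      simp [strandVal_nil, strandVal_cons, vtxVal_o, vtxVal_u, rotVal_zero, rotVal_neg_one,
        mul_assoc]
    · have e : dot μ[A] (S.data.legs S.R S.data.i33 S.data.i31) (S.κ ≫ S.data.i32) ≫
          iterMul μ[A] η[A] 3 =
          dot μ[A] (S.data.legs S.R S.data.i31 S.data.i33) (S.κinv ≫ S.data.i32) ≫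
          iterMul μ[A] η[A] 3 := S.eqn .xc1f
      rw [← Category.assoc, e]
      have := (((pairs_legs S () true (post_i31 S _) (post_i33 S _)).dot
        (pairs_pt S (post_i32 S (.pt S.κinv)))).post (iterMul μ[A] η[A] 3)).post (toPow1 A)
      rw [Mono.post_iterMul, Mono.post_toPow1] at this
      refine this.strandsVal_of_eq S ((mul_one _).trans (crossPts_unit S fun _ => true).symm) fun i => ?_
      fin_cases i
      simp [strandVal_nil, strandVal_cons, vtxVal_o, vtxVal_u, rotVal_zero, rotVal_one,
        mul_assoc]
    · fin_cases j; fin_cases j'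
      simp [EPath.count, Vtx.o, Vtx.u]
  | r2ab ε =>
    refine .inr ⟨⟨unitPow η[A] 2, ?_, ?_⟩, fun j => ⟨true, j = 0, fun j' => ?_⟩⟩
    · have e : unitPow η[A] 2 = dot μ[A] (cond (!ε) S.R S.Rinv ≫ toPow2 A)
          (cond ε S.R S.Rinv ≫ toPow2 A) := by
        cases ε
        · exact (S.eqn .R_mul_inv).symm
        · exact (S.eqn .R_inv_mul).symm
      rw [e]
      refine ((pairs_toPow2 S false (!ε)).dot (pairs_toPow2 S true ε)).strandsVal_of_eq S
        ((mul_comm _ _).trans (crossPts_bool S fun x => cond x ε !ε).symm) fun i => ?_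
      fin_cases i <;> simp [strandVal_nil, strandVal_cons, vtxVal_o, vtxVal_u, rotVal_zero]
    · have := Pairs.pt (d := S.data) (ν := Empty × Bool) (unitPow η[A] 2)
      rw [← Mono.boxAll_one] at this
      refine this.strandsVal_of_eq S (crossPts_empty S _).symm fun i => ?_
      fin_cases i <;> simp [strandVal_nil, rotVal_zero]
    · fin_cases j <;> fin_cases j' <;> simp [EPath.count, Vtx.o, Vtx.u]
  | r2c =>
    refine .inr ⟨⟨ptensor η[A] S.κinv ≫ toPow2 A, ?_, ?_⟩, fun j => ⟨true, j = 0, fun j' => ?_⟩⟩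
    · have e : ptensor η[A] S.κinv = dot μ[A] (dot μ[A] (S.data.legs S.R S.data.i51 S.data.i55)
          (S.data.legs S.Rinv S.data.i52 S.data.i53)) (S.κinv ≫ S.data.i54) ≫
        (tpowAdd A 2 3).inv ≫ (iterMul μ[A] η[A] 2 ⊗ₘ iterMul μ[A] η[A] 3) := S.eqn .xc2c
      rw [e]
      have := ((((pairs_legs S true true (post_i51 S _) (post_i55 S _)).dot
        (pairs_legs S false false (post_i52 S _) (post_i53 S _))).dot
        (pairs_pt S (post_i54 S (.pt S.κinv)))).post ((tpowAdd A 2 3).inv ≫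
          (iterMul μ[A] η[A] 2 ⊗ₘ iterMul μ[A] η[A] 3))).post (toPow2 A)
      rw [← Mono.post_post, Mono.post_tpowAdd_inv, ← Mono.box_post_post, Mono.post_iterMul,
        Mono.post_iterMul, Mono.post_toPow2] at this
      refine this.strandsVal_of_eq S ((mul_one _).trans (crossPts_bool S fun x => x).symm) fun i => ?_
      fin_cases i <;> simp [strandVal_nil, strandVal_cons, vtxVal_o, vtxVal_u, rotVal_zero,
        rotVal_one, mul_assoc, Fin.natAdd, Fin.castAdd]
    · refine (pairs_pt_pt S _ _).strandsVal_of_eq S (crossPts_empty S _).symm fun i => ?_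
      fin_cases i
      · exact (strandVal_nil S (X := Empty) 0).symm
      · exact (strandVal_nil S (X := Empty) 1).symm
    · fin_cases j <;> fin_cases j' <;> simp [EPath.count, Vtx.o, Vtx.u]
  | r2d =>
    refine .inr ⟨⟨ptensor S.κ η[A] ≫ toPow2 A, ?_, ?_⟩, fun j => ⟨true, j = 0, fun j' => ?_⟩⟩
    · have e : ptensor S.κ η[A] = dot μ[A] (dot μ[A] (S.data.legs S.Rinv S.data.i51 S.data.i55)
          (S.data.legs S.R S.data.i53 S.data.i54)) (S.κ ≫ S.data.i52) ≫
        (tpowAdd A 3 2).inv ≫ (iterMul μ[A] η[A] 3 ⊗ₘ iterMul μ[A] η[A] 2) := S.eqn .xc2d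
      rw [e]
      have := ((((pairs_legs S false false (post_i51 S _) (post_i55 S _)).dot
        (pairs_legs S true true (post_i53 S _) (post_i54 S _))).dot
        (pairs_pt S (post_i52 S (.pt S.κ)))).post ((tpowAdd A 3 2).inv ≫
          (iterMul μ[A] η[A] 3 ⊗ₘ iterMul μ[A] η[A] 2))).post (toPow2 A)
      rw [← Mono.post_post, Mono.post_tpowAdd_inv, ← Mono.box_post_post, Mono.post_iterMul,
        Mono.post_iterMul, Mono.post_toPow2] at this
      refine this.strandsVal_of_eq S
        (((mul_one _).trans (mul_comm _ _)).trans (crossPts_bool S fun x => x).symm) fun i => ?_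
      fin_cases i <;> simp [strandVal_nil, strandVal_cons, vtxVal_o, vtxVal_u, rotVal_zero,
        rotVal_neg_one, mul_assoc, Fin.natAdd, Fin.castAdd]
    · refine (pairs_pt_pt S _ _).strandsVal_of_eq S (crossPts_empty S _).symm fun i => ?_
      fin_cases i
      · exact (strandVal_nil S (X := Empty) (-1)).symm
      · exact (strandVal_nil S (X := Empty) 0).symm
    · fin_cases j <;> fin_cases j' <;> simp [EPath.count, Vtx.o, Vtx.u]
  | r3 =>
    refine .inr ⟨⟨dot μ[A] (dot μ[A] (S.data.legs S.R S.data.i31 S.data.i32)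
      (S.data.legs S.R S.data.i31 S.data.i33)) (S.data.legs S.R S.data.i32 S.data.i33), ?_, ?_⟩,
      fun j => ⟨![0, 0, 1] j, ![true, false, false] j, fun j' => ?_⟩⟩
    · refine (((pairs_legs S 0 true (post_i31 S _) (post_i32 S _)).dot
        (pairs_legs S 1 true (post_i31 S _) (post_i33 S _))).dot
        (pairs_legs S 2 true (post_i32 S _) (post_i33 S _))).strandsVal_of_eq S
        (crossPts_three S fun _ => true).symm fun i => ?_
      fin_cases i <;> simp [strandVal_nil, strandVal_cons, vtxVal_o, vtxVal_u, rotVal_zero]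
    · have e : dot μ[A] (dot μ[A] (S.data.legs S.R S.data.i31 S.data.i32)
          (S.data.legs S.R S.data.i31 S.data.i33)) (S.data.legs S.R S.data.i32 S.data.i33) =
        dot μ[A] (dot μ[A] (S.data.legs S.R S.data.i32 S.data.i33)
          (S.data.legs S.R S.data.i31 S.data.i33)) (S.data.legs S.R S.data.i31 S.data.i32) :=
        S.eqn .xc3
      rw [e]
      refine (((pairs_legs S 2 true (post_i32 S _) (post_i33 S _)).dot
        (pairs_legs S 1 true (post_i31 S _) (post_i33 S _))).dot
        (pairs_legs S 0 true (post_i31 S _) (post_i32 S _))).strandsVal_of_eq S ?_ fun i => ?_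
      · exact ((mul_comm _ _).trans ((congrArg _ (mul_comm _ _)).trans (mul_assoc _ _ _).symm)).trans
          (crossPts_three S fun _ => true).symm
      · fin_cases i <;> simp [strandVal_nil, strandVal_cons, vtxVal_o, vtxVal_u, rotVal_zero]
    · fin_cases j <;> fin_cases j' <;> simp [EPath.count, Vtx.o, Vtx.u]

theorem Step.val_eq {n : ℕ} {D D' : XCDiagram n} (h : Step D D') : D.val S = D'.val S := by
  cases h with
  | iso e h1 h2 h3 => exact (XCDiagram.val_iso S e h1 h2).symm
  | move h c hL hR =>
    rcases h.exists_pairs S with ⟨X, s, l, r, rfl, rfl, hj⟩ | ⟨⟨u, hl, hr⟩, hj⟩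
    · exact hL.val_eq_val_of_arc S hR hj
    · exact hL.val_eq_val S hR hl hr hj

end Moves

end XCT

namespace XCT

/-! ### Tangles are generated by the crossings and the edges -/

namespace EPath

variable {X : Type}

theorem count_bind_congr {E E' V : Type} (u : V) {F F' : E → EPath E' V}
    (h : ∀ e, (F e).count u = (F' e).count u) (p : EPath E V) :
    (p.bind F).count u = (p.bind F').count u := by
  obtain ⟨e, t⟩ := p
  simp only [count, bind, List.countP_append] at h ⊢
  rw [h]
  congr 1
  induction t with
  | nil => rfl
  | cons a t ih => simp only [List.flatMap_cons, List.countP_append, ih, List.countP_cons, h]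

/-- Two strands that differ by one application of the move `Ω0r`. -/
def RotStep (p q : Strand X) : Prop :=
  ∃ (c : EPath (SignType ⊕ Fin 1) (Vtx X)) (i j k : SignType) (_ : (i : ℤ) + (j : ℤ) = (k : ℤ)),
    p = (Picture.fill ⟨Empty, Empty.elim, ![⟨i, [(Vtx.bi, j)]⟩]⟩ c).rename (Equiv.sumEmpty X Empty) ∧
    q = (Picture.fill ⟨Empty, Empty.elim, ![⟨k, []⟩]⟩ c).rename (Equiv.sumEmpty X Empty)

/-- Two strands that differ by applications of the move `Ω0r`. -/
def RotEq (p q : Strand X) : Prop := Relation.EqvGen RotStep p q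

theorem RotStep.count_eq {p q : Strand X} (h : RotStep p q) (x : X) (o : Bool) :
    p.count (Vtx.cross x o) = q.count (Vtx.cross x o) := by
  obtain ⟨c, i, j, k, -, rfl, rfl⟩ := h
  have e : ∀ p : Strand (X ⊕ Empty), (p.rename (Equiv.sumEmpty X Empty)).count (Vtx.cross x o) =
      p.count (Vtx.cross (Sum.inl x) o) :=
    count_rename _ (Equiv.sumEmpty X Empty).injective (Sum.inl x) o
  rw [e, e]
  refine count_bind_congr _ (fun s => ?_) _
  rcases s with s | a
  · rfl
  · fin_cases a
    simp [count, rename, mapV, Vtx.map]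

theorem RotEq.symm {p q : Strand X} (h : RotEq p q) : RotEq q p := Relation.EqvGen.symm _ _ h

theorem RotEq.trans {p q r : Strand X} (h : RotEq p q) (h' : RotEq q r) : RotEq p r :=
  Relation.EqvGen.trans _ _ _ h h'

theorem RotEq.count_eq {p q : Strand X} (h : RotEq p q) (x : X) (o : Bool) :
    p.count (Vtx.cross x o) = q.count (Vtx.cross x o) := by
  induction h with
  | rel _ _ h => exact h.count_eq x o
  | refl => rfl
  | symm _ _ _ ih => exact ih.symm
  | trans _ _ _ _ _ ih ih' => exact ih.trans ih'

theorem rename_fill_glue (a : Fin 1 → Strand Empty) (v : Vtx X)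
    (p q : EPath (SignType ⊕ Fin 1) (Vtx X)) :
    (Picture.fill ⟨Empty, Empty.elim, a⟩ (glue v p q)).rename (Equiv.sumEmpty X Empty) =
      glue v ((Picture.fill ⟨Empty, Empty.elim, a⟩ p).rename (Equiv.sumEmpty X Empty))
        ((Picture.fill ⟨Empty, Empty.elim, a⟩ q).rename (Equiv.sumEmpty X Empty)) := by
  refine (congrArg (rename _) (fill_glue ⟨Empty, Empty.elim, a⟩ v p q)).trans ?_
  refine (mapV_glue _ _ _ _).trans ?_
  cases v <;> rfl

theorem rename_fill_closed (a : Fin 1 → Strand Empty) (p : Strand X) :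
    (Picture.fill ⟨Empty, Empty.elim, a⟩ (closed p)).rename (Equiv.sumEmpty X Empty) = p :=
  (congrArg (rename _) (fill_closed ⟨Empty, Empty.elim, a⟩ p)).trans (Tangle.rename_sumEmpty p)

theorem RotEq.glue_left (v : Vtx X) {p q : Strand X} (r : Strand X) (h : RotEq p q) :
    RotEq (glue v r p) (glue v r q) := by
  induction h with
  | rel _ _ h =>
    obtain ⟨c, i, j, k, hijk, rfl, rfl⟩ := h
    refine .rel _ _ ⟨glue v (closed r) c, i, j, k, hijk, ?_, ?_⟩ <;>
    · refine Eq.trans ?_ (rename_fill_glue _ v _ _).symm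
      exact congrArg (fun s => glue v s _)
        (rename_fill_closed _ r).symm
  | refl => exact .refl _
  | symm _ _ _ ih => exact ih.symm
  | trans _ _ _ _ _ ih ih' => exact ih.trans ih'

theorem RotEq.glue_right (v : Vtx X) {p q : Strand X} (r : Strand X) (h : RotEq p q) :
    RotEq (glue v p r) (glue v q r) := by
  induction h with
  | rel _ _ h =>
    obtain ⟨c, i, j, k, hijk, rfl, rfl⟩ := h
    refine .rel _ _ ⟨glue v c (closed r), i, j, k, hijk, ?_, ?_⟩ <;>
    · refine Eq.trans ?_ (rename_fill_glue _ v _ _).symm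
      exact congrArg (glue v _)
        (rename_fill_closed _ r).symm
  | refl => exact .refl _
  | symm _ _ _ ih => exact ih.symm
  | trans _ _ _ _ _ ih ih' => exact ih.trans ih'

theorem RotEq.join_edge (i j k : SignType) (h : (i : ℤ) + (j : ℤ) = (k : ℤ)) :
    RotEq (join (edge i) (edge j) : Strand X) (edge k) :=
  .rel _ _ ⟨edge (Sum.inr 0), i, j, k, h, rfl, rfl⟩

theorem RotEq.edge_join (p : Strand X) : RotEq (join (edge 0) p) p := by
  obtain ⟨h, t⟩ := p
  have e := RotEq.join_edge (X := X) 0 h h (zero_add _)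
  cases t with
  | nil => exact e
  | cons a t =>
    obtain ⟨v, s⟩ := a
    exact e.glue_right v ⟨s, t⟩

/-- The strand that consists of one edge or of one passage. -/
def elem : SignType ⊕ (X × Bool) → Strand X
  | .inl s => edge s
  | .inr a => ⟨0, [(Vtx.cross a.1 a.2, 0)]⟩

theorem rename_elem {Y : Type} (f : X → Y) (a : SignType ⊕ (X × Bool)) :
    (elem a).rename f = elem (a.map id (Prod.map f id)) := by
  rcases a with a | ⟨x, o⟩ <;> rfl

open Classical in
theorem count_elem (a : SignType ⊕ (X × Bool)) (x : X) (o : Bool) :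
    (elem a).count (Vtx.cross x o) = if a = Sum.inr (x, o) then 1 else 0 := by
  rcases a with a | ⟨y, o'⟩
  · rfl
  · simp [elem, count, List.countP_cons]

/-- The edges and passages of a path. -/
def elems : SignType → List (Vtx X × SignType) → List (SignType ⊕ (X × Bool))
  | h, [] => [Sum.inl h]
  | h, (Vtx.bi, e) :: t => Sum.inl h :: elems e t
  | h, (Vtx.cross x o, e) :: t => Sum.inl h :: Sum.inr (x, o) :: elems e t

theorem joinAll_cons (e : SignType) (p : Strand X) {l : List (Strand X)} (hl : l ≠ []) :
    joinAll e (p :: l) = join p (joinAll e l) := by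
  cases l with
  | nil => exact absurd rfl hl
  | cons => rfl

theorem elems_ne_nil (h : SignType) (t : List (Vtx X × SignType)) : elems h t ≠ [] := by
  rcases t with _ | ⟨⟨_ | _, _⟩, _⟩ <;> simp [elems]

theorem rotEq_joinAll_elems : ∀ (h : SignType) (t : List (Vtx X × SignType)),
    RotEq ⟨h, t⟩ (joinAll 0 ((elems h t).map elem))
  | h, [] => .refl _
  | h, (Vtx.bi, e) :: t => by
    rw [elems, List.map_cons, joinAll_cons _ _ (by simpa using elems_ne_nil e t)]
    exact (rotEq_joinAll_elems e t).glue_left Vtx.bi (edge h)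
  | h, (Vtx.cross x o, e) :: t => by
    rw [elems, List.map_cons, List.map_cons, joinAll_cons _ _ (by simp),
      joinAll_cons _ _ (by simpa using elems_ne_nil e t)]
    have h1 : RotEq (glue (Vtx.cross x o) (edge h) ⟨e, t⟩)
        (glue (Vtx.cross x o) (join (edge h) (edge 0)) ⟨e, t⟩) :=
      RotEq.symm ((RotEq.join_edge h 0 h (add_zero _)).glue_right _ _)
    have h2 := ((rotEq_joinAll_elems e t).trans (RotEq.symm (RotEq.edge_join _))).glue_left
      (Vtx.cross x o) (join (edge h) (edge 0))
    refine (h1.trans h2).trans ?_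
    rw [join, glue_assoc]
    refine RotEq.glue_left _ _ ?_
    rw [join, ← glue_assoc]
    exact .refl _

end EPath

namespace Tangle

open EPath

section RotEq

variable {n : ℕ} {X : Type} [Finite X] (sign : X → Bool) (perm : Equiv.Perm (Fin n))

open Classical in
/-- The tangle with given strands. -/
noncomputable def ofStrands (p : Fin n → Strand X) : Tangle n :=
  if h : ∀ x o, ∑ i, (p i).count (Vtx.cross x o) = 1 then mk ⟨X, inferInstance, sign, p, perm, h⟩ else 1

theorem ofStrands_update (a : Fin n) {q r : Strand X} (h : RotEq q r) (p : Fin n → Strand X) :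
    ofStrands sign perm (Function.update p a q) = ofStrands sign perm (Function.update p a r) := by
  induction h with
  | rel q r h =>
    have hc : ∀ x o, ∑ i, (Function.update p a q i).count (Vtx.cross x o) =
        ∑ i, (Function.update p a r i).count (Vtx.cross x o) := fun x o =>
      Finset.sum_congr rfl fun i _ => by
        by_cases hi : i = a
        · subst hi
          simpa using h.count_eq x o
        · simp [hi]
    by_cases h' : ∀ x o, ∑ i, (Function.update p a q i).count (Vtx.cross x o) = 1
    · have h'' := h'
      simp only [hc] at h''
      rw [ofStrands, ofStrands, dif_pos h', dif_pos h'']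
      obtain ⟨c, i, j, k, hijk, hq, hr⟩ := h
      refine mk_eq_of_arc a (Equiv.refl _) (fun _ => rfl) rfl (fun i hi => ?_) c _ _
        (.r0r i j k hijk) ?_ ?_
      · simpa [hi] using (rename_id (p i)).symm
      · simpa using hq
      · simp only [Function.update_self]
        exact hr.trans (rename_id _).symm
    · have h'' := h'
      simp only [hc] at h''
      rw [ofStrands, ofStrands, dif_neg h', dif_neg h'']
  | refl => rfl
  | symm _ _ _ ih => exact ih.symm
  | trans _ _ _ _ _ ih ih' => exact ih.trans ih'

theorem ofStrands_eq {p q : Fin n → Strand X} (h : ∀ i, RotEq (p i) (q i)) :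
    ofStrands sign perm p = ofStrands sign perm q := by
  have key : ∀ s : Finset (Fin n), ofStrands sign perm p = ofStrands sign perm (s.piecewise q p) := by
    intro s
    induction s using Finset.induction_on with
    | empty => rw [Finset.piecewise_empty]
    | insert a s ha ih =>
      rw [Finset.piecewise_insert, ih]
      have := ofStrands_update sign perm a (h a) (s.piecewise q p)
      rw [← this]
      congr 1
      refine (Function.update_eq_self_iff.mpr ?_).symm
      simp [ha]
  rw [key Finset.univ, Finset.piecewise_univ]

end RotEq

theorem mk_eq_mk_of_rotEq {n : ℕ} {X : Type} {hX : Finite X} {sign : X → Bool}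
    {p q : Fin n → Strand X} {perm : Equiv.Perm (Fin n)} {hp hq}
    (h : ∀ i, RotEq (p i) (q i)) : mk ⟨X, hX, sign, p, perm, hp⟩ = mk ⟨X, hX, sign, q, perm, hq⟩ := by
  have := ofStrands_eq sign perm h
  simpa only [ofStrands, dif_pos hp, dif_pos hq] using this

end Tangle

end XCT

namespace XCT

/-! ### Induction on tangles -/

namespace Tangle

open EPath XCDiagram

theorem _root_.XCT.XCDiagram.tensor_strand_castAdd {n m : ℕ} (T₁ : XCDiagram n) (T₂ : XCDiagram m) (i : Fin n) :
    (T₁.tensor T₂).strand (Fin.castAdd m i) = (T₁.strand i).rename Sum.inl := by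
  simp only [XCDiagram.tensor, Fin.addCases_left]

theorem _root_.XCT.XCDiagram.tensor_strand_natAdd {n m : ℕ} (T₁ : XCDiagram n) (T₂ : XCDiagram m) (i : Fin m) :
    (T₁.tensor T₂).strand (Fin.natAdd n i) = (T₂.strand i).rename Sum.inr := by
  simp only [XCDiagram.tensor, Fin.addCases_right]

/-- A family of sets of tangles that contains the generators and is closed under the external
operations. -/
structure Closed (Q : ∀ n, Tangle n → Prop) : Prop where
  one : ∀ n, Q n 1
  X : Q 2 X
  Xinv : Q 2 Xinv
  K : Q 1 K
  Kinv : Q 1 Kinv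
  tensor : ∀ {n m : ℕ} {T : Tangle n} {T' : Tangle m}, Q n T → Q m T' → Q (n + m) (T.tensor T')
  permute : ∀ {n : ℕ} (ρ τ : Equiv.Perm (Fin n)) {T : Tangle n}, Q n T → Q n (T.permute ρ τ)
  merge : ∀ {r : ℕ} (k : Fin r → ℕ) {T : Tangle (total k)}, Q (total k) T → Q r (T.merge k)

namespace Closed

variable {Q : ∀ n, Tangle n → Prop} (hQ : Closed Q)

include hQ

theorem of_relabel {n : ℕ} {D D' : XCDiagram n} (τ : Equiv.Perm (Fin n)) (e : D'.X ≃ D.X)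
    (hs : ∀ x, D.sign (e x) = D'.sign x) (hst : ∀ i, D.strand (τ i) = (D'.strand i).rename e)
    (h : Q n (Tangle.mk D')) : Q n (Tangle.mk D) := by
  have := hQ.permute (D.perm * τ * D'.perm⁻¹) τ h
  rwa [show (Tangle.mk D').permute (D.perm * τ * D'.perm⁻¹) τ = Tangle.mk D from
    mk_eq_of_step (.iso e hs (fun i => by
      obtain ⟨i, rfl⟩ := τ.surjective i
      rw [hst]
      exact congrArg (fun j => (D'.strand j).rename e) (τ.symm_apply_apply i).symm)
      (by simp [XCDiagram.permute]))] at this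

theorem of_relabel_tensor {n m : ℕ} {D : XCDiagram (n + m)} {F : XCDiagram n} {E : XCDiagram m}
    (τ : Equiv.Perm (Fin (n + m))) (e : F.X ⊕ E.X ≃ D.X)
    (hsl : ∀ x, D.sign (e (Sum.inl x)) = F.sign x) (hsr : ∀ x, D.sign (e (Sum.inr x)) = E.sign x)
    (hl : ∀ i, D.strand (τ (Fin.castAdd m i)) = (F.strand i).rename (e ∘ Sum.inl))
    (hr : ∀ i, D.strand (τ (Fin.natAdd n i)) = (E.strand i).rename (e ∘ Sum.inr))
    (hF : Q n (Tangle.mk F)) (hE : Q m (Tangle.mk E)) : Q (n + m) (Tangle.mk D) := by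
  refine hQ.of_relabel (D' := F.tensor E) τ e ?_ (fun i => ?_) (hQ.tensor hF hE)
  · rintro (x | x)
    · exact hsl x
    · exact hsr x
  · refine Fin.addCases (fun i => ?_) (fun i => ?_) i
    · rw [hl, tensor_strand_castAdd]
      exact (rename_rename _ _ _).symm
    · rw [hr, tensor_strand_natAdd]
      exact (rename_rename _ _ _).symm

theorem rotation (s : SignType) : Q 1 (Tangle.mk (XCDiagram.rotation s)) := by
  cases s
  · exact hQ.one 1
  · exact hQ.Kinv
  · exact hQ.K

/-- Diagrams without crossings whose strands are edges. -/
theorem exists_edges : ∀ {n : ℕ} (f : Fin n → SignType),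
    ∃ D : XCDiagram n, IsEmpty D.X ∧ (∀ i, D.strand i = edge (f i)) ∧ Q n (Tangle.mk D)
  | 0, _ => ⟨XCDiagram.id 0, inferInstanceAs (IsEmpty Empty), fun i => i.elim0, hQ.one 0⟩
  | n + 1, f => by
    obtain ⟨D, h1, h2, h3⟩ := exists_edges fun i => f i.castSucc
    refine ⟨D.tensor (XCDiagram.rotation (f (Fin.last n))), ?_, fun i => ?_,
      hQ.tensor h3 (hQ.rotation _)⟩
    · have : IsEmpty (XCDiagram.rotation (f (Fin.last n))).X := inferInstanceAs (IsEmpty Empty)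
      exact inferInstanceAs (IsEmpty (D.X ⊕ (XCDiagram.rotation (f (Fin.last n))).X))
    · refine Fin.lastCases ?_ (fun i => ?_) i
      · exact tensor_strand_natAdd _ _ (0 : Fin 1)
      · refine (tensor_strand_castAdd _ _ i).trans ?_
        rw [h2]
        rfl

/-- A single crossing; the first strand is the overpassing one. -/
theorem exists_crossing (ε : Bool) : ∃ D : XCDiagram 2, ∃ x : D.X, (∀ y, y = x) ∧ D.sign x = ε ∧
    D.strand 0 = elem (Sum.inr (x, true)) ∧ D.strand 1 = elem (Sum.inr (x, false)) ∧
    Q 2 (Tangle.mk D) := by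
  cases ε
  · exact ⟨negCrossing.permute 1 (Equiv.swap 0 1), (), fun _ => rfl, rfl, rfl, rfl,
      hQ.permute _ _ hQ.Xinv⟩
  · exact ⟨posCrossing, (), fun _ => rfl, rfl, rfl, rfl, hQ.X⟩

/-- Diagrams whose strands are single passages. -/
theorem exists_passages (X : Type) [Finite X] : ∀ (sign : X → Bool),
    ∃ (n : ℕ) (D : XCDiagram n) (e : X ≃ D.X) (q : Fin n → X × Bool), Function.Bijective q ∧
      (∀ x, D.sign (e x) = sign x) ∧
      (∀ i, D.strand i = elem (Sum.inr ((q i).map e id))) ∧ Q n (Tangle.mk D) := by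
  induction X using Finite.induction_empty_option with
  | of_equiv f ih =>
    intro sign
    obtain ⟨n, D, e, q, hq, h1, h2, h3⟩ := ih (sign ∘ f)
    refine ⟨n, D, f.symm.trans e, fun i => (q i).map f id,
      (f.bijective.prodMap Function.bijective_id).comp hq, fun x => ?_, fun i => ?_, h3⟩
    · simpa using h1 (f.symm x)
    · rw [h2]; simp [Prod.map]
  | h_empty =>
    intro sign
    have : IsEmpty (XCDiagram.id 0).X := inferInstanceAs (IsEmpty Empty)
    exact ⟨0, XCDiagram.id 0, Equiv.equivOfIsEmpty _ _, fun i => i.elim0,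
      ⟨fun i => i.elim0, fun x => x.1.elim⟩, fun x => x.elim, fun i => i.elim0, hQ.one 0⟩
  | h_option ih =>
    intro sign
    obtain ⟨n, D, e, q, hq, h1, h2, h3⟩ := ih (sign ∘ some)
    obtain ⟨E, x, hx, g1, g2, g3, g4⟩ := hQ.exists_crossing (sign none)
    have : Unique E.X := ⟨⟨x⟩, hx⟩
    let e' : Option _ ≃ D.X ⊕ E.X := (Equiv.optionEquivSumPUnit.{0} _).trans
      (e.sumCongr (Equiv.ofUnique PUnit E.X))
    have he' : e' none = Sum.inr x := congrArg Sum.inr (hx _)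
    refine ⟨n + 2, D.tensor E, e', Fin.addCases (motive := fun _ => _) (fun i => (q i).map some id)
      ![(none, true), (none, false)], ⟨?_, ?_⟩, ?_, fun i => ?_, hQ.tensor h3 g4⟩
    · intro i j
      refine Fin.addCases (fun i => ?_) (fun i => ?_) i <;>
      refine Fin.addCases (fun j => ?_) (fun j => ?_) j
      · intro h
        simp only [Fin.addCases_left] at h
        rw [hq.1 (((Option.some_injective _).prodMap Function.injective_id) h)]
      · intro h
        rw [Fin.addCases_left, Fin.addCases_right] at h
        fin_cases j <;> simp [Prod.ext_iff] at h
      · intro h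
        rw [Fin.addCases_left, Fin.addCases_right] at h
        fin_cases i <;> simp [Prod.ext_iff] at h
      · intro h
        rw [Fin.addCases_right, Fin.addCases_right] at h
        fin_cases i <;> fin_cases j <;> simp at h ⊢
    · rintro ⟨_ | y, o⟩
      · refine ⟨Fin.natAdd n (cond o 0 1), ?_⟩
        rw [Fin.addCases_right]
        cases o <;> rfl
      · obtain ⟨i, hi⟩ := hq.2 (y, o)
        refine ⟨Fin.castAdd 2 i, ?_⟩
        rw [Fin.addCases_left, hi]
        rfl
    · rintro (_ | y)
      · exact (congrArg (Sum.elim D.sign E.sign) he').trans g1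
      · exact h1 y
    · refine Fin.addCases (fun i => ?_) (fun i => ?_) i
      · rw [tensor_strand_castAdd, h2, rename_elem, Fin.addCases_left]
        rfl
      · rw [tensor_strand_natAdd, Fin.addCases_right]
        fin_cases i
        · refine ((congrArg _ g2).trans (rename_elem _ _)).trans ?_
          exact congrArg (fun z => elem (Sum.inr (z, true))) he'.symm
        · refine ((congrArg _ g3).trans (rename_elem _ _)).trans ?_
          exact congrArg (fun z => elem (Sum.inr (z, false))) he'.symm

theorem of_elems {n : ℕ} (D : XCDiagram n) (f : Fin n → SignType ⊕ (D.X × Bool))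
    (hf : ∀ i, D.strand i = elem (f i)) : Q n (Tangle.mk D) := by
  classical
  have := D.finite
  obtain ⟨m, E, e, q, hq, h1, h2, h3⟩ := hQ.exists_passages D.X D.sign
  let q' : Fin m ≃ D.X × Bool := Equiv.ofBijective q hq
  have hu : ∀ j : Fin m, ∃! t, (f t).map _root_.id q'.symm = Sum.inr j := by
    intro j
    have h := D.once (q' j).1 (q' j).2
    simp only [hf, count_elem, Finset.sum_boole, Nat.cast_id, Finset.card_eq_one] at h
    obtain ⟨t, ht⟩ := h
    have key : ∀ t', (f t').map _root_.id q'.symm = Sum.inr j ↔ t' = t := by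
      intro t'
      rw [← Finset.mem_singleton (a := t), ← ht]
      rcases hft : f t' with s | a
      · simp [hft]
      · simp [hft, Equiv.symm_apply_eq]
    exact ⟨t, (key t).mpr rfl, fun t' h => (key t').mp h⟩
  obtain ⟨N, s, g, hg⟩ := exists_split _ hu
  obtain ⟨F, k1, k2, k3⟩ := hQ.exists_edges g
  obtain rfl : N + m = n := by simpa using Fintype.card_congr s
  refine hQ.of_relabel_tensor (F := F) (E := E) (finSumFinEquiv.symm.trans s)
    ((Equiv.emptySum F.X E.X).trans e.symm) (fun x => k1.elim x) (fun x => ?_) (fun i => ?_)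
    (fun i => ?_) k3 h3
  · obtain ⟨x, rfl⟩ := e.surjective x
    rw [h1]
    simp
  · have := hg (Sum.inl i)
    rw [hf, k2]
    change elem (f (s (finSumFinEquiv.symm (Fin.castAdd m i)))) = _
    rw [finSumFinEquiv_symm_apply_castAdd]
    rcases hfi : f (s (Sum.inl i)) with a | a <;> rw [hfi] at this
    · have ha : a = g i := Sum.inl_injective this
      rw [ha]
      rfl
    · cases this
  · have := hg (Sum.inr i)
    rw [hf, h2, rename_elem]
    change elem (f (s (finSumFinEquiv.symm (Fin.natAdd N i)))) = _
    rw [finSumFinEquiv_symm_apply_natAdd]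
    rcases hfi : f (s (Sum.inr i)) with a | a <;> rw [hfi] at this
    · cases this
    · have ha : a = q i := (Equiv.symm_apply_eq q').mp (Sum.inr_injective this)
      rw [ha]
      refine congrArg (fun b => elem (Sum.inr b)) (Prod.ext ?_ rfl)
      exact (e.symm_apply_apply _).symm

theorem all {n : ℕ} (T : Tangle n) : Q n T := by
  obtain ⟨X, hX, sign, p, perm, once⟩ := T
  let l : Fin n → List (SignType ⊕ X × Bool) := fun i => (elems (p i).head (p i).tail).reverse
  obtain ⟨f, hf⟩ := exists_blockFun (fun i => (l i).length) fun i j => (l i).get j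
  have hl : ∀ i, joinAll 0 (List.ofFn fun j => elem (f (blockPos (fun i => (l i).length) i j))).reverse =
      joinAll 0 ((elems (p i).head (p i).tail).map elem) := by
    intro i
    simp only [hf]
    have : (List.ofFn fun j => (elem ((l i).get j) : Strand X)) = (l i).map elem := by
      conv_rhs => rw [← List.ofFn_get (l i), List.map_ofFn]
      rfl
    rw [this, ← List.map_reverse, List.reverse_reverse]
  have hr : ∀ i, RotEq (p i) (joinAll 0 (List.ofFn fun j =>
      elem (f (blockPos (fun i => (l i).length) i j))).reverse) := by
    intro i
    rw [hl]
    exact rotEq_joinAll_elems _ _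
  let E : XCDiagram (total fun i => (l i).length) := ⟨X, hX, sign, fun t => elem (f t), 1, by
    intro x o
    rw [← sum_blockPos, ← once x o]
    refine Finset.sum_congr rfl fun i _ => ?_
    rw [(hr i).count_eq, count_joinAll, List.map_reverse, List.sum_reverse, List.map_ofFn,
      List.sum_ofFn]
    rfl⟩
  have h := hQ.permute (perm * (mergePerm _ E.perm)⁻¹) 1 (hQ.merge _ (hQ.of_elems E f fun _ => rfl))
  have e : Tangle.mk ⟨X, hX, sign, p, perm, once⟩ = ((Tangle.mk E).merge fun i => (l i).length).permute
      (perm * (mergePerm _ E.perm)⁻¹) 1 := by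
    refine (mk_eq_mk_of_rotEq (hq := ?_) hr).trans (mk_eq_of_step (.iso (Equiv.refl X) (fun _ => rfl)
      (fun i => (rename_id _).symm) ?_))
    · intro x o
      rw [← once x o]
      exact Finset.sum_congr rfl fun i _ => ((hr i).count_eq x o).symm
    · exact (mul_one _).trans (inv_mul_cancel_right perm (mergePerm _ E.perm))
  change Q n (Tangle.mk ⟨X, hX, sign, p, perm, once⟩)
  rw [e]
  exact h

end Closed

end Tangle

end XCT

namespace XCT

open scoped MonObj

/-! ### The functor on XC-tangles -/

theorem Step.perm_eq {n : ℕ} {D D' : XCDiagram n} (h : Step D D') : D.perm = D'.perm := by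
  cases h with
  | iso _ _ _ h => exact h.symm
  | move _ c hL hR =>
    obtain ⟨_, _, _, _, h⟩ := hL
    obtain ⟨_, _, _, _, h'⟩ := hR
    exact h.trans h'.symm

section Functor

variable {C : Type u} [Category.{v} C] [MonoidalCategory C] [SymmetricCategory C]
  {A : C} [MonObj A] (S : XCStructure A)

namespace Tangle

/-- The point of `A^{⊗ n}` that is associated with a tangle. -/
noncomputable def val {n : ℕ} (T : Tangle n) : 𝟙_ C ⟶ tpow A n :=
  Quot.lift (fun D => D.val S) (fun _ _ h => h.val_eq S) T

/-- The permutation from the starts to the ends of the strands. -/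
def perm {n : ℕ} (T : Tangle n) : Equiv.Perm (Fin n) :=
  Quot.lift (fun D => D.perm) (fun _ _ h => h.perm_eq) T

theorem val_mem {n : ℕ} (T : Tangle n) : T.val S ∈ Set.range (XC.interp S (n := n)) := by
  refine Closed.all (Q := fun n T => T.val S ∈ Set.range (XC.interp S (n := n)))
    ⟨fun n => ?_, ?_, ?_, ?_, ?_, ?_, ?_, ?_⟩ T
  · exact (congrArg (· ∈ _) (XCDiagram.val_id S)).mpr (1 : VE S n).mem
  · exact (congrArg (· ∈ _) (XCDiagram.val_posCrossing S)).mpr (VE.X S).mem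
  · exact (congrArg (· ∈ _) (XCDiagram.val_negCrossing S)).mpr (VE.Xinv S).mem
  · exact (congrArg (· ∈ _) (XCDiagram.val_rotation S 1)).mpr (VE.K S).mem
  · exact (congrArg (· ∈ _) (XCDiagram.val_rotation S (-1))).mpr (VE.Kinv S).mem
  · rintro n m ⟨D⟩ ⟨D'⟩ h h'
    exact (congrArg (· ∈ _) (XCDiagram.val_tensor S D D')).mpr
      (VE.tensor (S := S) ⟨D.val S, h, 1⟩ ⟨D'.val S, h', 1⟩).mem
  · rintro n ρ τ ⟨D⟩ h
    exact (congrArg (· ∈ _) (XCDiagram.val_permute S ρ τ D)).mpr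
      (VE.permute (S := S) 1 τ ⟨D.val S, h, 1⟩).mem
  · rintro n k ⟨D⟩ h
    exact (congrArg (· ∈ _) (XCDiagram.val_merge S k D)).mpr
      (VE.merge (S := S) k ⟨D.val S, h, 1⟩).mem

end Tangle

/-- The functor from XC-tangles to the virtual category of elements. -/
noncomputable def tangleFunctor : XCFunctor S where
  map n :=
    { toFun := fun T => ⟨T.val S, T.val_mem S, T.perm⟩
      map_one' := VE.ext (XCDiagram.val_id S) rfl
      map_mul' := by
        rintro ⟨D⟩ ⟨D'⟩
        exact VE.ext (XCDiagram.val_comp S D D') rfl }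
  map_tensor := by
    rintro n m ⟨D⟩ ⟨D'⟩
    exact VE.ext (XCDiagram.val_tensor S D D') rfl
  map_braid n m := VE.ext (XCDiagram.val_braid S) rfl

theorem tangleFunctor_compatible : (tangleFunctor S).Compatible where
  permute := by
    rintro n ρ τ ⟨D⟩
    exact VE.ext (XCDiagram.val_permute S ρ τ D) rfl
  merge := by
    rintro n k ⟨D⟩
    exact VE.ext (XCDiagram.val_merge S k D) rfl

theorem tangleFunctor_X : (tangleFunctor S).map 2 Tangle.X = VE.X S :=
  VE.ext (XCDiagram.val_posCrossing S) rfl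

theorem tangleFunctor_Xinv : (tangleFunctor S).map 2 Tangle.Xinv = VE.Xinv S :=
  VE.ext (XCDiagram.val_negCrossing S) rfl

theorem tangleFunctor_K : (tangleFunctor S).map 1 Tangle.K = VE.K S :=
  VE.ext (XCDiagram.val_rotation S 1) rfl

theorem tangleFunctor_Kinv : (tangleFunctor S).map 1 Tangle.Kinv = VE.Kinv S :=
  VE.ext (XCDiagram.val_rotation S (-1)) rfl

variable {S}

theorem XCFunctor.eq_of_generators {Z Z' : XCFunctor S} (h : Z.Compatible) (h' : Z'.Compatible)
    (hX : Z.map 2 Tangle.X = Z'.map 2 Tangle.X)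
    (hXinv : Z.map 2 Tangle.Xinv = Z'.map 2 Tangle.Xinv)
    (hK : Z.map 1 Tangle.K = Z'.map 1 Tangle.K)
    (hKinv : Z.map 1 Tangle.Kinv = Z'.map 1 Tangle.Kinv) : Z = Z' := by
  refine XCFunctor.ext (funext fun n => MonoidHom.ext fun T => ?_)
  refine Tangle.Closed.all (Q := fun n T => Z.map n T = Z'.map n T)
    ⟨fun n => ?_, hX, hXinv, hK, hKinv, ?_, ?_, ?_⟩ T
  · rw [map_one, map_one]
  · intro _ _ _ _ h1 h2
    rw [Z.map_tensor, Z'.map_tensor, h1, h2]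
  · intro _ ρ τ _ h1
    rw [h.permute, h'.permute, h1]
  · intro _ k _ h1
    rw [h.merge, h'.merge, h1]

end Functor

end XCT

namespace XCT

open Presented (evalObj)
open scoped MonObj

/-! ### The points of tensor powers that come from the PROP `XC` are generated by `R` and `κ` -/

section Generic

variable {C : Type u} [Category.{v} C] [MonoidalCategory C]

theorem comp_whiskerLeft_tensorHom {P N X M : C} (u : 𝟙_ C ⟶ P ⊗ 𝟙_ C) (f : 𝟙_ C ⟶ X) (φ : P ⟶ N)
    (ψ : X ⟶ M) : (u ≫ P ◁ f) ≫ (φ ⊗ₘ ψ) = ptensor (u ≫ (ρ_ P).hom ≫ φ) (f ≫ ψ) := by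
  have h : u = (u ≫ (ρ_ P).hom) ≫ (ρ_ P).inv := by simp
  generalize u ≫ (ρ_ P).hom = w at h
  subst h
  have e : (w ≫ (ρ_ P).inv) ≫ (ρ_ P).hom ≫ φ = w ≫ φ := by simp
  rw [e, ptensor, unitors_inv_equal, ← tensorHom_comp_tensorHom, tensorHom_def w f]
  simp

theorem tpowAdd_one_inv_eqToHom (X : C) {N n : ℕ} (h : N = n) :
    (tpowAdd X N 1).inv ≫ (eqToHom (congrArg (tpow X) h) ⊗ₘ (λ_ X).hom) =
      eqToHom (congrArg (fun k => tpow X (k + 1)) h) := by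
  subst h
  change ((ρ_ (tpow X N)).inv ▷ X ≫ (α_ (tpow X N) (𝟙_ C) X).hom) ≫ (𝟙 _ ⊗ₘ (λ_ X).hom) = 𝟙 _
  simp

theorem blockMul_ones {X : C} (m : X ⊗ X ⟶ X) (e : 𝟙_ C ⟶ X) (hm : e ▷ X ≫ m = (λ_ X).hom) : ∀ n : ℕ,
    ∃ h : total (fun _ : Fin n => 1) = n,
      blockMul m e (fun _ : Fin n => 1) = eqToHom (congrArg (tpow X) h)
  | 0 => ⟨rfl, rfl⟩
  | n + 1 => by
    obtain ⟨h, hb⟩ := blockMul_ones m e hm n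
    refine ⟨congrArg (· + 1) h, ?_⟩
    change (tpowAdd X (total fun _ : Fin n => 1) 1).inv ≫
      (blockMul m e (fun _ : Fin n => 1) ⊗ₘ iterMul m e 1) = _
    have h1 : iterMul m e 1 = (λ_ X).hom := hm
    rw [hb, h1]
    exact tpowAdd_one_inv_eqToHom X h

theorem tpowAdd_two_inv (X : C) (n : ℕ) {m : X ⊗ X ⟶ X} {e : 𝟙_ C ⟶ X}
    (hm : e ▷ X ≫ m = (λ_ X).hom) :
    (tpowAdd X n 2).inv ≫ (tpow X n ◁ iterMul m e 2) = (α_ (tpow X n) X X).hom ≫ tpow X n ◁ m := by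
  change ((((ρ_ (tpow X n)).inv ▷ X ≫ (α_ (tpow X n) (𝟙_ C) X).hom) ▷ X) ≫ (α_ _ _ _).hom) ≫
    tpow X n ◁ ((e ▷ X ≫ m) ▷ X ≫ m) = _
  rw [hm, whiskerLeft_comp, ← Category.assoc]
  congr 1
  monoidal

end Generic

section Generation

variable {C : Type u} [Category.{v} C] [MonoidalCategory C] [SymmetricCategory C]
  {A : C} [MonObj A] (S : XCStructure A)

/-- A family of sets of points that contains `R^{±1}`, `κ^{±1}` and is closed under the operations
of an algebra object. -/
structure PowClosed (I : ∀ n, (𝟙_ C ⟶ tpow A n) → Prop) : Prop where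
  one : ∀ n, I n (unitPow η[A] n)
  R : I 2 (S.R ≫ toPow2 A)
  Rinv : I 2 ((S.Rinv ≫ (β_ A A).hom) ≫ toPow2 A)
  κ : I 1 (S.κ ≫ toPow1 A)
  κinv : I 1 (S.κinv ≫ toPow1 A)
  tensor : ∀ {n m a b}, I n a → I m b → I (n + m) (powTensor a b)
  perm : ∀ {n : ℕ} (σ : Equiv.Perm (Fin n)) {a}, I n a → I n (a ≫ permMap A σ)
  mul : ∀ {r : ℕ} (k : Fin r → ℕ) {a}, I (total k) a → I r (a ≫ blockMul μ[A] η[A] k)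

/-- The labelling of a word by a single label. -/
def unitLab : ∀ w : Word, Lab Unit w
  | .unit => .unit
  | .gen => .gen ()
  | .tensor x y => .tensor (unitLab x) (unitLab y)

namespace PowClosed

variable {S} {I : ∀ n, (𝟙_ C ⟶ tpow A n) → Prop} (hI : PowClosed S I)

theorem cast {n m : ℕ} (h : n = m) {a : 𝟙_ C ⟶ tpow A n} (ha : I n a) :
    I m (a ≫ eqToHom (congrArg (tpow A) h)) := by
  subst h
  simpa using ha

include hI

theorem exists_mul {n : ℕ} (f : Fin n → ℕ) (hf : f = fun _ => 1) (c : ℕ) (hc : c = 2)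
    {a : 𝟙_ C ⟶ tpow A (n + 2)} (ha : I (n + 2) a) :
    ∃ b, I (total f + c) b ∧ b ≫ (tpowAdd A (total f) c).inv ≫
      (blockMul μ[A] η[A] f ⊗ₘ iterMul μ[A] η[A] c) =
        a ≫ (α_ (tpow A n) A A).hom ≫ tpow A n ◁ μ[A] := by
  subst hf hc
  obtain ⟨h, hb⟩ := blockMul_ones μ[A] η[A] (MonObj.one_mul A) n
  rw [hb, ← tpowAdd_two_inv A n (MonObj.one_mul A)]
  clear hb
  generalize (total fun _ : Fin n => 1) = N at h ⊢
  subst h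
  exact ⟨a, ha, by simp⟩

theorem mul_last {n : ℕ} {a : 𝟙_ C ⟶ tpow A (n + 2)} (ha : I (n + 2) a) :
    I (n + 1) (a ≫ (α_ (tpow A n) A A).hom ≫ tpow A n ◁ μ[A]) := by
  let k : Fin (n + 1) → ℕ := fun i => if i = Fin.last n then 2 else 1
  obtain ⟨b, hb, e⟩ := hI.exists_mul (fun i : Fin n => k i.castSucc)
    (funext fun i => if_neg (Fin.castSucc_lt_last i).ne) (k (Fin.last n)) (if_pos rfl) ha
  rw [← e]
  exact hI.mul k hb

end PowClosed

variable (I : ∀ n, (𝟙_ C ⟶ tpow A n) → Prop)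

/-- The corresponding sets of points of arbitrary bracketed tensor powers. -/
def WordMem (w : Word) (a : 𝟙_ C ⟶ evalObj S.data w) : Prop :=
  I (unitLab w).names.length (a ≫ (flatten S.data (unitLab w)).hom)

theorem flatten_gen_gen : (flatten S.data (unitLab (.tensor .gen .gen))).hom = toPow2 A := by
  change ((λ_ A).inv ⊗ₘ (λ_ A).inv) ≫ (α_ (𝟙_ C ⊗ A) (𝟙_ C) A).inv ≫ (ρ_ (𝟙_ C ⊗ A)).hom ▷ A =
    (λ_ A).inv ▷ A
  monoidal

theorem mul_flatten_aux {P N : C} (φ : P ⟶ N) :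
    (P ◁ μ[A]) ≫ ((φ ⊗ₘ (λ_ A).inv) ≫ (α_ N (𝟙_ C) A).inv ≫ (ρ_ N).hom ▷ A) =
      ((φ ⊗ₘ toPow2 A) ≫ ((α_ N (𝟙_ C ⊗ A) A).inv ≫ ((α_ N (𝟙_ C) A).inv ≫ (ρ_ N).hom ▷ A) ▷ A)) ≫
        (α_ N A A).hom ≫ N ◁ μ[A] := by
  have h1 : (φ ⊗ₘ (λ_ A).inv) ≫ (α_ N (𝟙_ C) A).inv ≫ (ρ_ N).hom ▷ A = φ ▷ A := by
    rw [MonoidalCategory.tensorHom_def]; monoidal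
  have h2 : ((φ ⊗ₘ toPow2 A) ≫ ((α_ N (𝟙_ C ⊗ A) A).inv ≫
      ((α_ N (𝟙_ C) A).inv ≫ (ρ_ N).hom ▷ A) ▷ A)) ≫ (α_ N A A).hom = φ ▷ (A ⊗ A) := by
    rw [MonoidalCategory.tensorHom_def, toPow2]; monoidal
  rw [h1, ← Category.assoc, h2, whisker_exchange]

theorem wordMem_whiskerLeft_aux {P X Y Z : C} (a : 𝟙_ C ⟶ P ⊗ X ⊗ Y) (f : Y ⟶ Z) :
    a ≫ P ◁ X ◁ f = ((a ≫ (α_ P X Y).inv) ≫ (P ⊗ X) ◁ f) ≫ (α_ P X Z).hom := by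
  simp

theorem wordMem_whiskerRight_aux {P X Y Z : C} (a : 𝟙_ C ⟶ P ⊗ Y ⊗ X) (f : Y ⟶ Z) :
    a ≫ P ◁ f ▷ X = ((a ≫ P ◁ (β_ Y X).hom) ≫ P ◁ X ◁ f) ≫ P ◁ (β_ X Z).hom := by
  have h : f ▷ X = (β_ Y X).hom ≫ X ◁ f ≫ (β_ X Z).hom := by
    rw [BraidedCategory.braiding_naturality_right, SymmetricCategory.symmetry_assoc]
  rw [h]
  simp only [MonoidalCategory.whiskerLeft_comp, Category.assoc]

theorem leftUnitor_inv_comp_whiskerLeft {Y : C} (f : 𝟙_ C ⟶ Y) :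
    ((λ_ (𝟙_ C)).inv ≫ 𝟙_ C ◁ f) ≫ (λ_ Y).hom = f := by
  simp

theorem comp_eqToHom_aux {n m : ℕ} (h : n = m) {Q : C} {g : 𝟙_ C ⟶ Q} {a : 𝟙_ C ⟶ tpow A n}
    {c : tpow A n ⟶ Q} (hg : g = a ≫ c) {φ : Q ⟶ tpow A m}
    (e : c ≫ φ = eqToHom (congrArg (tpow A) h)) :
    (g ≫ φ) ≫ eqToHom (congrArg (tpow A) h.symm) = a := by
  subst h hg
  simp [e]

theorem comparison_flatten_aux {n m : ℕ} (h : n = m) {Q : C} {c : tpow A n ⟶ Q} {φ : Q ⟶ tpow A m}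
    (e : c ≫ φ = eqToHom (congrArg (tpow A) h)) :
    (c ▷ A ≫ 𝟙 (Q ⊗ A)) ≫
      ((φ ⊗ₘ (λ_ A).inv) ≫ (α_ (tpow A m) (𝟙_ C) A).inv ≫ (ρ_ (tpow A m)).hom ▷ A) =
        eqToHom (congrArg (tpow A) (congrArg (· + 1) h)) := by
  subst h
  have h1 : (φ ⊗ₘ (λ_ A).inv) ≫ (α_ (tpow A n) (𝟙_ C) A).inv ≫ (ρ_ (tpow A n)).hom ▷ A = φ ▷ A := by
    rw [MonoidalCategory.tensorHom_def]; monoidal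
  rw [h1, Category.comp_id, ← comp_whiskerRight, e]
  exact id_whiskerRight _ _

theorem exists_comparison_flatten : ∀ n : ℕ,
    ∃ h : n = (unitLab (tpow XC.gen n : XC)).names.length,
      XC.comparison S n ≫ (flatten S.data (unitLab (tpow XC.gen n : XC))).hom =
        eqToHom (congrArg (tpow A) h)
  | 0 => ⟨rfl, Category.comp_id (𝟙 (𝟙_ C))⟩
  | n + 1 => by
    obtain ⟨h, e⟩ := exists_comparison_flatten n
    exact ⟨congrArg (· + 1) h, comparison_flatten_aux (A := A) h e⟩

namespace PowClosed

variable {S} {I : ∀ n, (𝟙_ C ⟶ tpow A n) → Prop} (hI : PowClosed S I)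

include hI

theorem wordMem_str {x y : Word} {s} (h : Str S.data (unitLab x) (unitLab y) s)
    {a : 𝟙_ C ⟶ evalObj S.data x} (ha : WordMem S I x a) : WordMem S I y (a ≫ s) := by
  obtain ⟨r, hr, e⟩ := h.flat
  obtain ⟨hl, σ, rfl, -⟩ := hr.isPerm
  have key : (a ≫ s) ≫ (flatten S.data (unitLab y)).hom =
      ((a ≫ (flatten S.data (unitLab x)).hom) ≫ permMap S.data.obj σ) ≫
        eqToHom (congrArg (tpow S.data.obj) hl) := by
    simp only [Category.assoc, e]
  exact (congrArg (I _) key).mpr (PowClosed.cast (A := A) (I := I) hl (hI.perm σ ha))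

theorem wordMem_point {p : Word} {a : 𝟙_ C ⟶ evalObj S.data p ⊗ 𝟙_ C}
    (ha : WordMem S I (p.tensor .unit) a) {A' : C} (f : 𝟙_ C ⟶ A') (ψ : A' ⟶ tpow A 1)
    (hf : I 1 (f ≫ ψ)) : I ((unitLab p).names.length + 1)
      (((a ≫ _ ◁ f) ≫ ((flatten S.data (unitLab p)).hom ⊗ₘ ψ)) ≫ (tpowAdd A _ 1).hom) := by
  rw [comp_whiskerLeft_tensorHom]
  refine hI.tensor ?_ hf
  exact (congrArg (I _) (Category.assoc _ _ _)).mp (hI.wordMem_str (.ρ_hom _) ha)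

theorem wordMem_gen {p : Word} {a : 𝟙_ C ⟶ evalObj S.data p ⊗ 𝟙_ C}
    (ha : WordMem S I (p.tensor .unit) a) (f : 𝟙_ C ⟶ A) (hf : I 1 (f ≫ toPow1 A)) :
    WordMem S I (p.tensor .gen) (a ≫ _ ◁ f) :=
  (congrArg (I _) (Category.assoc _ _ _)).mp (hI.wordMem_point ha f (toPow1 A) hf)

theorem wordMem_gen_gen {p : Word} {a : 𝟙_ C ⟶ evalObj S.data p ⊗ 𝟙_ C}
    (ha : WordMem S I (p.tensor .unit) a) (f : 𝟙_ C ⟶ A ⊗ A) (hf : I 2 (f ≫ toPow2 A)) :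
    WordMem S I (p.tensor (.tensor .gen .gen)) (a ≫ _ ◁ f) := by
  have h1 := hI.tensor (hI.wordMem_str (.ρ_hom _) ha) hf
  refine (congrArg (I _) ?_).mp h1
  rw [← flatten_gen_gen, powTensor]
  refine Eq.trans ?_ (Category.assoc _ _ _)
  refine congrArg (· ≫ (tpowAdd A _ 2).hom) ?_
  refine Eq.trans ?_ (comp_whiskerLeft_tensorHom a f _ _).symm
  exact congrArg (ptensor · _) (Category.assoc _ _ _)

theorem wordMem_mul {p : Word} {a : 𝟙_ C ⟶ evalObj S.data p ⊗ (A ⊗ A)}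
    (ha : WordMem S I (p.tensor (.tensor .gen .gen)) a) :
    WordMem S I (p.tensor .gen) (a ≫ _ ◁ μ[A]) := by
  have h1 := hI.mul_last (n := (unitLab p).names.length) ha
  refine (congrArg (I _) ?_).mp h1
  refine (Category.assoc _ _ _).trans (Eq.trans ?_ (Category.assoc _ _ _).symm)
  refine congrArg (a ≫ ·) ?_
  refine Eq.trans ?_ (mul_flatten_aux _).symm
  have := flatten_gen_gen (S := S)
  exact congrArg (fun ψ => ((_ ⊗ₘ ψ) ≫ _) ≫ _) this

theorem wordMem_term {x y : Word} (t : Term x y) : ∀ (p : Word)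
    {a : 𝟙_ C ⟶ evalObj S.data p ⊗ evalObj S.data x}, WordMem S I (p.tensor x) a →
      WordMem S I (p.tensor y) (a ≫ evalObj S.data p ◁ Presented.interpTerm S.data t) := by
  have str : ∀ {x y : Word} (p : Word) {s} (_ : Str S.data (unitLab x) (unitLab y) s)
      {a : 𝟙_ C ⟶ evalObj S.data p ⊗ evalObj S.data x}, WordMem S I (p.tensor x) a →
      WordMem S I (p.tensor y) (a ≫ evalObj S.data p ◁ s) :=
    fun p _ h _ ha => hI.wordMem_str (.whiskerLeft (unitLab p) h) ha
  have left : ∀ {x y z : Word} (p : Word) {f : evalObj S.data y ⟶ evalObj S.data z}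
      (_ : ∀ (p : Word) {a : 𝟙_ C ⟶ evalObj S.data p ⊗ evalObj S.data y}, WordMem S I (p.tensor y) a →
        WordMem S I (p.tensor z) (a ≫ evalObj S.data p ◁ f))
      {a : 𝟙_ C ⟶ evalObj S.data p ⊗ evalObj S.data x ⊗ evalObj S.data y},
      WordMem S I (p.tensor (x.tensor y)) a →
      WordMem S I (p.tensor (x.tensor z)) (a ≫ evalObj S.data p ◁ evalObj S.data x ◁ f) := by
    intro x y z p f ih a ha
    refine (congrArg (WordMem S I _) (wordMem_whiskerLeft_aux a f)).mpr ?_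
    exact hI.wordMem_str (x := (p.tensor x).tensor z) (.α_hom _ _ _)
      (ih (p.tensor x) (hI.wordMem_str (.α_inv _ _ _) ha))
  induction t with
  | id x => exact fun p _ ha => str p (.id _) ha
  | comp f g ih ih' =>
    intro p a ha
    refine (congrArg (WordMem S I _) ?_).mp (ih' p (ih p ha))
    exact (Category.assoc _ _ _).trans (congrArg (a ≫ ·) (whiskerLeft_comp _ _ _).symm)
  | whiskerLeft X f ih => exact fun p _ ha => left p ih ha
  | whiskerRight f Z ih =>
    intro p a ha
    refine (congrArg (WordMem S I _) (wordMem_whiskerRight_aux a _)).mpr ?_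
    exact str p (.β _ _) (left p ih (str p (.β _ _) ha))
  | α_hom => exact fun p _ ha => str p (.α_hom _ _ _) ha
  | α_inv => exact fun p _ ha => str p (.α_inv _ _ _) ha
  | l_hom => exact fun p _ ha => str p (.l_hom _) ha
  | l_inv => exact fun p _ ha => str p (.l_inv _) ha
  | ρ_hom => exact fun p _ ha => str p (.ρ_hom _) ha
  | ρ_inv => exact fun p _ ha => str p (.ρ_inv _) ha
  | β => exact fun p _ ha => str p (.β _ _) ha
  | mul => exact fun p _ ha => hI.wordMem_mul ha
  | one =>
    refine fun p _ ha => hI.wordMem_gen ha η[A] ?_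
    refine (congrArg (I 1) ?_).mp (hI.one 1)
    change (λ_ (𝟙_ C)).inv ≫ (𝟙 _ ⊗ₘ η[A]) = η[A] ≫ (λ_ A).inv
    rw [id_tensorHom, leftUnitor_inv_naturality]
  | R => exact fun p _ ha => hI.wordMem_gen_gen ha S.R hI.R
  | Rinv =>
    intro p a ha
    have h := str p (x := .tensor .gen .gen) (.β (.gen ()) (.gen ()))
      (hI.wordMem_gen_gen ha _ hI.Rinv)
    refine (congrArg (WordMem S I _) ?_).mp h
    refine (Category.assoc _ _ _).trans (congrArg (a ≫ ·) ?_)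
    refine (whiskerLeft_comp _ _ _).symm.trans (congrArg (_ ◁ ·) ?_)
    exact (Category.assoc _ _ _).trans ((congrArg (S.Rinv ≫ ·)
      (SymmetricCategory.symmetry A A)).trans (Category.comp_id _))
  | κ => exact fun p _ ha => hI.wordMem_gen ha S.κ hI.κ
  | κinv => exact fun p _ ha => hI.wordMem_gen ha S.κinv hI.κinv

theorem interp_mem {n : ℕ} (f : 𝟙_ XC ⟶ tpow XC.gen n) : I n (XC.interp S f) := by
  obtain ⟨h, e⟩ := exists_comparison_flatten S n
  have hf : I _ ((XC.functor S).map f ≫ (flatten S.data (unitLab (tpow XC.gen n : XC))).hom) := by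
    obtain ⟨t⟩ := f
    have h0 : WordMem S I (Word.unit.tensor .unit) (λ_ (𝟙_ C)).inv := by
      refine (congrArg (I 0) ?_).mp (hI.one 0)
      change 𝟙 _ = (λ_ (𝟙_ C)).inv ≫ (𝟙 _ ⊗ₘ 𝟙 _) ≫ (ρ_ (𝟙_ C)).hom
      rw [id_tensorHom_id, Category.id_comp, ← unitors_equal, Iso.inv_hom_id]
    have h1 := hI.wordMem_str (.l_hom _) (hI.wordMem_term t .unit h0)
    refine (congrArg (fun x => I _ (x ≫ _)) ?_).mp h1
    exact leftUnitor_inv_comp_whiskerLeft _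
  have hc := PowClosed.cast h.symm hf
  refine (congrArg (I n) ?_).mp hc
  rw [← Category.id_comp ((XC.functor S).map f)]
  exact comp_eqToHom_aux h (XC.interp_comp S f) e

end PowClosed

end Generation

end XCT

namespace XCT

open scoped MonObj

section Fullness

variable {C : Type u} [Category.{v} C] [MonoidalCategory C] [SymmetricCategory C]
  {A : C} [MonObj A] {S : XCStructure A}

/-- The elements that come from tangles are closed under the operations of an algebra object. -/
theorem XCFunctor.powClosed {Z : XCFunctor S} (h : Z.Compatible) (hX : Z.map 2 Tangle.X = VE.X S)
    (hXinv : Z.map 2 Tangle.Xinv = VE.Xinv S) (hK : Z.map 1 Tangle.K = VE.K S)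
    (hKinv : Z.map 1 Tangle.Kinv = VE.Kinv S) :
    PowClosed S fun n a => ∃ T, (Z.map n T).elt = a where
  one n := ⟨1, congrArg VE.elt (map_one (Z.map n))⟩
  R := ⟨_, congrArg VE.elt hX⟩
  Rinv := ⟨_, congrArg VE.elt hXinv⟩
  κ := ⟨_, congrArg VE.elt hKinv⟩
  κinv := ⟨_, congrArg VE.elt hK⟩
  tensor := by
    rintro n m _ _ ⟨T, rfl⟩ ⟨T', rfl⟩
    exact ⟨_, congrArg VE.elt (Z.map_tensor T T')⟩
  perm := by
    rintro n σ _ ⟨T, rfl⟩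
    exact ⟨_, congrArg VE.elt (h.permute 1 σ T)⟩
  mul := by
    rintro r k _ ⟨T, rfl⟩
    exact ⟨_, congrArg VE.elt (h.merge k T)⟩

theorem XCFunctor.full_of_compatible {Z : XCFunctor S} (h : Z.Compatible)
    (hX : Z.map 2 Tangle.X = VE.X S) (hXinv : Z.map 2 Tangle.Xinv = VE.Xinv S)
    (hK : Z.map 1 Tangle.K = VE.K S) (hKinv : Z.map 1 Tangle.Kinv = VE.Kinv S) : Z.Full := by
  intro n x
  obtain ⟨f, hf⟩ := x.mem
  obtain ⟨T, hT⟩ := (XCFunctor.powClosed h hX hXinv hK hKinv).interp_mem f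
  refine ⟨T.permute (x.perm * (Z.map n T).perm⁻¹) 1, ?_⟩
  rw [h.permute]
  ext1
  · change (Z.map n T).elt ≫ permMap A 1 = x.elt
    rw [permMap_one, Category.comp_id, hT, hf]
  · change x.perm * (Z.map n T).perm⁻¹ * (Z.map n T).perm * 1⁻¹ = x.perm
    simp

end Fullness

end XCT

theorem theorem4p6 {C : Type u} [Category.{v} C] [MonoidalCategory C] [SymmetricCategory C]
    (A : C) [MonObj A] (S : XCT.XCStructure A) :
    (∃! Z : XCT.XCFunctor S, Z.Compatible ∧
      Z.map 2 XCT.Tangle.X = XCT.VE.X S ∧ Z.map 2 XCT.Tangle.Xinv = XCT.VE.Xinv S ∧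
      Z.map 1 XCT.Tangle.K = XCT.VE.K S ∧ Z.map 1 XCT.Tangle.Kinv = XCT.VE.Kinv S) ∧
    (∀ Z : XCT.XCFunctor S, Z.Compatible ∧
      Z.map 2 XCT.Tangle.X = XCT.VE.X S ∧ Z.map 2 XCT.Tangle.Xinv = XCT.VE.Xinv S ∧
      Z.map 1 XCT.Tangle.K = XCT.VE.K S ∧ Z.map 1 XCT.Tangle.Kinv = XCT.VE.Kinv S → Z.Full) := by
  refine ⟨⟨XCT.tangleFunctor S, ⟨XCT.tangleFunctor_compatible S, XCT.tangleFunctor_X S,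
    XCT.tangleFunctor_Xinv S, XCT.tangleFunctor_K S, XCT.tangleFunctor_Kinv S⟩, ?_⟩, ?_⟩
  · rintro Z ⟨h, hX, hXinv, hK, hKinv⟩
    exact XCT.XCFunctor.eq_of_generators h (XCT.tangleFunctor_compatible S)
      (hX.trans (XCT.tangleFunctor_X S).symm) (hXinv.trans (XCT.tangleFunctor_Xinv S).symm)
      (hK.trans (XCT.tangleFunctor_K S).symm) (hKinv.trans (XCT.tangleFunctor_Kinv S).symm)
  · rintro Z ⟨h, hX, hXinv, hK, hKinv⟩
    exact XCT.XCFunctor.full_of_compatible h hX hXinv hK hKinv
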